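/- **Setting.** A delay function is a concave, continuous, monotonically increasing $D:[0,\infty)\to[0,\infty)$ with $D(0)=0$, $D(t)\to\infty$, and all one-sided derivatives positive and bounded. A weighted $2$-HST is a finite rooted tree $T$ with positive edge weights such that the edge from a vertex $v$ to any of its children weighs at most half of the edge from $v$ to its parent; its height $h\ge 1$ is the largest number of edges between the root and a leaf, and $\mathrm{dist}$ is the tree metric. An instance consists of finitely many requests $r$, each with an arrival time $a(r)\ge 0$, a leaf of $T$ as its location and a polarity $\pm$, with equally many positive and negative requests. A solution is a perfect matching of requests of opposite polarities, with a matching time $m(r)$ for each request, which is common to both requests of a pair and no earlier than the arrival of either. For a delay function $D$, its connection cost $\mathrm{SOL}_c$ is the sum of the distances of the matched pairs, its delay cost is $\mathrm{SOL}_d=\sum_r D(m(r)-a(r))$, and its cost is the sum of the two. **Counters.** Let $f$ be a piecewise linear function on $[0,\infty)$ with $f(0)=0$ and $f(t)\to\infty$, with finitely or infinitely many pieces $k=0,1,2,\dots$, of positive slopes $\alpha_k$ with $\alpha_{k+1}\le\alpha_k/2$; let $y_k$ be the increase of $f$ on piece $k$ and $S_k=y_0+\dots+y_k$ (both are $\infty$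 for a last, unbounded piece). Suppose that $f\le D\le 2f$. The tree of counters $F=F(T,f)$ has an edge counter for every edge $e$ of $T$, of capacity $w_e$, and delay counters $(v,k)$, with $v$ a vertex of $T$, of capacity $y_k$ and slope $\alpha_k$. On the way from a leaf of $T$ to the root, edge counters (by $w_e$) and delay counters (by $S_k$) are met in increasing order, every level $k$ exactly once: delay counter $k$ comes before edge $e$ iff $S_k<w_e$, and it is placed at the vertex that has been reached at that point, so that it is shared by all branches that meet it there. An edge counter has the slope of the first delay counter above it. A request arriving at a leaf is given to the first counter on the way from that leaf to the root. **BPMA.** Each counter $z$ has a positive copy $z^+$ and a negative copy $z^-$, both with the capacity and slope of $z$ and starting at level $0$. Positive requests are associated with positive copies and negative requests with negative ones. Let $sur_z(t)$ be the number of positive minus the number of negative requests associated at time $t$ with $z$ or its descendants in $F$. At all times: whenever $z^+$ and $z^-$ both have a request, two such requests are matched; $z^+$ (resp. $z^-$) increases at rate $\alpha_z|sur_z(t)|$ while it has a request and $sur_z(t)>0$ (resp. $<0$); when an increasing counter reaches its capacity, one of its requests moves to the copy, of the same polarity, of the parent of $z$ in $F$, and $z^+,z^-$ are both reset to $0$.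 All ties, including the order of simultaneous events, are broken arbitrarily. **Theorem.** There is an absolute constant $C>0$ such that the following holds for every delay function $D$. There is at least one $f$ as above with $f\le D\le 2f$; and for every such $f$, every weighted $2$-HST $T$ of height $h\ge 1$ and every instance, every run of BPMA with $F(T,f)$ can be continued until all requests are matched, and whenever a run has matched all requests, its matching is such that for every solution $\mathrm{SOL}$ of the instance $$\mathrm{BPMA}\;\le\; C\cdot \mathrm{SOL}_c+C\,h\cdot \mathrm{SOL}_d ,$$ where all costs are taken with respect to $D$. -/

import Mathlib

open Filter Topology

namespace ConcaveMatching

noncomputable section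

/-! ### Delay functions -/

/-- The standing assumptions on a delay function `D` (only its values on `[0, ∞)` matter):
`D 0 = 0`, concave, continuous, monotone, all one-sided derivatives positive and uniformly
bounded, and unbounded at infinity. -/
structure IsDelayFunction (D : ℝ → ℝ) : Prop where
  zero : D 0 = 0
  concave : ConcaveOn ℝ (Set.Ici 0) D
  continuousOn : ContinuousOn D (Set.Ici 0)
  monotoneOn : MonotoneOn D (Set.Ici 0)
  derivs : ∃ B : ℝ,
    (∀ t d, 0 ≤ t → HasDerivWithinAt D d (Set.Ici t) t → 0 < d ∧ d ≤ B) ∧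
    (∀ t d, 0 < t → HasDerivWithinAt D d (Set.Iic t) t → 0 < d ∧ d ≤ B)
  tendsto : Tendsto D atTop atTop

/-- A piecewise linear function `f` on `[0, ∞)` with `f 0 = 0`, `f → ∞`, finitely or infinitely many
pieces, positive slopes, and each slope at most half of the preceding one. There are `pieces` many
pieces, numbered from `0`. Piece `k` has slope `slope k`; it is `[x k, x (k+1)]`, or `[x k, ∞)` if
it is the last one. -/
structure PiecewiseLinearDelay where
  f : ℝ → ℝ
  pieces : ℕ∞
  x : ℕ → ℝ
  slope : ℕ → ℝ
  x_zero : x 0 = 0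
  x_lt : ∀ k : ℕ, ((k + 1 : ℕ) : ℕ∞) < pieces → x k < x (k + 1)
  cover : ∀ t : ℝ, 0 ≤ t → ∃ k : ℕ, (k : ℕ∞) < pieces ∧ x k ≤ t ∧
    (((k + 1 : ℕ) : ℕ∞) < pieces → t ≤ x (k + 1))
  slope_pos : ∀ k : ℕ, (k : ℕ∞) < pieces → 0 < slope k
  slope_halves : ∀ k : ℕ, ((k + 1 : ℕ) : ℕ∞) < pieces → 2 * slope (k + 1) ≤ slope k
  f_zero : f 0 = 0
  f_linear : ∀ k : ℕ, (k : ℕ∞) < pieces → ∀ t : ℝ, x k ≤ t →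
    (((k + 1 : ℕ) : ℕ∞) < pieces → t ≤ x (k + 1)) → f t = f (x k) + slope k * (t - x k)
  tendsto : Tendsto f atTop atTop

namespace PiecewiseLinearDelay

variable (p : PiecewiseLinearDelay)

/-- `f ≤ D ≤ 2 f` on `[0, ∞)`. -/
def Approximates (D : ℝ → ℝ) : Prop :=
  ∀ t : ℝ, 0 ≤ t → p.f t ≤ D t ∧ D t ≤ 2 * p.f t

/-- The height `y_k` gained on piece `k` (infinite for the last piece). -/
def height (k : ℕ) : WithTop ℝ :=
  if ((k + 1 : ℕ) : ℕ∞) < p.pieces then ((p.f (p.x (k + 1)) - p.f (p.x k) : ℝ) : WithTop ℝ) else ⊤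

/-- The total height `y_0 + ... + y_k` of pieces `0, ..., k`, i.e. the value of `f` at the end of
piece `k` (infinite for the last piece). -/
def cumHeight (k : ℕ) : WithTop ℝ :=
  if ((k + 1 : ℕ) : ℕ∞) < p.pieces then ((p.f (p.x (k + 1)) : ℝ) : WithTop ℝ) else ⊤

/-- The first piece whose cumulative height is at least `w`. -/
def firstPiece (w : ℝ) : ℕ := sInf {k : ℕ | (w : WithTop ℝ) ≤ p.cumHeight k}

end PiecewiseLinearDelay

/-! ### Weighted hierarchically separated trees -/

/-- A finite weighted `σ`-HST on a rooted tree `T` (root `⊥`, parent `Order.pred`, `u ≤ v` iff `u` is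
an ancestor of `v` or `v` itself, leaves are the maximal elements). Every edge joins some `v ≠ ⊥` to
its parent and is named by its lower end `v`; `weight v` is its weight. -/
structure WeightedHST (σ : ℝ) (T : RootedTree) where
  weight : T → ℝ
  weight_pos : ∀ v : T, v ≠ ⊥ → 0 < weight v
  separated : ∀ v : T, v ≠ ⊥ → Order.pred v ≠ ⊥ → weight v ≤ 1 / σ * weight (Order.pred v)

open scoped Classical in
/-- The number of edges between `v` and the root. -/
def depth (T : RootedTree) [Fintype T] (v : T) : ℕ :=
  (Finset.univ.filter fun u : T => u ≠ ⊥ ∧ u ≤ v).card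

/-- The largest number of edges between the root and a vertex (equivalently, a leaf). -/
def treeHeight (T : RootedTree) [Fintype T] : ℕ :=
  Finset.univ.sup (depth T)

namespace WeightedHST

variable {σ : ℝ} {T : RootedTree} (H : WeightedHST σ T) (p : PiecewiseLinearDelay)

open scoped Classical in
/-- The tree metric. The path between `u` and `v` consists of the edges that have exactly one of
`u`, `v` below them. -/
def dist [Fintype T] (u v : T) : ℝ :=
  ∑ e ∈ Finset.univ.filter (fun e : T => e ≠ ⊥ ∧ Xor (e ≤ u) (e ≤ v)), H.weight e

end WeightedHST

/-! ### The tree of counters -/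

/-- `edge v` is the counter of the edge between `v` and its parent; `delay v k` is the counter of
piece `k` of the delay function that is placed at the vertex `v`. The counters in use are those that
are reached from a leaf by `WeightedHST.entry` and `WeightedHST.next`. -/
inductive Counter (T : RootedTree)
  | edge (v : T)
  | delay (v : T) (k : ℕ)

namespace WeightedHST

variable {σ : ℝ} {T : RootedTree} (H : WeightedHST σ T) (p : PiecewiseLinearDelay)

open scoped Classical in
/-- The next counter for a request that stands at the vertex `v` and has passed all delay counters
before `k`. On the way from a leaf to the root, edge counters (by weight) and delay counters (by
cumulative height) are met in increasing order: delay counter `k` comes before the edge above `v` if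
its cumulative height is less than the weight of this edge, and there is no edge above the root. -/
def climb (v : T) (k : ℕ) : Counter T :=
  if v = ⊥ ∨ p.cumHeight k < (H.weight v : WithTop ℝ) then Counter.delay v k else Counter.edge v

/-- The counter given to a request that arrives at `v`. -/
def entry (v : T) : Counter T := H.climb p v 0

/-- The parent of a counter. Above the edge counter of `v` one continues at the parent of `v` with
the first delay counter whose cumulative height is at least the weight of the edge. -/
def next : Counter T → Counter T
  | .edge v => H.climb p (Order.pred v) (p.firstPiece (H.weight v))
  | .delay v k => H.climb p v (k + 1)

/-- The capacity of a counter: the weight of the edge, or the height of the piece. -/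
def capacity : Counter T → WithTop ℝ
  | .edge v => (H.weight v : WithTop ℝ)
  | .delay _ k => p.height k

/-- The slope of a counter. An edge counter has the slope of the first delay counter above it. -/
def slope : Counter T → ℝ
  | .edge v => p.slope (p.firstPiece (H.weight v))
  | .delay _ k => p.slope k

/-- `z'` is `z` or a descendant of `z`. -/
def IsDescendant (z' z : Counter T) : Prop := ∃ n : ℕ, (H.next p)^[n] z' = z

end WeightedHST

/-! ### Instances and solutions -/

/-- Finitely many requests, each with an arrival time, a location (a leaf) and a polarity (`1` or
`-1`), with as many positive as negative requests. -/
structure RequestSequence (T : RootedTree) (R : Type*) [Fintype R] where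
  arrival : R → ℝ
  arrival_nonneg : ∀ r, 0 ≤ arrival r
  loc : R → T
  loc_leaf : ∀ r, IsMax (loc r)
  pol : R → ℤˣ
  balanced : ∑ r, (pol r : ℤ) = 0

/-- A perfect matching of the requests into pairs of opposite polarity, with the time at which each
request is matched; a pair is matched at a time at which both its requests have arrived. -/
structure Solution {T : RootedTree} {R : Type*} [Fintype R] (I : RequestSequence T R) where
  partner : R → R
  time : R → ℝ
  partner_partner : ∀ r, partner (partner r) = r
  pol_partner : ∀ r, I.pol (partner r) = -I.pol r
  time_partner : ∀ r, time (partner r) = time r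
  arrival_le : ∀ r, I.arrival r ≤ time r

namespace Solution

variable {σ : ℝ} {T : RootedTree} {R : Type*} [Fintype R] {I : RequestSequence T R}

/-- Sum of the distances over all matched pairs (each pair is counted from both sides). -/
def connectionCost [Fintype T] (S : Solution I) (H : WeightedHST σ T) : ℝ :=
  (∑ r, H.dist (I.loc r) (I.loc (S.partner r))) / 2

/-- Sum of the delays over all requests. -/
def delayCost (S : Solution I) (D : ℝ → ℝ) : ℝ :=
  ∑ r, D (S.time r - I.arrival r)

/-- Connection cost plus delay cost. -/
def cost [Fintype T] (S : Solution I) (H : WeightedHST σ T) (D : ℝ → ℝ) : ℝ :=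
  S.connectionCost H + S.delayCost D

end Solution

/-! ### The algorithm BPMA -/

/-- The status of a request: not yet arrived, associated with a counter, or matched. -/
inductive Status (T : RootedTree) (R : Type*)
  | future
  | waiting (z : Counter T)
  | matched (partner : R) (time : ℝ)

/-- A configuration of the algorithm. `level z s` is the level of `z⁺` (for `s = 1`), resp. of `z⁻`
(for `s = -1`). -/
structure Config (T : RootedTree) (R : Type*) where
  time : ℝ
  status : R → Status T R
  level : Counter T → ℤˣ → ℝ

namespace Config

variable {σ : ℝ} {T : RootedTree} {R : Type*} [Fintype R]
  (H : WeightedHST σ T) (p : PiecewiseLinearDelay) (I : RequestSequence T R)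

/-- At time `0` no request has arrived and all counters are at level `0`. -/
def initial (T : RootedTree) (R : Type*) : Config T R where
  time := 0
  status := fun _ => .future
  level := fun _ _ => 0

open scoped Classical in
/-- The surplus of `z`: the number of positive minus the number of negative requests associated
with `z` or its descendants. -/
def surplus (c : Config T R) (z : Counter T) : ℤ :=
  ∑ r ∈ Finset.univ.filter
    (fun r => ∃ z', c.status r = .waiting z' ∧ H.IsDescendant p z' z), (I.pol r : ℤ)

/-- A request of polarity `s` is associated with `z`. -/
def Occupied (c : Config T R) (z : Counter T) (s : ℤˣ) : Prop :=
  ∃ r, c.status r = .waiting z ∧ I.pol r = s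

/-- The counter `z⁺` (`s = 1`) increases iff a positive request is associated with it and the
surplus of `z` is positive; symmetrically for `z⁻` (`s = -1`). -/
def Increases (c : Config T R) (z : Counter T) (s : ℤˣ) : Prop :=
  c.Occupied I z s ∧ 0 < (s : ℤ) * c.surplus H p I z

open scoped Classical in
/-- The rate of increase of a counter. -/
def rate (c : Config T R) (z : Counter T) (s : ℤˣ) : ℝ :=
  if c.Increases H p I z s then H.slope p z * |(c.surplus H p I z : ℝ)| else 0

/-- No counter `z` has both a positive request on `z⁺` and a negative one on `z⁻`. -/
def NoMatchable (c : Config T R) : Prop :=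
  ∀ z, ¬ (c.Occupied I z 1 ∧ c.Occupied I z (-1))

open scoped Classical in
/-- The steps of the algorithm. Arrivals, matches and moves take no time and may be interleaved in
any order, with all ties broken arbitrarily. Time passes only while no request is due, none can be
matched, and no increasing counter is full; meanwhile all surpluses are constant, so that all
counters grow linearly. -/
inductive Step : Config T R → Config T R → Prop
  /-- A request arrives and is associated with the counter at which its location enters. -/
  | arrive (c : Config T R) (r : R) (h : c.status r = .future) (ht : c.time = I.arrival r) :
      Step c { c with status := Function.update c.status r (.waiting (H.entry p (I.loc r))) }
  /-- Two requests of opposite polarities on corresponding counters are matched. -/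
  | pair (c : Config T R) (r r' : R) (z : Counter T)
      (h : c.status r = .waiting z) (h' : c.status r' = .waiting z)
      (hpol : I.pol r' = -I.pol r) :
      Step c { c with
        status := Function.update (Function.update c.status r (.matched r' c.time)) r'
          (.matched r c.time) }
  /-- A full counter sends one of its requests to the parent counter; the positive and the negative
  counter are both reset. -/
  | move (c : Config T R) (r : R) (z : Counter T)
      (h : c.status r = .waiting z) (hinc : c.Increases H p I z (I.pol r))
      (hopp : ¬ c.Occupied I z (-I.pol r))
      (hfull : ((c.level z (I.pol r) : ℝ) : WithTop ℝ) = H.capacity p z) :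
      Step c { c with
        status := Function.update c.status r (.waiting (H.next p z))
        level := Function.update c.level z (fun _ => 0) }
  /-- An amount `τ` of time passes. -/
  | elapse (c : Config T R) (τ : ℝ) (hτ : 0 < τ)
      (hfuture : ∀ r, c.status r = .future → c.time + τ ≤ I.arrival r)
      (hmatch : c.NoMatchable I)
      (hcap : ∀ z s, c.Increases H p I z s →
        ((c.level z s + c.rate H p I z s * τ : ℝ) : WithTop ℝ) ≤ H.capacity p z) :
      Step c { c with
        time := c.time + τ
        level := fun z s => c.level z s + c.rate H p I z s * τ }

/-- Any number of steps. -/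
def Steps : Config T R → Config T R → Prop := Relation.ReflTransGen (Step H p I)

/-- `c` occurs in some run of the algorithm. -/
def Reachable (c : Config T R) : Prop := Steps H p I (initial T R) c

/-- In `c` all requests are matched, as prescribed by the solution `S`. -/
def Yields {I : RequestSequence T R} (c : Config T R) (S : Solution I) : Prop :=
  ∀ r, c.status r = .matched (S.partner r) (S.time r)

end Config

end

end ConcaveMatching

/-!
The algorithm is analysed with a potential function, one counter at a time.

On its way to the root a request meets a path of counters (`OnPath`), ordered by `position`. A
solution is made to follow the same paths: the request `r` stays at or below the counter `z` until
it has waited to the end of the piece of `z`, or until it is matched (`deadline`). So every counter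
has two surpluses, that of the algorithm (`surplus`) and that of the solution (`offSurplus`), and a
`gap` between them. If the gap is positive, then moving a positive request out of `z` decreases it,
and the growth of the positive copy of `z` can be paid for by the potential, which is proportional
to the capacity times the gap. Otherwise the surplus of the algorithm is at most that of the solution,
and the growth is charged to the requests that the solution keeps waiting at the same slope. A
change of the surplus of the solution costs it the capacity of the counter. See `potential_jump`,
`potential_move`, `potential_grow`, and `sum_charge_increment` for the solution.

The algorithm, in turn, pays only for growth. A move costs the capacity of the counter, which had to
fill up before. At any time the sum of the slopes at which requests are waiting is at most twice the
total rate of the increasing counters (`sum_waitRate_le`): a counter whose requests are in the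
minority of its surplus has children with large surpluses of the opposite sign, and slopes decrease
towards the root. Waiting at these slopes bounds the delay, because `f` lies below the line of slope
`slope k` that is shifted up to `f (x k)` at the origin (`f_le_line`). All of this is the statement
that `Invariant` is preserved by every step.

What the solution is charged for one request is computed in `sum_charge_le`. The weights of the
edges of a path grow geometrically and every piece is met once, so the counters passed by waiting
have a total capacity of at most three times the delay, and those passed because two matched
requests are far apart have one of at most twice the distance. The slopes of the delay counters halve, so
waiting below them costs a constant factor; the edges of a path, which may all have the same slope,
cost a factor of the height of the tree.

The invariant also bounds the index of every counter in use, whence a run cannot move requests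
forever. As a lowest counter with a request increases unless two requests can be matched, every run
reaches a configuration in which all requests are matched.

The function `f` interpolates `D` between breakpoints: from each breakpoint one follows the line of
half the right derivative of `D` to the last point at which it meets `D` (`sSup_aboveHalf`).
-/

open Filter Topology

namespace ConcaveMatching

/-! ### Piecewise linear approximation of a delay function -/

namespace IsDelayFunction

variable {D : ℝ → ℝ}

lemma exists_lipschitz (hD : IsDelayFunction D) :
    ∃ B : ℝ, ∀ x t, 0 ≤ x → x < t → D t - D x ≤ B * (t - x) := by
  obtain ⟨B, hB, -⟩ := hD.derivs
  refine ⟨B, ?_⟩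
  have key : ∀ x t, 0 < x → x < t → D t - D x ≤ B * (t - x) := by
    intro x t hx hxt
    have hint : x ∈ interior (Set.Ici (0 : ℝ)) := by simpa using hx
    have hd : DifferentiableWithinAt ℝ D (Set.Ioi x) x := by
      have := hD.concave.neg.differentiableWithinAt_Ioi_of_mem_interior hint
      simpa using this.neg
    have h1 := hd.hasDerivWithinAt
    have h2 := hD.concave.slope_le_rightDeriv hx.le (hx.le.trans hxt.le) hxt hd
    have h3 := (hB x _ hx.le (hasDerivWithinAt_Ioi_iff_Ici.mp h1)).2
    rw [slope_def_field] at h2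
    have h4 := h2.trans h3
    rwa [div_le_iff₀ (sub_pos.mpr hxt)] at h4
  intro x t hx hxt
  rcases hx.eq_or_lt with rfl | hx
  · have hc : Tendsto D (𝓝[>] 0) (𝓝 (D 0)) :=
      (hD.continuousOn 0 (by simp)).mono_left (nhdsWithin_mono _ Set.Ioi_subset_Ici_self)
    have h1 : Tendsto (fun y => D t - D y) (𝓝[>] 0) (𝓝 (D t - D 0)) := hc.const_sub _
    have h2 : Tendsto (fun y => B * (t - y)) (𝓝[>] (0 : ℝ)) (𝓝 (B * (t - 0))) := by
      apply Tendsto.mono_left _ nhdsWithin_le_nhds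
      exact Continuous.tendsto (by fun_prop) 0
    refine le_of_tendsto_of_tendsto h1 h2 ?_
    filter_upwards [Ioo_mem_nhdsGT hxt] with y hy
    exact key y t hy.1 hy.2
  · exact key x t hx hxt

end IsDelayFunction

/-- The supremum of the slopes of the chords of `D` that start at `x`; for concave `D` this is the
right derivative of `D` at `x`. -/
noncomputable def chordSup (D : ℝ → ℝ) (x : ℝ) : ℝ :=
  sSup ((fun t => (D t - D x) / (t - x)) '' Set.Ioi x)

/-- The points beyond `x` at which `D` is at least the line through `(x, D x)` that has half the
initial slope of `D` at `x`. -/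
def aboveHalf (D : ℝ → ℝ) (x : ℝ) : Set ℝ :=
  {t | x < t ∧ D x + chordSup D x / 2 * (t - x) ≤ D t}

/-- The breakpoints of the approximation: the line of half slope from one breakpoint meets `D` for
the last time at the next one. -/
noncomputable def breakpoint (D : ℝ → ℝ) : ℕ → ℝ
  | 0 => 0
  | k + 1 => sSup (aboveHalf D (breakpoint D k))

open scoped Classical in
/-- The number of pieces: a piece is the last one iff the line of half slope stays below `D`. -/
noncomputable def numPieces (D : ℝ → ℝ) : ℕ∞ :=
  if h : ∃ k, ¬ BddAbove (aboveHalf D (breakpoint D k)) then ((Nat.find h + 1 : ℕ) : ℕ∞) else ⊤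

/-- The point `t` lies on the `k`-th piece. -/
def OnPiece (D : ℝ → ℝ) (k : ℕ) (t : ℝ) : Prop :=
  (k : ℕ∞) < numPieces D ∧ breakpoint D k ≤ t ∧
    (((k + 1 : ℕ) : ℕ∞) < numPieces D → t ≤ breakpoint D (k + 1))

open scoped Classical in
/-- The function that interpolates `D` linearly between the breakpoints. -/
noncomputable def interpolation (D : ℝ → ℝ) (t : ℝ) : ℝ :=
  if h : ∃ k, OnPiece D k t then
    D (breakpoint D h.choose) + chordSup D (breakpoint D h.choose) / 2 * (t - breakpoint D h.choose)
  else 0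

lemma lt_numPieces_iff {D : ℝ → ℝ} {k : ℕ} :
    (k : ℕ∞) < numPieces D ↔ ∀ j < k, BddAbove (aboveHalf D (breakpoint D j)) := by
  classical
  unfold numPieces
  split_ifs with h
  · rw [Nat.cast_lt, Nat.lt_succ_iff, Nat.le_find_iff]
    simp
  · push Not at h
    simp [h]

namespace IsDelayFunction

variable {D : ℝ → ℝ}


lemma bddAbove_chords (hD : IsDelayFunction D) {x : ℝ} (hx : 0 ≤ x) :
    BddAbove ((fun t => (D t - D x) / (t - x)) '' Set.Ioi x) := by
  obtain ⟨B, hB⟩ := hD.exists_lipschitz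
  refine ⟨B, ?_⟩
  rintro _ ⟨t, ht, rfl⟩
  exact (div_le_iff₀ (sub_pos.mpr ht)).mpr (hB x t hx ht)

lemma sub_le_chordSup (hD : IsDelayFunction D) {x t : ℝ} (hx : 0 ≤ x) (hxt : x ≤ t) :
    D t - D x ≤ chordSup D x * (t - x) := by
  rcases hxt.eq_or_lt with rfl | hxt
  · simp
  rw [← div_le_iff₀ (sub_pos.mpr hxt)]
  exact le_csSup (hD.bddAbove_chords hx) ⟨t, hxt, rfl⟩

lemma exists_gt (hD : IsDelayFunction D) (x : ℝ) : ∃ t, x < t ∧ D x < D t :=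
  ((eventually_gt_atTop x).and (hD.tendsto.eventually_gt_atTop (D x))).exists

lemma chordSup_pos (hD : IsDelayFunction D) {x : ℝ} (hx : 0 ≤ x) : 0 < chordSup D x := by
  obtain ⟨t, ht, h⟩ := hD.exists_gt x
  have := hD.sub_le_chordSup hx ht.le
  by_contra! hc
  nlinarith

lemma aboveHalf_nonempty (hD : IsDelayFunction D) {x : ℝ} (hx : 0 ≤ x) :
    (aboveHalf D x).Nonempty := by
  have h := half_lt_self (hD.chordSup_pos hx)
  obtain ⟨_, ⟨t, ht, rfl⟩, h⟩ := exists_lt_of_lt_csSup (Set.nonempty_Ioi.image _) h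
  have ht : x < t := ht
  refine ⟨t, ht, ?_⟩
  rw [lt_div_iff₀ (sub_pos.mpr ht)] at h
  linarith

lemma line_le_of_mem_aboveHalf (hD : IsDelayFunction D) {x t u : ℝ} (hx : 0 ≤ x)
    (ht : t ∈ aboveHalf D x) (hu : x ≤ u) (hut : u ≤ t) :
    D x + chordSup D x / 2 * (u - x) ≤ D u := by
  obtain ⟨hxt, ht⟩ := ht
  have hp : 0 < t - x := sub_pos.mpr hxt
  have hc := hD.concave.2 (Set.mem_Ici.mpr hx) (Set.mem_Ici.mpr (hx.trans hxt.le))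
    (div_nonneg (sub_nonneg.mpr hut) hp.le) (div_nonneg (sub_nonneg.mpr hu) hp.le)
    (by field_simp; ring)
  have he : ((t - u) / (t - x)) • x + ((u - x) / (t - x)) • t = u := by
    simp only [smul_eq_mul]; field_simp; ring
  rw [he] at hc
  refine le_trans ?_ hc
  simp only [smul_eq_mul]
  have hβ : 0 ≤ (u - x) / (t - x) := div_nonneg (sub_nonneg.mpr hu) hp.le
  calc D x + chordSup D x / 2 * (u - x)
      = (t - u) / (t - x) * D x +
          (u - x) / (t - x) * (D x + chordSup D x / 2 * (t - x)) := by field_simp; ring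
    _ ≤ _ := by gcongr

/-- At the end of a bounded piece the line meets `D`, and from there on `D` has at most the slope of
the line. -/
lemma sSup_aboveHalf (hD : IsDelayFunction D) {x : ℝ} (hx : 0 ≤ x) (hb : BddAbove (aboveHalf D x)) :
    x < sSup (aboveHalf D x) ∧
      D (sSup (aboveHalf D x)) = D x + chordSup D x / 2 * (sSup (aboveHalf D x) - x) ∧
      chordSup D (sSup (aboveHalf D x)) ≤ chordSup D x / 2 := by
  set y := sSup (aboveHalf D x) with hy
  obtain ⟨t0, ht0⟩ := hD.aboveHalf_nonempty hx
  have hxy : x < y := ht0.1.trans_le (le_csSup hb ht0)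
  have hlt : ∀ t, y < t → D t < D x + chordSup D x / 2 * (t - x) := by
    intro t ht
    by_contra! h
    exact absurd (le_csSup hb (show t ∈ aboveHalf D x from ⟨hxy.trans ht, h⟩)) (not_le.mpr ht)
  have hy0 : 0 ≤ y := hx.trans hxy.le
  have hcl : Tendsto (fun t => D x + chordSup D x / 2 * (t - x)) (𝓝 y)
      (𝓝 (D x + chordSup D x / 2 * (y - x))) := Continuous.tendsto (by fun_prop) y
  have hcont : ContinuousAt D y :=
    (hD.continuousOn y hy0).continuousAt (Ici_mem_nhds (hx.trans_lt hxy))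
  have hcD : Tendsto D (𝓝 y) (𝓝 (D y)) := hcont
  have hle : D y ≤ D x + chordSup D x / 2 * (y - x) := by
    refine le_of_tendsto_of_tendsto (hcD.mono_left (nhdsWithin_le_nhds (s := Set.Ioi y)))
      (hcl.mono_left nhdsWithin_le_nhds) ?_
    filter_upwards [self_mem_nhdsWithin] with t ht
    exact (hlt t ht).le
  have hge : D x + chordSup D x / 2 * (y - x) ≤ D y := by
    refine le_of_tendsto_of_tendsto (hcl.mono_left (nhdsWithin_le_nhds (s := Set.Iio y)))
      (hcD.mono_left nhdsWithin_le_nhds) ?_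
    filter_upwards [Ioo_mem_nhdsLT hxy] with t ht
    obtain ⟨s, hs, hts⟩ := exists_lt_of_lt_csSup ⟨t0, ht0⟩ ht.2
    exact hD.line_le_of_mem_aboveHalf hx hs ht.1.le hts.le
  have heq := le_antisymm hle hge
  refine ⟨hxy, heq, ?_⟩
  refine csSup_le (Set.nonempty_Ioi.image _) ?_
  rintro _ ⟨t, ht, rfl⟩
  have ht : y < t := ht
  simp only
  rw [div_le_iff₀ (sub_pos.mpr ht), heq]
  nlinarith [hlt t ht]

lemma breakpoint_step (hD : IsDelayFunction D) (k : ℕ) :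
    ((k : ℕ∞) < numPieces D → 0 ≤ breakpoint D k) ∧
    (((k + 1 : ℕ) : ℕ∞) < numPieces D →
      breakpoint D k < breakpoint D (k + 1) ∧
      D (breakpoint D (k + 1)) = D (breakpoint D k) +
        chordSup D (breakpoint D k) / 2 * (breakpoint D (k + 1) - breakpoint D k) ∧
      chordSup D (breakpoint D (k + 1)) ≤ chordSup D (breakpoint D k) / 2) := by
  induction k with
  | zero =>
    refine ⟨fun _ => le_rfl, fun h => ?_⟩
    exact hD.sSup_aboveHalf le_rfl (lt_numPieces_iff.mp h 0 (by simp))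
  | succ k ih =>
    have h0 : ((k + 1 : ℕ) : ℕ∞) < numPieces D → 0 ≤ breakpoint D (k + 1) := by
      intro h
      have hk : (k : ℕ∞) < numPieces D := lt_trans (by exact_mod_cast Nat.lt_succ_self k) h
      exact (ih.1 hk).trans (ih.2 h).1.le
    refine ⟨h0, fun h => ?_⟩
    have hk : ((k + 1 : ℕ) : ℕ∞) < numPieces D :=
      lt_trans (by exact_mod_cast Nat.lt_succ_self (k + 1)) h
    exact hD.sSup_aboveHalf (h0 hk) (lt_numPieces_iff.mp h (k + 1) (by simp))

lemma breakpoint_mono (hD : IsDelayFunction D) {j k : ℕ} (hjk : j ≤ k)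
    (hk : (k : ℕ∞) < numPieces D) : breakpoint D j ≤ breakpoint D k := by
  induction k, hjk using Nat.le_induction with
  | base => exact le_rfl
  | succ k hjk ih =>
    have hk' : (k : ℕ∞) < numPieces D := lt_trans (by exact_mod_cast Nat.lt_succ_self k) hk
    exact (ih hk').trans ((hD.breakpoint_step k).2 hk).1.le

lemma exists_onPiece (hD : IsDelayFunction D) {t : ℝ} (ht : 0 ≤ t) : ∃ k, OnPiece D k t := by
  by_contra! hno
  have hall : ∀ k : ℕ, (k : ℕ∞) < numPieces D ∧ breakpoint D k ≤ t := by
    intro k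
    induction k with
    | zero => exact ⟨lt_numPieces_iff.mpr (by simp), ht⟩
    | succ k ih =>
      have := hno k
      unfold OnPiece at this
      push Not at this
      obtain ⟨h1, h2⟩ := this ih.1 ih.2
      exact ⟨h1, h2.le⟩
  obtain ⟨u, htu, hu⟩ := hD.exists_gt t
  have hslope : ∀ k : ℕ, chordSup D (breakpoint D k) ≤ chordSup D 0 * (1 / 2) ^ k := by
    intro k
    induction k with
    | zero => simp [breakpoint]
    | succ k ih =>
      have := ((hD.breakpoint_step k).2 (hall (k + 1)).1).2.2
      rw [pow_succ]
      linarith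
  have hbound : ∀ k : ℕ, D u - D t ≤ chordSup D 0 * (1 / 2) ^ k * u := by
    intro k
    have h0 := (hD.breakpoint_step k).1 (hall k).1
    have h1 := hD.sub_le_chordSup h0 ((hall k).2.trans htu.le)
    have h2 := hD.monotoneOn h0 ht (hall k).2
    have h3 := hD.chordSup_pos h0
    calc D u - D t ≤ D u - D (breakpoint D k) := by linarith
      _ ≤ chordSup D (breakpoint D k) * (u - breakpoint D k) := h1
      _ ≤ chordSup D (breakpoint D k) * u := by nlinarith
      _ ≤ _ := mul_le_mul_of_nonneg_right (hslope k) (ht.trans htu.le)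
  have hlim : Tendsto (fun k : ℕ => chordSup D 0 * (1 / 2) ^ k * u) atTop (𝓝 0) := by
    have := (tendsto_pow_atTop_nhds_zero_of_lt_one (r := (1 / 2 : ℝ)) (by norm_num)
      (by norm_num)).const_mul (chordSup D 0) |>.mul_const u
    simpa using this
  have := ge_of_tendsto' hlim hbound
  linarith

lemma interpolation_eq (hD : IsDelayFunction D) {k : ℕ} {t : ℝ} (h : OnPiece D k t) :
    interpolation D t =
      D (breakpoint D k) + chordSup D (breakpoint D k) / 2 * (t - breakpoint D k) := by
  have key : ∀ i j, i < j → OnPiece D i t → OnPiece D j t →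
      D (breakpoint D i) + chordSup D (breakpoint D i) / 2 * (t - breakpoint D i) =
      D (breakpoint D j) + chordSup D (breakpoint D j) / 2 * (t - breakpoint D j) := by
    intro i j hij hi hj
    have hi1 : ((i + 1 : ℕ) : ℕ∞) < numPieces D :=
      lt_of_le_of_lt (by exact_mod_cast hij) hj.1
    have h1 := hi.2.2 hi1
    have h2 := hD.breakpoint_mono hij hj.1
    have ht : t = breakpoint D j := le_antisymm (h1.trans h2) hj.2.1
    have hjeq : j = i + 1 := by
      by_contra hne
      obtain ⟨m, rfl⟩ : ∃ m, j = m + 1 := ⟨j - 1, by omega⟩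
      have h3 := ((hD.breakpoint_step m).2 hj.1).1
      have h4 := hD.breakpoint_mono (j := i + 1) (k := m) (by omega)
        (lt_trans (by exact_mod_cast Nat.lt_succ_self m) hj.1)
      linarith
    subst hjeq
    rw [ht, ((hD.breakpoint_step i).2 hi1).2.1]
    ring
  have hex : ∃ k, OnPiece D k t := ⟨k, h⟩
  unfold interpolation
  rw [dif_pos hex]
  rcases lt_trichotomy hex.choose k with hlt | heq | hlt
  · exact key _ _ hlt hex.choose_spec h
  · rw [heq]
  · exact (key _ _ hlt h hex.choose_spec).symm

lemma interpolation_approx (hD : IsDelayFunction D) {t : ℝ} (ht : 0 ≤ t) :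
    interpolation D t ≤ D t ∧ D t ≤ 2 * interpolation D t := by
  obtain ⟨k, hk⟩ := hD.exists_onPiece ht
  have h0 := (hD.breakpoint_step k).1 hk.1
  rw [hD.interpolation_eq hk]
  constructor
  · by_cases hb : BddAbove (aboveHalf D (breakpoint D k))
    · have hk1 : ((k + 1 : ℕ) : ℕ∞) < numPieces D := by
        refine lt_numPieces_iff.mpr fun j hj => ?_
        rcases Nat.lt_succ_iff_lt_or_eq.mp hj with h | rfl
        · exact lt_numPieces_iff.mp hk.1 j h
        · exact hb
      obtain ⟨h1, h2, -⟩ := (hD.breakpoint_step k).2 hk1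
      exact hD.line_le_of_mem_aboveHalf h0 ⟨h1, h2.ge⟩ hk.2.1 (hk.2.2 hk1)
    · rw [not_bddAbove_iff] at hb
      obtain ⟨u, hu, htu⟩ := hb t
      exact hD.line_le_of_mem_aboveHalf h0 hu hk.2.1 htu.le
  · have h1 := hD.sub_le_chordSup h0 hk.2.1
    have h2 : 0 ≤ D (breakpoint D k) := by
      rw [← hD.zero]
      exact hD.monotoneOn (by simp) h0 h0
    linarith

/-- Every delay function is approximated within a factor of two by a piecewise linear function whose
slopes at least halve from piece to piece. -/
theorem exists_approximates (hD : IsDelayFunction D) :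
    ∃ p : PiecewiseLinearDelay, p.Approximates D := by
  refine ⟨{ f := interpolation D
            pieces := numPieces D
            x := breakpoint D
            slope := fun k => chordSup D (breakpoint D k) / 2
            x_zero := rfl
            x_lt := fun k hk => ((hD.breakpoint_step k).2 hk).1
            cover := fun t ht => hD.exists_onPiece ht
            slope_pos := fun k hk => half_pos (hD.chordSup_pos ((hD.breakpoint_step k).1 hk))
            slope_halves := fun k hk => ?_
            f_zero := ?_
            f_linear := fun k hk t h1 h2 => ?_
            tendsto := ?_ }, fun t ht => hD.interpolation_approx ht⟩
  · have := ((hD.breakpoint_step k).2 hk).2.2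
    linarith
  · obtain ⟨h1, h2⟩ := hD.interpolation_approx le_rfl
    rw [hD.zero] at h1 h2
    linarith
  · have hk0 : OnPiece D k (breakpoint D k) :=
      ⟨hk, le_rfl, fun h => ((hD.breakpoint_step k).2 h).1.le⟩
    rw [hD.interpolation_eq ⟨hk, h1, h2⟩, hD.interpolation_eq hk0]
    ring
  · have h : Tendsto (fun t => D t / 2) atTop atTop := hD.tendsto.atTop_div_const two_pos
    refine tendsto_atTop_mono' _ ?_ h
    filter_upwards [eventually_ge_atTop 0] with t ht
    linarith [(hD.interpolation_approx ht).2]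

end IsDelayFunction

/-! ### Piecewise linear functions with halving slopes -/

namespace PiecewiseLinearDelay

variable (p : PiecewiseLinearDelay)

lemma lt_pieces_of_le {j k : ℕ} (h : j ≤ k) (hk : (k : ℕ∞) < p.pieces) : (j : ℕ∞) < p.pieces :=
  lt_of_le_of_lt (by exact_mod_cast h) hk

lemma lt_pieces_of_succ {k : ℕ} (hk : ((k + 1 : ℕ) : ℕ∞) < p.pieces) : (k : ℕ∞) < p.pieces :=
  p.lt_pieces_of_le k.le_succ hk

lemma zero_lt_pieces : ((0 : ℕ) : ℕ∞) < p.pieces := by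
  obtain ⟨k, hk, -⟩ := p.cover 0 le_rfl
  exact p.lt_pieces_of_le k.zero_le hk

lemma x_mono {j k : ℕ} (h : j ≤ k) (hk : (k : ℕ∞) < p.pieces) : p.x j ≤ p.x k := by
  induction k, h using Nat.le_induction with
  | base => exact le_rfl
  | succ k h ih => exact (ih (p.lt_pieces_of_succ hk)).trans (p.x_lt k hk).le

lemma x_nonneg {k : ℕ} (hk : (k : ℕ∞) < p.pieces) : 0 ≤ p.x k := by
  rw [← p.x_zero]
  exact p.x_mono k.zero_le hk

lemma slope_anti {j k : ℕ} (h : j ≤ k) (hk : (k : ℕ∞) < p.pieces) : p.slope k ≤ p.slope j := by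
  induction k, h using Nat.le_induction with
  | base => exact le_rfl
  | succ k h ih =>
    have h1 := ih (p.lt_pieces_of_succ hk)
    have h2 := p.slope_halves k hk
    have h3 := p.slope_pos (k + 1) hk
    linarith

lemma f_x_succ {k : ℕ} (hk : ((k + 1 : ℕ) : ℕ∞) < p.pieces) :
    p.f (p.x (k + 1)) = p.f (p.x k) + p.slope k * (p.x (k + 1) - p.x k) :=
  p.f_linear k (p.lt_pieces_of_succ hk) _ (p.x_lt k hk).le fun _ => le_rfl

lemma f_x_lt {k : ℕ} (hk : ((k + 1 : ℕ) : ℕ∞) < p.pieces) : p.f (p.x k) < p.f (p.x (k + 1)) := by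
  rw [p.f_x_succ hk]
  have := mul_pos (p.slope_pos k (p.lt_pieces_of_succ hk)) (sub_pos.mpr (p.x_lt k hk))
  linarith

lemma f_x_mono {j k : ℕ} (h : j ≤ k) (hk : (k : ℕ∞) < p.pieces) : p.f (p.x j) ≤ p.f (p.x k) := by
  induction k, h using Nat.le_induction with
  | base => exact le_rfl
  | succ k h ih => exact (ih (p.lt_pieces_of_succ hk)).trans (p.f_x_lt hk).le

lemma f_x_nonneg {k : ℕ} (hk : (k : ℕ∞) < p.pieces) : 0 ≤ p.f (p.x k) := by
  rw [← p.f_zero, ← p.x_zero]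
  exact p.f_x_mono k.zero_le hk

lemma f_mono {s t : ℝ} (hs : 0 ≤ s) (hst : s ≤ t) : p.f s ≤ p.f t := by
  obtain ⟨i, hi, hi1, hi2⟩ := p.cover s hs
  obtain ⟨j, hj, hj1, hj2⟩ := p.cover t (hs.trans hst)
  rw [p.f_linear j hj t hj1 hj2]
  have hαi := p.slope_pos i hi
  have hαj := p.slope_pos j hj
  rcases lt_trichotomy i j with h | rfl | h
  · have hi3 : ((i + 1 : ℕ) : ℕ∞) < p.pieces := p.lt_pieces_of_le h hj
    have h1 := p.f_x_mono h hj
    rw [p.f_linear i hi s hi1 hi2]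
    rw [p.f_x_succ hi3] at h1
    nlinarith [hi2 hi3]
  · rw [p.f_linear i hi s hi1 hi2]
    nlinarith
  · have hj3 : ((j + 1 : ℕ) : ℕ∞) < p.pieces := p.lt_pieces_of_le h hi
    have h1 := hj2 hj3
    have h2 := p.x_mono h hi
    obtain rfl : s = t := by linarith
    rw [p.f_linear j hj s hj1 hj2]

lemma f_nonneg {t : ℝ} (ht : 0 ≤ t) : 0 ≤ p.f t := by
  rw [← p.f_zero]
  exact p.f_mono le_rfl ht

lemma f_x_le_line {j k : ℕ} (h : k ≤ j) (hj : (j : ℕ∞) < p.pieces) :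
    p.f (p.x j) ≤ p.f (p.x k) + p.slope k * (p.x j - p.x k) := by
  induction j, h using Nat.le_induction with
  | base => simp
  | succ j h ih =>
    have h1 := ih (p.lt_pieces_of_succ hj)
    have h2 := p.slope_anti h (p.lt_pieces_of_succ hj)
    rw [p.f_x_succ hj]
    nlinarith [p.x_lt j hj]

/-- A line of slope `slope k` that lies above `f`; it is shifted up from the `k`-th piece. -/
lemma f_le_line {k : ℕ} (hk : (k : ℕ∞) < p.pieces) {t : ℝ} (ht : 0 ≤ t) :
    p.f t ≤ p.f (p.x k) + p.slope k * t := by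
  have hα := p.slope_pos k hk
  have hx := p.x_nonneg hk
  rcases le_total t (p.x k) with h | h
  · have := p.f_mono ht h
    nlinarith
  · obtain ⟨j, hj, hj1, hj2⟩ := p.cover t ht
    rcases le_or_gt k j with hkj | hkj
    · rw [p.f_linear j hj t hj1 hj2]
      have h1 := p.f_x_le_line hkj hj
      have h2 := p.slope_anti hkj hj
      nlinarith
    · have h1 := hj2 (p.lt_pieces_of_le hkj hk)
      have h2 := p.x_mono hkj hk
      obtain rfl : t = p.x k := by linarith
      nlinarith

lemma slope_mul_x_le {k : ℕ} (hk : (k : ℕ∞) < p.pieces) : p.slope k * p.x k ≤ p.f (p.x k) := by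
  induction k with
  | zero => simp [p.x_zero, p.f_zero]
  | succ k ih =>
    have h1 := ih (p.lt_pieces_of_succ hk)
    have h2 := p.slope_anti k.le_succ hk
    have h3 := p.x_nonneg hk
    rw [p.f_x_succ hk]
    nlinarith

lemma slope_mul_le_f {k : ℕ} (hk : (k : ℕ∞) < p.pieces) {t : ℝ} (ht : 0 ≤ t)
    (htk : ((k + 1 : ℕ) : ℕ∞) < p.pieces → t ≤ p.x (k + 1)) : p.slope k * t ≤ p.f t := by
  rcases le_or_gt (p.x k) t with h | h
  · rw [p.f_linear k hk t h htk]
    linarith [p.slope_mul_x_le hk]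
  · obtain ⟨j, hj, hj1, hj2⟩ := p.cover t ht
    have hjk : j ≤ k := by
      by_contra! hc
      linarith [p.x_mono hc.le hj]
    rw [p.f_linear j hj t hj1 hj2]
    nlinarith [p.slope_mul_x_le hj, p.slope_anti hjk hk]

open scoped Classical in
/-- The part of a waiting time `t` that lies before the end of piece `k`. -/
noncomputable def clip (k : ℕ) (t : ℝ) : ℝ :=
  if ((k + 1 : ℕ) : ℕ∞) < p.pieces then min t (p.x (k + 1)) else t

lemma clip_le (k : ℕ) (t : ℝ) : p.clip k t ≤ t := by
  unfold clip
  split_ifs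
  · exact min_le_left _ _
  · exact le_rfl

lemma clip_nonneg (k : ℕ) {t : ℝ} (ht : 0 ≤ t) : 0 ≤ p.clip k t := by
  unfold clip
  split_ifs with h
  · exact le_min ht (p.x_nonneg h)
  · exact ht

lemma slope_mul_clip_le {k : ℕ} (hk : (k : ℕ∞) < p.pieces) {t : ℝ} (ht : 0 ≤ t) :
    p.slope k * p.clip k t ≤ p.f t := by
  refine (p.slope_mul_le_f hk (p.clip_nonneg k ht) fun h => ?_).trans
    (p.f_mono (p.clip_nonneg k ht) (p.clip_le k t))
  rw [clip, if_pos h]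
  exact min_le_right _ _

/-- Because the slopes halve, all pieces together are paid for by twice the delay. -/
lemma sum_slope_mul_clip_le {n : ℕ} (hn : (n : ℕ∞) < p.pieces) {t : ℝ} (ht : 0 ≤ t) :
    ∑ k ∈ Finset.range (n + 1), p.slope k * p.clip k t ≤ 2 * p.f t := by
  have key : ∑ k ∈ Finset.range (n + 1), p.slope k * p.clip k t + p.slope n * p.clip n t ≤
      2 * p.f (p.clip n t) := by
    induction n with
    | zero =>
      have h := p.f_linear 0 hn (p.clip 0 t) (by rw [p.x_zero]; exact p.clip_nonneg 0 ht)
        (fun h => by rw [clip, if_pos h]; exact min_le_right _ _)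
      rw [p.x_zero, p.f_zero] at h
      simp only [zero_add, Finset.sum_range_one]
      linarith
    | succ n ih =>
      have h1 := ih (p.lt_pieces_of_succ hn)
      have hm : p.clip n t = min t (p.x (n + 1)) := by rw [clip, if_pos hn]
      have h2 : p.f (p.clip (n + 1) t) =
          p.f (p.clip n t) + p.slope (n + 1) * (p.clip (n + 1) t - p.clip n t) := by
        rcases le_total t (p.x (n + 1)) with h | h
        · have h3 : p.clip (n + 1) t = t := by
            unfold clip
            split_ifs with h4
            · exact min_eq_left (h.trans (p.x_lt _ h4).le)
            · rfl
          rw [h3, hm, min_eq_left h]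
          ring
        · rw [hm, min_eq_right h]
          refine p.f_linear (n + 1) hn _ ?_ ?_
          · unfold clip
            split_ifs with h4
            · exact le_min h (p.x_lt _ h4).le
            · exact h
          · intro h4
            rw [clip, if_pos h4]
            exact min_le_right _ _
      have h3 := p.slope_halves n hn
      have h4 := p.clip_nonneg n ht
      rw [Finset.sum_range_succ]
      nlinarith
  have h1 := mul_nonneg (p.slope_pos n hn).le (p.clip_nonneg n ht)
  have h2 := p.f_mono (p.clip_nonneg n ht) (p.clip_le n t)
  linarith

lemma cumHeight_of_lt {k : ℕ} (hk : ((k + 1 : ℕ) : ℕ∞) < p.pieces) :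
    p.cumHeight k = ((p.f (p.x (k + 1)) : ℝ) : WithTop ℝ) := if_pos hk

lemma cumHeight_of_not_lt {k : ℕ} (hk : ¬ ((k + 1 : ℕ) : ℕ∞) < p.pieces) : p.cumHeight k = ⊤ :=
  if_neg hk

lemma height_of_lt {k : ℕ} (hk : ((k + 1 : ℕ) : ℕ∞) < p.pieces) :
    p.height k = ((p.f (p.x (k + 1)) - p.f (p.x k) : ℝ) : WithTop ℝ) := if_pos hk

lemma cumHeight_mono {j k : ℕ} (h : j ≤ k) : p.cumHeight j ≤ p.cumHeight k := by
  by_cases hk : ((k + 1 : ℕ) : ℕ∞) < p.pieces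
  · rw [p.cumHeight_of_lt hk, p.cumHeight_of_lt (p.lt_pieces_of_le (Nat.succ_le_succ h) hk)]
    exact_mod_cast p.f_x_mono (Nat.succ_le_succ h) hk
  · rw [p.cumHeight_of_not_lt hk]
    exact le_top

lemma succ_lt_pieces_of_cumHeight_lt {k : ℕ} {w : WithTop ℝ} (h : p.cumHeight k < w) :
    ((k + 1 : ℕ) : ℕ∞) < p.pieces := by
  by_contra hk
  rw [p.cumHeight_of_not_lt hk] at h
  exact not_top_lt h

lemma exists_le_cumHeight (w : ℝ) :
    ∃ k : ℕ, (k : ℕ∞) < p.pieces ∧ (w : WithTop ℝ) ≤ p.cumHeight k := by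
  obtain ⟨t, ht0, ht⟩ :=
    ((eventually_ge_atTop (0 : ℝ)).and (p.tendsto.eventually_ge_atTop w)).exists
  obtain ⟨k, hk, hk1, hk2⟩ := p.cover t ht0
  refine ⟨k, hk, ?_⟩
  by_cases h : ((k + 1 : ℕ) : ℕ∞) < p.pieces
  · rw [p.cumHeight_of_lt h]
    exact_mod_cast ht.trans (p.f_mono ht0 (hk2 h))
  · rw [p.cumHeight_of_not_lt h]
    exact le_top

lemma firstPiece_le_iff {w : ℝ} {k : ℕ} :
    p.firstPiece w ≤ k ↔ (w : WithTop ℝ) ≤ p.cumHeight k := by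
  constructor
  · intro h
    obtain ⟨j, -, hj⟩ := p.exists_le_cumHeight w
    have hne : {k : ℕ | (w : WithTop ℝ) ≤ p.cumHeight k}.Nonempty := ⟨j, hj⟩
    exact (show (w : WithTop ℝ) ≤ p.cumHeight (p.firstPiece w) from Nat.sInf_mem hne).trans
      (p.cumHeight_mono h)
  · exact fun h => Nat.sInf_le h

lemma lt_firstPiece_iff {w : ℝ} {k : ℕ} :
    k < p.firstPiece w ↔ p.cumHeight k < (w : WithTop ℝ) := by
  rw [← not_le, p.firstPiece_le_iff, not_le]

lemma firstPiece_lt_pieces (w : ℝ) : (p.firstPiece w : ℕ∞) < p.pieces := by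
  obtain ⟨k, hk, h⟩ := p.exists_le_cumHeight w
  exact p.lt_pieces_of_le (p.firstPiece_le_iff.mpr h) hk

lemma firstPiece_mono {v w : ℝ} (h : v ≤ w) : p.firstPiece v ≤ p.firstPiece w := by
  rw [p.firstPiece_le_iff]
  exact le_trans (by exact_mod_cast h) (p.firstPiece_le_iff.mp le_rfl)

lemma exists_index_bound (C : ℝ) :
    ∃ K : ℕ, ∀ k : ℕ, (k : ℕ∞) < p.pieces → p.f (p.x k) ≤ C → k ≤ K := by
  obtain ⟨j, -, hj⟩ := p.exists_le_cumHeight (C + 1)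
  refine ⟨j, fun k hk h => ?_⟩
  by_contra! hc
  have hj1 : ((j + 1 : ℕ) : ℕ∞) < p.pieces := p.lt_pieces_of_le hc hk
  rw [p.cumHeight_of_lt hj1] at hj
  have h1 : C + 1 ≤ p.f (p.x (j + 1)) := by exact_mod_cast hj
  linarith [p.f_x_mono hc hk]

end PiecewiseLinearDelay

/-! ### Paths in a rooted tree -/

section Tree

variable {T : RootedTree}

lemma pred_lt_of_ne_bot {v : T} (hv : v ≠ ⊥) : Order.pred v < v :=
  Order.pred_lt_of_not_isMin (by rwa [isMin_iff_eq_bot])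

lemma le_of_pred_lt {u v l : T} (hu : u ≤ l) (hv : v ≤ l) (h : Order.pred v < u) : v ≤ u := by
  rcases le_total_of_directed hv hu with h1 | h1
  · rcases h1.eq_or_lt with rfl | h2
    · exact le_rfl
    · exact absurd (Order.le_pred_of_lt h2) (not_le_of_gt h)
  · exact h1

lemma exists_child {v l : T} (h : v < l) : ∃ u, v < u ∧ u ≤ l ∧ Order.pred u = v := by
  classical
  have hex := h.le.exists_pred_iterate
  have hspec := Nat.find_spec hex
  have hmin := fun m => Nat.find_min hex (m := m)
  generalize Nat.find hex = n at hspec hmin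
  cases n with
  | zero => exact absurd hspec h.ne'
  | succ n =>
    rw [Function.iterate_succ_apply'] at hspec
    have hne : Order.pred^[n] l ≠ v := hmin n n.lt_succ_self
    refine ⟨Order.pred^[n] l, lt_of_le_of_ne ?_ hne.symm, Order.pred_iterate_le _ _, hspec⟩
    calc v = Order.pred (Order.pred^[n] l) := hspec.symm
      _ ≤ _ := Order.pred_le _

variable [Fintype T]

open scoped Classical in
/-- The lower ends of the edges on the way from `l` up to its ancestor `v`. -/
noncomputable def edgesBelow (v l : T) : Finset T := Finset.univ.filter fun u => v < u ∧ u ≤ l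

lemma mem_edgesBelow {v l u : T} : u ∈ edgesBelow v l ↔ v < u ∧ u ≤ l := by
  simp [edgesBelow]

lemma edgesBelow_self (l : T) : edgesBelow l l = ∅ := by
  ext u
  simp only [mem_edgesBelow, Finset.notMem_empty, iff_false, not_and]
  exact fun h1 h2 => absurd h2 (not_le_of_gt h1)

lemma notMem_edgesBelow_self (v l : T) : v ∉ edgesBelow v l := by
  simp [mem_edgesBelow]

open scoped Classical in
lemma edgesBelow_pred {v l : T} (hv : v ≠ ⊥) (hvl : v ≤ l) :
    edgesBelow (Order.pred v) l = insert v (edgesBelow v l) := by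
  ext u
  simp only [mem_edgesBelow, Finset.mem_insert]
  constructor
  · rintro ⟨h1, h2⟩
    rcases (le_of_pred_lt h2 hvl h1).eq_or_lt with rfl | h3
    · exact Or.inl rfl
    · exact Or.inr ⟨h3, h2⟩
  · rintro (rfl | ⟨h1, h2⟩)
    · exact ⟨pred_lt_of_ne_bot hv, hvl⟩
    · exact ⟨(Order.pred_le v).trans_lt h1, h2⟩

end Tree

/-- The vertex at which a counter is placed (for an edge, its lower end). -/
def Counter.vertex {T : RootedTree} : Counter T → T
  | .edge v => v
  | .delay v _ => v

namespace WeightedHST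

variable {T : RootedTree} (H : WeightedHST 2 T) (p : PiecewiseLinearDelay)

lemma two_mul_weight_le {v : T} (hv : v ≠ ⊥) (hp : Order.pred v ≠ ⊥) :
    2 * H.weight v ≤ H.weight (Order.pred v) := by
  linarith [H.separated v hv hp]

lemma weight_anti {u v : T} (h : v ≤ u) (hv : v ≠ ⊥) : H.weight u ≤ H.weight v := by
  obtain ⟨n, hn⟩ := h.exists_pred_iterate
  induction n generalizing v with
  | zero => simp only [Function.iterate_zero, id_eq] at hn; rw [hn]
  | succ n ih =>
    rw [Function.iterate_succ_apply'] at hn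
    have hne : Order.pred^[n] u ≠ ⊥ := by
      intro h0
      rw [h0, Order.pred_bot] at hn
      exact hv hn.symm
    have h1 := ih (Order.pred_iterate_le _ _) hne rfl
    have h2 := H.two_mul_weight_le hne (hn ▸ hv)
    have h3 := H.weight_pos _ hne
    rw [hn] at h2
    linarith

/-- The index of the first delay counter at or above a counter. -/
noncomputable def index : Counter T → ℕ
  | .edge v => p.firstPiece (H.weight v)
  | .delay _ k => k

lemma slope_eq (z : Counter T) : H.slope p z = p.slope (H.index p z) := by
  cases z <;> rfl

/-- An explicit description of the counters on the way from the leaf `l` to the root: the delay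
counter `k` stands at the highest vertex that is reached through edges of weight at most the
cumulative height of piece `k`. -/
def OnPath (l : T) : Counter T → Prop
  | .edge v => v ≠ ⊥ ∧ v ≤ l
  | .delay v k => v ≤ l ∧ (k : ℕ∞) < p.pieces ∧
      (v = ⊥ ∨ p.cumHeight k < (H.weight v : WithTop ℝ)) ∧
      ∀ u, v < u → u ≤ l → (H.weight u : WithTop ℝ) ≤ p.cumHeight k

variable {H p}

lemma OnPath.vertex_le {l : T} {z : Counter T} (h : H.OnPath p l z) : z.vertex ≤ l := by
  cases z with
  | edge v => exact h.2
  | delay v k => exact h.1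

lemma OnPath.index_lt {l : T} {z : Counter T} (h : H.OnPath p l z) :
    (H.index p z : ℕ∞) < p.pieces := by
  cases z with
  | edge v => exact p.firstPiece_lt_pieces _
  | delay v k => exact h.2.1

lemma OnPath.weight_le {l : T} {z : Counter T} (h : H.OnPath p l z) {u : T} (h1 : z.vertex < u)
    (h2 : u ≤ l) : (H.weight u : WithTop ℝ) ≤ p.cumHeight (H.index p z) := by
  cases z with
  | edge v =>
    exact p.firstPiece_le_iff.mp (p.firstPiece_mono (H.weight_anti h1.le h.1))
  | delay v k => exact h.2.2.2 u h1 h2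

lemma OnPath.lt_weight {l : T} {z : Counter T} (h : H.OnPath p l z) (hv : z.vertex ≠ ⊥) {j : ℕ}
    (hj : j < H.index p z) : p.cumHeight j < (H.weight z.vertex : WithTop ℝ) := by
  cases z with
  | edge v => exact p.lt_firstPiece_iff.mp hj
  | delay v k =>
    exact (p.cumHeight_mono hj.le).trans_lt (h.2.2.1.resolve_left hv)

lemma vertex_climb (v : T) (k : ℕ) : (H.climb p v k).vertex = v := by
  unfold climb
  split_ifs <;> rfl

lemma climb_of_lt {v : T} {k : ℕ} (h : v = ⊥ ∨ p.cumHeight k < (H.weight v : WithTop ℝ)) :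
    H.climb p v k = .delay v k := if_pos h

lemma climb_of_le {v : T} {k : ℕ} (hv : v ≠ ⊥) (h : (H.weight v : WithTop ℝ) ≤ p.cumHeight k) :
    H.climb p v k = .edge v := if_neg (by
  rintro (h1 | h1)
  · exact hv h1
  · exact absurd h1 (not_lt_of_ge h))

lemma index_climb {v : T} {k : ℕ} (h : v ≠ ⊥ → ∀ j < k, p.cumHeight j < (H.weight v : WithTop ℝ)) :
    H.index p (H.climb p v k) = k := by
  by_cases hc : v = ⊥ ∨ p.cumHeight k < (H.weight v : WithTop ℝ)
  · rw [climb_of_lt hc]; rfl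
  · push Not at hc
    rw [climb_of_le hc.1 hc.2]
    refine le_antisymm (p.firstPiece_le_iff.mpr hc.2) ?_
    by_contra! hlt
    have := h hc.1 _ hlt
    rw [← p.lt_firstPiece_iff] at this
    exact lt_irrefl _ this

lemma onPath_climb {l v : T} {k : ℕ} (hv : v ≤ l) (hk : (k : ℕ∞) < p.pieces)
    (h : ∀ u, v < u → u ≤ l → (H.weight u : WithTop ℝ) ≤ p.cumHeight k) :
    H.OnPath p l (H.climb p v k) := by
  by_cases hc : v = ⊥ ∨ p.cumHeight k < (H.weight v : WithTop ℝ)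
  · rw [climb_of_lt hc]
    exact ⟨hv, hk, hc, h⟩
  · push Not at hc
    rw [climb_of_le hc.1 hc.2]
    exact ⟨hc.1, hv⟩

lemma OnPath.climb_eq {l : T} {z : Counter T} (h : H.OnPath p l z) :
    H.climb p z.vertex (H.index p z) = z := by
  cases z with
  | edge v => exact climb_of_le h.1 (p.firstPiece_le_iff.mp le_rfl)
  | delay v k => exact climb_of_lt h.2.2.1

lemma onPath_entry (l : T) : H.OnPath p l (H.entry p l) :=
  onPath_climb le_rfl p.zero_lt_pieces fun _ h1 h2 => absurd h2 (not_le_of_gt h1)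

lemma vertex_entry (l : T) : (H.entry p l).vertex = l := vertex_climb _ _

lemma index_entry (l : T) : H.index p (H.entry p l) = 0 := index_climb (by simp)

/-- The counter is of no use: it lies beyond the last delay counter. -/
def IsJunk (p : PiecewiseLinearDelay) (z : Counter T) : Prop :=
  ∃ k : ℕ, z = .delay ⊥ k ∧ ¬ (k : ℕ∞) < p.pieces

lemma IsJunk.next {z : Counter T} (h : IsJunk p z) : IsJunk p (H.next p z) := by
  obtain ⟨k, rfl, hk⟩ := h
  exact ⟨k + 1, climb_of_lt (Or.inl rfl), fun h => hk (p.lt_pieces_of_succ h)⟩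

lemma OnPath.not_isJunk {l : T} {z : Counter T} (h : H.OnPath p l z) : ¬ IsJunk p z := by
  rintro ⟨k, rfl, hk⟩
  exact hk h.2.1

lemma succ_lt_pieces_of_capacity_ne_top {v : T} {k : ℕ}
    (h : H.capacity p (.delay v k) ≠ ⊤) : ((k + 1 : ℕ) : ℕ∞) < p.pieces := by
  by_contra hk
  exact h (if_neg hk)

lemma capacity_ne_top_of_succ_lt {v : T} {k : ℕ} (h : ((k + 1 : ℕ) : ℕ∞) < p.pieces) :
    H.capacity p (.delay v k) ≠ ⊤ := by
  change p.height k ≠ ⊤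
  rw [p.height_of_lt h]
  exact WithTop.coe_ne_top

lemma capacity_edge_ne_top (v : T) : H.capacity p (.edge v) ≠ ⊤ := WithTop.coe_ne_top

/-- A counter of infinite capacity is met by every path. -/
lemma OnPath.of_capacity_eq_top {l l' : T} {z : Counter T} (h : H.OnPath p l z)
    (hc : H.capacity p z = ⊤) : H.OnPath p l' z := by
  cases z with
  | edge v => exact absurd hc (capacity_edge_ne_top v)
  | delay v k =>
    have hk : ¬ ((k + 1 : ℕ) : ℕ∞) < p.pieces := fun hk => capacity_ne_top_of_succ_lt hk hc
    have hv : v = ⊥ := h.2.2.1.resolve_right fun h1 => hk (p.succ_lt_pieces_of_cumHeight_lt h1)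
    subst hv
    refine ⟨bot_le, h.2.1, Or.inl rfl, fun u _ _ => ?_⟩
    rw [p.cumHeight_of_not_lt hk]
    exact le_top

lemma OnPath.isJunk_next {l : T} {z : Counter T} (h : H.OnPath p l z)
    (hc : H.capacity p z = ⊤) : IsJunk p (H.next p z) := by
  cases z with
  | edge v => exact absurd hc (capacity_edge_ne_top v)
  | delay v k =>
    have hk : ¬ ((k + 1 : ℕ) : ℕ∞) < p.pieces := fun hk => capacity_ne_top_of_succ_lt hk hc
    have hv : v = ⊥ := h.2.2.1.resolve_right fun h1 => hk (p.succ_lt_pieces_of_cumHeight_lt h1)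
    subst hv
    exact ⟨k + 1, climb_of_lt (Or.inl rfl), hk⟩

lemma vertex_next_edge (v : T) : (H.next p (.edge v)).vertex = Order.pred v := vertex_climb _ _

lemma vertex_next_delay (v : T) (k : ℕ) : (H.next p (.delay v k)).vertex = v := vertex_climb _ _

lemma index_next_edge (v : T) :
    H.index p (H.next p (.edge v)) = H.index p (.edge v) :=
  index_climb fun hp j hj => (p.lt_firstPiece_iff.mp hj).trans_le
    (by exact_mod_cast H.weight_anti (Order.pred_le v) hp)

lemma OnPath.index_next_delay {l v : T} {k : ℕ} (h : H.OnPath p l (.delay v k)) :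
    H.index p (H.next p (.delay v k)) = k + 1 :=
  index_climb fun hv _ hj =>
    (p.cumHeight_mono (Nat.lt_succ_iff.mp hj)).trans_lt (h.2.2.1.resolve_left hv)

lemma OnPath.next {l : T} {z : Counter T} (h : H.OnPath p l z) (hc : H.capacity p z ≠ ⊤) :
    H.OnPath p l (H.next p z) := by
  cases z with
  | edge v =>
    refine onPath_climb ((Order.pred_le v).trans h.2) (p.firstPiece_lt_pieces _) ?_
    intro u h1 h2
    exact p.firstPiece_le_iff.mp
      (p.firstPiece_mono (H.weight_anti (le_of_pred_lt h2 h.2 h1) h.1))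
  | delay v k =>
    refine onPath_climb h.1 (succ_lt_pieces_of_capacity_ne_top hc) fun u h1 h2 => ?_
    exact (h.2.2.2 u h1 h2).trans (p.cumHeight_mono k.le_succ)

lemma OnPath.index_le_next {l : T} {z : Counter T} (h : H.OnPath p l z) :
    H.index p z ≤ H.index p (H.next p z) := by
  cases z with
  | edge v => exact (index_next_edge v).ge
  | delay v k => rw [h.index_next_delay]; exact k.le_succ

variable [Fintype T]

variable (H p) in
/-- The number of counters that precede `z` on the path from `l`. -/
noncomputable def position (l : T) (z : Counter T) : ℕ :=
  H.index p z + (edgesBelow z.vertex l).card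

lemma position_entry (l : T) : H.position p l (H.entry p l) = 0 := by
  rw [position, index_entry, vertex_entry, edgesBelow_self, Finset.card_empty]

lemma OnPath.position_next {l : T} {z : Counter T} (h : H.OnPath p l z) :
    H.position p l (H.next p z) = H.position p l z + 1 := by
  classical
  cases z with
  | edge v =>
    rw [position, position, index_next_edge v, vertex_next_edge, edgesBelow_pred h.1 h.2,
      Finset.card_insert_of_notMem (notMem_edgesBelow_self v l)]
    rfl
  | delay v k =>
    rw [position, position, h.index_next_delay, vertex_next_delay]
    change _ = k + _ + 1
    simp only [Counter.vertex]
    ring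

lemma OnPath.iterate {l : T} {z : Counter T} (h : H.OnPath p l z) (n : ℕ) :
    (H.OnPath p l ((H.next p)^[n] z) ∧
      H.position p l ((H.next p)^[n] z) = H.position p l z + n) ∨
    IsJunk p ((H.next p)^[n] z) := by
  induction n with
  | zero => exact Or.inl ⟨h, rfl⟩
  | succ n ih =>
    rw [Function.iterate_succ_apply']
    rcases ih with ⟨h1, h2⟩ | h1
    · by_cases hc : H.capacity p ((H.next p)^[n] z) = ⊤
      · exact Or.inr (h1.isJunk_next hc)
      · exact Or.inl ⟨h1.next hc, by rw [h1.position_next, h2, add_assoc]⟩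
    · exact Or.inr h1.next

lemma OnPath.exists_prev {l : T} {z : Counter T} (h : H.OnPath p l z) :
    z = H.entry p l ∨ ∃ c, H.OnPath p l c ∧ H.next p c = z := by
  by_cases hA : H.index p z ≠ 0 ∧
      ∀ u, z.vertex < u → u ≤ l → (H.weight u : WithTop ℝ) ≤ p.cumHeight (H.index p z - 1)
  · obtain ⟨h0, hA⟩ := hA
    right
    refine ⟨.delay z.vertex (H.index p z - 1), ⟨h.vertex_le, ?_, ?_, hA⟩, ?_⟩
    · exact p.lt_pieces_of_le (Nat.sub_le _ _) h.index_lt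
    · by_cases hv : z.vertex = ⊥
      · exact Or.inl hv
      · exact Or.inr (h.lt_weight hv (by omega))
    · change H.climb p z.vertex (H.index p z - 1 + 1) = z
      rw [Nat.sub_add_cancel (by omega)]
      exact h.climb_eq
  · by_cases hv : z.vertex = l
    · left
      have h0 : H.index p z = 0 := by
        by_contra h0
        exact hA ⟨h0, fun u h1 h2 => absurd h2 (not_le_of_gt (hv ▸ h1))⟩
      rw [← h.climb_eq, h0, hv]
      rfl
    · right
      obtain ⟨u, hu1, hu2, hu3⟩ := exists_child (lt_of_le_of_ne h.vertex_le hv)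
      have hu0 : u ≠ ⊥ := fun h0 => not_lt_bot (h0 ▸ hu1)
      refine ⟨.edge u, ⟨hu0, hu2⟩, ?_⟩
      have hfp : p.firstPiece (H.weight u) = H.index p z := by
        refine le_antisymm (p.firstPiece_le_iff.mpr (h.weight_le hu1 hu2)) ?_
        by_contra! hlt
        refine hA ⟨by omega, fun u' h1 h2 => ?_⟩
        have h3 : u ≤ u' := le_of_pred_lt h2 hu2 (hu3 ▸ h1)
        have h4 : p.firstPiece (H.weight u) ≤ H.index p z - 1 := by omega
        exact le_trans (by exact_mod_cast H.weight_anti h3 hu0) (p.firstPiece_le_iff.mp h4)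
      change H.climb p (Order.pred u) (p.firstPiece (H.weight u)) = z
      rw [hu3, hfp]
      exact h.climb_eq

lemma OnPath.eq_iterate_entry {l : T} {z : Counter T} (h : H.OnPath p l z) :
    z = (H.next p)^[H.position p l z] (H.entry p l) := by
  generalize hn : H.position p l z = n
  induction n generalizing z with
  | zero =>
    rcases h.exists_prev with h1 | ⟨c, hc, rfl⟩
    · exact h1
    · rw [hc.position_next] at hn
      omega
  | succ n ih =>
    rcases h.exists_prev with h1 | ⟨c, hc, rfl⟩
    · rw [h1, position_entry] at hn
      omega
    · rw [hc.position_next] at hn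
      rw [Function.iterate_succ_apply', ← ih hc (by omega)]

/-- The counters that a request can meet form a path, on which they are ordered by their
position. -/
lemma OnPath.isDescendant_iff {l : T} {z' z : Counter T} (h : H.OnPath p l z')
    (hz : ¬ IsJunk p z) :
    H.IsDescendant p z' z ↔ H.OnPath p l z ∧ H.position p l z' ≤ H.position p l z := by
  constructor
  · rintro ⟨n, rfl⟩
    rcases h.iterate n with ⟨h1, h2⟩ | h1
    · exact ⟨h1, by omega⟩
    · exact absurd h1 hz
  · rintro ⟨h1, h2⟩
    refine ⟨H.position p l z - H.position p l z', ?_⟩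
    calc (H.next p)^[H.position p l z - H.position p l z'] z'
        = (H.next p)^[H.position p l z - H.position p l z']
            ((H.next p)^[H.position p l z'] (H.entry p l)) := congrArg _ h.eq_iterate_entry
      _ = (H.next p)^[H.position p l z] (H.entry p l) := by
          rw [← Function.iterate_add_apply, Nat.sub_add_cancel h2]
      _ = z := h1.eq_iterate_entry.symm

lemma isDescendant_entry_iff {l : T} {z : Counter T} (hz : ¬ IsJunk p z) :
    H.IsDescendant p (H.entry p l) z ↔ H.OnPath p l z := by
  rw [(onPath_entry l).isDescendant_iff hz, position_entry]
  simp

lemma OnPath.eq_of_position_eq {l : T} {z z' : Counter T} (h : H.OnPath p l z)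
    (h' : H.OnPath p l z') (he : H.position p l z = H.position p l z') : z = z' := by
  rw [h.eq_iterate_entry, h'.eq_iterate_entry, he]

end WeightedHST

/-! ### Surpluses -/

lemma sum_comp_update {R α M : Type*} [Fintype R] [DecidableEq R] [AddCommGroup M]
    (F : R → α → M) (st : R → α) (r₀ : R) (a : α) :
    ∑ r, F r (Function.update st r₀ a r) = ∑ r, F r (st r) + (F r₀ a - F r₀ (st r₀)) := by
  rw [← sub_eq_iff_eq_add', ← Finset.sum_sub_distrib]
  rw [Finset.sum_eq_single r₀]
  · simp
  · intro r _ hr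
    simp [Function.update_of_ne hr]
  · simp

namespace WeightedHST

variable {T : RootedTree} {H : WeightedHST 2 T} {p : PiecewiseLinearDelay}

lemma slope_pos_of_onPath {l : T} {z : Counter T} (h : H.OnPath p l z) : 0 < H.slope p z := by
  rw [slope_eq]
  exact p.slope_pos _ h.index_lt

variable [Fintype T]

variable (H p) in
open scoped Classical in
/-- The counters on paths of leaves up to a given index. -/
noncomputable def counters (K : ℕ) : Finset (Counter T) :=
  (Finset.univ.image Counter.edge ∪
    (Finset.univ ×ˢ Finset.range (K + 1)).image fun x => Counter.delay x.1 x.2).filter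
    fun z => (∃ l, H.OnPath p l z) ∧ H.index p z ≤ K

lemma mem_counters {K : ℕ} {z : Counter T} :
    z ∈ H.counters p K ↔ (∃ l, H.OnPath p l z) ∧ H.index p z ≤ K := by
  classical
  unfold counters
  rw [Finset.mem_filter, and_iff_right_iff_imp]
  rintro ⟨-, h⟩
  cases z with
  | edge v => simp
  | delay v k =>
    have h : k ≤ K := h
    simp
    omega

end WeightedHST

namespace Config

open WeightedHST

variable {T : RootedTree} {R : Type*}

open scoped Classical in
/-- The contribution of a request of polarity `s` with a given status to the surplus of `z`. -/
noncomputable def load (H : WeightedHST 2 T) (p : PiecewiseLinearDelay) (z : Counter T) (s : ℤˣ)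
    (st : Status T R) : ℤ :=
  if ∃ z', st = .waiting z' ∧ H.IsDescendant p z' z then (s : ℤ) else 0

variable {H : WeightedHST 2 T} {p : PiecewiseLinearDelay}

lemma load_waiting_of_isDescendant {z z' : Counter T} {s : ℤˣ} (h : H.IsDescendant p z' z) :
    load H p z s (.waiting z' : Status T R) = s := if_pos ⟨z', rfl, h⟩

lemma load_waiting_of_not {z z' : Counter T} {s : ℤˣ} (h : ¬ H.IsDescendant p z' z) :
    load H p z s (.waiting z' : Status T R) = 0 := if_neg (by
  rintro ⟨z'', h1, h2⟩
  cases h1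
  exact h h2)

lemma load_future {z : Counter T} {s : ℤˣ} : load H p z s (.future : Status T R) = 0 := if_neg (by
  rintro ⟨z'', h1, h2⟩
  cases h1)

lemma load_matched {z : Counter T} {s : ℤˣ} {r : R} {t : ℝ} :
    load H p z s (.matched r t : Status T R) = 0 := if_neg (by
  rintro ⟨z'', h1, h2⟩
  cases h1)

variable [Fintype R] {I : RequestSequence T R}

lemma surplus_eq_sum_load (c : Config T R) (z : Counter T) :
    c.surplus H p I z = ∑ r, load H p z (I.pol r) (c.status r) := by
  classical
  rw [surplus, Finset.sum_filter]
  rfl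

variable (H p I) in
/-- The invariants of a run that concern the requests and the levels of the counters. -/
structure IsValid (c : Config T R) : Prop where
  onPath : ∀ r z, c.status r = .waiting z → H.OnPath p (I.loc r) z
  le_arrival : ∀ r, c.status r = .future → c.time ≤ I.arrival r
  arrival_le : ∀ r, c.status r ≠ .future → I.arrival r ≤ c.time
  matched : ∀ r r' t, c.status r = .matched r' t →
    c.status r' = .matched r t ∧ I.pol r' = -I.pol r ∧ I.arrival r ≤ t
  level_nonneg : ∀ z s, 0 ≤ c.level z s
  level_le : ∀ z s l, H.OnPath p l z → ((c.level z s : ℝ) : WithTop ℝ) ≤ H.capacity p z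

lemma surplus_arrive [Fintype T] [DecidableEq R] {c : Config T R} {r : R}
    (h : c.status r = .future)
    {c' : Config T R}
    (hc' : c'.status = Function.update c.status r (.waiting (H.entry p (I.loc r))))
    {l : T} {z : Counter T} (hz : H.OnPath p l z) [Decidable (H.OnPath p (I.loc r) z)] :
    c'.surplus H p I z = c.surplus H p I z +
      if H.OnPath p (I.loc r) z then (I.pol r : ℤ) else 0 := by
  rw [surplus_eq_sum_load, surplus_eq_sum_load, hc',
    sum_comp_update (fun r st => load H p z (I.pol r) st), h, load_future, sub_zero]
  congr 1
  have := isDescendant_entry_iff (H := H) (p := p) (l := I.loc r) hz.not_isJunk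
  split_ifs with h1
  · exact load_waiting_of_isDescendant (this.mpr h1)
  · exact load_waiting_of_not (this.not.mpr h1)

lemma surplus_pair [DecidableEq R] {c c' : Config T R} {r r' : R} {z : Counter T}
    {t : ℝ} (h : c.status r = .waiting z) (h' : c.status r' = .waiting z)
    (hpol : I.pol r' = -I.pol r)
    (hc' : c'.status = Function.update (Function.update c.status r (.matched r' t)) r'
      (.matched r t)) (z' : Counter T) :
    c'.surplus H p I z' = c.surplus H p I z' := by
  have hne : r' ≠ r := by
    rintro rfl
    exact units_ne_neg_self _ hpol
  rw [surplus_eq_sum_load, surplus_eq_sum_load, hc',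
    sum_comp_update (fun r st => load H p z' (I.pol r) st),
    sum_comp_update (fun r st => load H p z' (I.pol r) st), Function.update_of_ne hne, h, h',
    load_matched, load_matched, hpol]
  have : load H p z' (-I.pol r) (.waiting z : Status T R) =
      - load H p z' (I.pol r) (.waiting z : Status T R) := by
    unfold load
    split_ifs <;> simp
  rw [this]
  ring

lemma surplus_move [Fintype T] [DecidableEq R] {c c' : Config T R} {r : R} {z : Counter T}
    (h : c.status r = .waiting z) (hz : H.OnPath p (I.loc r) z)
    (hc' : c'.status = Function.update c.status r (.waiting (H.next p z)))
    {z' : Counter T} [Decidable (z' = z)] :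
    c'.surplus H p I z' = c.surplus H p I z' - if z' = z then (I.pol r : ℤ) else 0 := by
  rw [surplus_eq_sum_load, surplus_eq_sum_load, hc',
    sum_comp_update (fun r st => load H p z' (I.pol r) st), h, sub_eq_add_neg]
  congr 1
  split_ifs with he
  · subst he
    rw [load_waiting_of_isDescendant (z := z') (z' := z') ⟨0, rfl⟩, load_waiting_of_not]
    · ring
    · rintro ⟨n, hn⟩
      rw [← Function.iterate_succ_apply] at hn
      rcases hz.iterate (n + 1) with ⟨-, h2⟩ | h2
      · rw [hn] at h2
        omega
      · rw [hn] at h2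
        exact hz.not_isJunk h2
  · by_cases hd : H.IsDescendant p (H.next p z) z'
    · have hd' : H.IsDescendant p z z' := by
        obtain ⟨n, hn⟩ := hd
        exact ⟨n + 1, hn⟩
      rw [load_waiting_of_isDescendant hd, load_waiting_of_isDescendant hd']
      ring
    · rw [load_waiting_of_not hd, load_waiting_of_not]
      · ring
      · rintro ⟨n, hn⟩
        cases n with
        | zero => exact he hn.symm
        | succ n => exact hd ⟨n, hn⟩

/-! ### Waiting requests are paid for by increasing counters -/

open scoped Classical in
/-- The sum of the polarities of the requests at `z`. -/
noncomputable def polAt (I : RequestSequence T R) (c : Config T R) (z : Counter T) : ℤ :=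
  ∑ r, if c.status r = .waiting z then (I.pol r : ℤ) else 0

open scoped Classical in
/-- The number of requests at `z`. -/
noncomputable def countAt (c : Config T R) (z : Counter T) : ℝ :=
  ∑ r, if c.status r = .waiting z then 1 else 0

lemma polAt_of_not_occupied {c : Config T R} {z : Counter T} {s : ℤˣ}
    (h : ¬ c.Occupied I z (-s)) : ((s : ℤ) : ℝ) * (c.polAt I z : ℝ) = c.countAt z := by
  classical
  rw [polAt, countAt, Int.cast_sum, Finset.mul_sum]
  refine Finset.sum_congr rfl fun r _ => ?_
  split_ifs with hr
  · have hs : I.pol r = s := by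
      by_contra hne
      exact h ⟨r, hr, Int.units_ne_iff_eq_neg.mp hne⟩
    rw [hs]
    rcases Int.units_eq_one_or s with rfl | rfl <;> simp
  · simp

variable (H p I) in
/-- The joint rate of increase of the two copies of a counter. -/
noncomputable def totalRate (c : Config T R) (z : Counter T) : ℝ :=
  c.rate H p I z 1 + c.rate H p I z (-1)

lemma rate_nonneg {c : Config T R} (hc : c.IsValid H p I) (z : Counter T) (s : ℤˣ) :
    0 ≤ c.rate H p I z s := by
  unfold rate
  split_ifs with h
  · obtain ⟨⟨r, hr, -⟩, -⟩ := h
    exact mul_nonneg (slope_pos_of_onPath (hc.onPath r z hr)).le (abs_nonneg _)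
  · exact le_rfl

lemma rate_le_totalRate {c : Config T R} (hc : c.IsValid H p I) (z : Counter T) (s : ℤˣ) :
    c.rate H p I z s ≤ c.totalRate H p I z := by
  have h1 := rate_nonneg hc z 1
  have h2 := rate_nonneg hc z (-1)
  unfold totalRate
  rcases Int.units_eq_one_or s with rfl | rfl <;> linarith

variable (H p) in
/-- The slope of the counter at which a request stands, if it is waiting. -/
noncomputable def waitRate : Status T R → ℝ
  | .waiting z => H.slope p z
  | _ => 0

variable [Fintype T]

open scoped Classical in
/-- The surplus of `z` comes from the requests at `z` and from the children of `z`. -/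
lemma surplus_eq_polAt_add {c : Config T R} (hc : c.IsValid H p I) {K : ℕ} {z : Counter T}
    (hz : z ∈ H.counters p K) :
    c.surplus H p I z = c.polAt I z +
      ∑ y ∈ H.counters p K, if H.next p y = z then c.surplus H p I y else 0 := by
  obtain ⟨⟨l, hl⟩, hK⟩ := mem_counters.mp hz
  have key : ∀ r, load H p z (I.pol r) (c.status r) =
      (if c.status r = .waiting z then (I.pol r : ℤ) else 0) +
      ∑ y ∈ H.counters p K, if H.next p y = z then load H p y (I.pol r) (c.status r) else 0 := by
    intro r
    rcases hst : c.status r with _ | z' | ⟨r', t⟩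
    · simp [load_future]
    · have hz' := hc.onPath r z' hst
      have hprev : ∀ y, H.next p y = z → H.IsDescendant p z' y →
          H.OnPath p (I.loc r) y ∧ H.position p (I.loc r) z' ≤ H.position p (I.loc r) y ∧
          H.position p (I.loc r) y + 1 = H.position p (I.loc r) z := by
        intro y hy hd
        have hnj : ¬ IsJunk p y := fun hj => hl.not_isJunk (hy ▸ hj.next)
        obtain ⟨h1, h2⟩ := (hz'.isDescendant_iff hnj).mp hd
        exact ⟨h1, h2, by rw [← h1.position_next, hy]⟩
      by_cases hd : H.IsDescendant p z' z
      · rw [load_waiting_of_isDescendant hd]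
        obtain ⟨h1, h2⟩ := (hz'.isDescendant_iff hl.not_isJunk).mp hd
        by_cases he : z' = z
        · subst he
          rw [if_pos rfl, Finset.sum_eq_zero, add_zero]
          intro y _
          split_ifs with hy
          · refine load_waiting_of_not fun hdy => ?_
            obtain ⟨-, h3, h4⟩ := hprev y hy hdy
            omega
          · rfl
        · rw [if_neg (by simpa using he), zero_add]
          have hlt : H.position p (I.loc r) z' ≠ H.position p (I.loc r) z :=
            fun h => he (hz'.eq_of_position_eq h1 h)
          rcases h1.exists_prev with h3 | ⟨y, hy, hyz⟩
          · exfalso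
            rw [h3, position_entry] at hlt h2
            omega
          · have hyz' := hyz
            have h5 := hy.position_next
            rw [hyz] at h5
            have hdy : H.IsDescendant p z' y :=
              (hz'.isDescendant_iff hy.not_isJunk).mpr ⟨hy, by omega⟩
            have hymem : y ∈ H.counters p K :=
              mem_counters.mpr ⟨⟨_, hy⟩, hy.index_le_next.trans (hyz ▸ hK)⟩
            rw [Finset.sum_eq_single_of_mem y hymem]
            · rw [if_pos hyz, load_waiting_of_isDescendant hdy]
            · intro y' _ hne
              split_ifs with hy'
              · refine load_waiting_of_not fun hdy' => hne ?_
                obtain ⟨h6, -, h7⟩ := hprev y' hy' hdy'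
                exact h6.eq_of_position_eq hy (by omega)
              · rfl
      · rw [load_waiting_of_not hd, if_neg, Finset.sum_eq_zero, add_zero]
        · intro y _
          split_ifs with hy
          · refine load_waiting_of_not fun hdy => hd ?_
            obtain ⟨n, rfl⟩ := hdy
            exact ⟨n + 1, by rw [Function.iterate_succ_apply', hy]⟩
          · rfl
        · intro he
          cases he
          exact hd ⟨0, rfl⟩
    · simp [load_matched]
  rw [surplus_eq_sum_load, polAt, Finset.sum_congr rfl fun r _ => key r, Finset.sum_add_distrib]
  congr 1
  rw [Finset.sum_comm]
  refine Finset.sum_congr rfl fun y _ => ?_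
  split_ifs
  · rw [surplus_eq_sum_load]
  · simp

open scoped Classical in
lemma slope_mul_countAt_le {c : Config T R} (hc : c.IsValid H p I) (hm : c.NoMatchable I) {K : ℕ}
    {z : Counter T} (hz : z ∈ H.counters p K) :
    H.slope p z * c.countAt z ≤ 2 * c.totalRate H p I z
      - H.slope p z * |(c.surplus H p I z : ℝ)|
      + ∑ y ∈ H.counters p K,
          if H.next p y = z then H.slope p y * |(c.surplus H p I y : ℝ)| else 0 := by
  obtain ⟨⟨l, hl⟩, hK⟩ := mem_counters.mp hz
  have hα := slope_pos_of_onPath hl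
  have hsum : (c.surplus H p I z : ℝ) = c.polAt I z +
      ∑ y ∈ H.counters p K, if H.next p y = z then (c.surplus H p I y : ℝ) else 0 := by
    rw [surplus_eq_polAt_add hc hz]
    push_cast
    rfl
  set A := ∑ y ∈ H.counters p K, if H.next p y = z then (c.surplus H p I y : ℝ) else 0 with hA
  set B := ∑ y ∈ H.counters p K,
    if H.next p y = z then H.slope p y * |(c.surplus H p I y : ℝ)| else 0 with hB
  have hAB : H.slope p z * |A| ≤ B := by
    calc H.slope p z * |A| ≤ H.slope p z * ∑ y ∈ H.counters p K,
          |if H.next p y = z then (c.surplus H p I y : ℝ) else 0| :=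
          mul_le_mul_of_nonneg_left (Finset.abs_sum_le_sum_abs _ _) hα.le
      _ ≤ B := by
        rw [Finset.mul_sum]
        refine Finset.sum_le_sum fun y hy => ?_
        split_ifs with hyz
        · obtain ⟨⟨l', hl'⟩, -⟩ := mem_counters.mp hy
          refine mul_le_mul_of_nonneg_right ?_ (abs_nonneg _)
          rw [slope_eq, slope_eq, ← hyz]
          exact p.slope_anti hl'.index_le_next (hyz ▸ hl.index_lt)
        · simp
  have hr1 := rate_nonneg hc z 1
  have hr2 := rate_nonneg hc z (-1)
  -- the case of a counter all of whose requests have polarity `s`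
  have key : ∀ s : ℤˣ, c.Occupied I z s → ¬ c.Occupied I z (-s) →
      H.slope p z * c.countAt z ≤ 2 * c.totalRate H p I z
        - H.slope p z * |(c.surplus H p I z : ℝ)| + B := by
    intro s hs hns
    rw [← polAt_of_not_occupied hns, eq_sub_of_add_eq hsum.symm]
    have hs1 : |((s : ℤ) : ℝ)| = 1 := by
      rcases Int.units_eq_one_or s with rfl | rfl <;> simp
    have hsA : -(((s : ℤ) : ℝ) * A) ≤ |A| := by
      calc -(((s : ℤ) : ℝ) * A) ≤ |((s : ℤ) : ℝ) * A| := neg_le_abs _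
        _ = |A| := by rw [abs_mul, hs1, one_mul]
    have hsur : |((s : ℤ) : ℝ) * (c.surplus H p I z : ℝ)| = |(c.surplus H p I z : ℝ)| := by
      rw [abs_mul, hs1, one_mul]
    by_cases hpos : 0 < (s : ℤ) * c.surplus H p I z
    · have hrate : c.rate H p I z s = H.slope p z * |(c.surplus H p I z : ℝ)| :=
        if_pos ⟨hs, hpos⟩
      have hle := rate_le_totalRate hc z s
      have h1 : ((s : ℤ) : ℝ) * (c.surplus H p I z : ℝ) ≤ |(c.surplus H p I z : ℝ)| := by
        rw [← hsur]
        exact le_abs_self _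
      rw [hrate] at hle
      have h2 := mul_le_mul_of_nonneg_left h1 hα.le
      have h3 := mul_le_mul_of_nonneg_left hsA hα.le
      rw [mul_sub]
      linarith
    · have hneg : ((s : ℤ) : ℝ) * (c.surplus H p I z : ℝ) ≤ 0 := by
        exact_mod_cast not_lt.mp hpos
      rw [abs_of_nonpos hneg] at hsur
      have h3 := mul_le_mul_of_nonneg_left hsA hα.le
      rw [← hsur, mul_sub]
      unfold totalRate
      linarith
  by_cases h1 : c.Occupied I z 1
  · exact key 1 h1 fun h2 => hm z ⟨h1, h2⟩
  · by_cases h2 : c.Occupied I z (-1)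
    · exact key (-1) h2 (by simpa using h1)
    · have h0 : c.countAt z = 0 := by
        refine Finset.sum_eq_zero fun r _ => if_neg fun hr => ?_
        rcases Int.units_eq_one_or (I.pol r) with h | h
        · exact h1 ⟨r, hr, h⟩
        · exact h2 ⟨r, hr, h⟩
      have h3 : (c.polAt I z : ℝ) = 0 := by
        have := polAt_of_not_occupied (s := 1) h2
        rw [h0] at this
        simpa using this
      rw [h3, zero_add] at hsum
      rw [h0, hsum]
      unfold totalRate
      linarith

/-- While no two requests can be matched, the slopes at which requests are waiting are paid for
twice over by the rates of the increasing counters. -/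
lemma sum_waitRate_le {c : Config T R} (hc : c.IsValid H p I) (hm : c.NoMatchable I) {K : ℕ}
    (hK : ∀ r z, c.status r = .waiting z → z ∈ H.counters p K) :
    ∑ r, waitRate H p (c.status r) ≤ 2 * ∑ z ∈ H.counters p K, c.totalRate H p I z := by
  classical
  have h1 : ∑ r, waitRate H p (c.status r) =
      ∑ z ∈ H.counters p K, H.slope p z * c.countAt z := by
    simp only [countAt, Finset.mul_sum]
    rw [Finset.sum_comm]
    refine Finset.sum_congr rfl fun r _ => ?_
    rcases hst : c.status r with _ | z | ⟨r', t⟩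
    · simp [waitRate]
    · rw [Finset.sum_eq_single_of_mem z (hK r z hst)]
      · simp [waitRate]
      · intro y _ hy
        rw [if_neg (by simpa using hy.symm), mul_zero]
    · simp [waitRate]
  have h2 := Finset.sum_le_sum fun z hz => slope_mul_countAt_le hc hm (K := K) (z := z) hz
  rw [Finset.sum_add_distrib, Finset.sum_sub_distrib, ← Finset.mul_sum, Finset.sum_comm] at h2
  have h3 : ∑ y ∈ H.counters p K, ∑ z ∈ H.counters p K,
      (if H.next p y = z then H.slope p y * |(c.surplus H p I y : ℝ)| else 0) ≤
      ∑ y ∈ H.counters p K, H.slope p y * |(c.surplus H p I y : ℝ)| := by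
    refine Finset.sum_le_sum fun y hy => ?_
    obtain ⟨⟨l, hl⟩, -⟩ := mem_counters.mp hy
    rw [Finset.sum_ite_eq]
    split_ifs
    · exact le_rfl
    · exact mul_nonneg (slope_pos_of_onPath hl).le (abs_nonneg _)
  rw [h1]
  linarith

end Config

/-! ### Invariants of a run -/

namespace WeightedHST

variable {T : RootedTree} {H : WeightedHST 2 T} {p : PiecewiseLinearDelay}

lemma capacity_nonneg {l : T} {z : Counter T} (h : H.OnPath p l z) :
    (0 : WithTop ℝ) ≤ H.capacity p z := by
  cases z with
  | edge v => exact WithTop.coe_nonneg.mpr (H.weight_pos v h.1).le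
  | delay v k =>
    change 0 ≤ p.height k
    by_cases hk : ((k + 1 : ℕ) : ℕ∞) < p.pieces
    · rw [p.height_of_lt hk]
      exact_mod_cast (sub_pos.mpr (p.f_x_lt hk)).le
    · rw [PiecewiseLinearDelay.height, if_neg hk]
      exact le_top

end WeightedHST

namespace Config

open WeightedHST

variable {T : RootedTree} {R : Type*} [Fintype R] {H : WeightedHST 2 T}
  {p : PiecewiseLinearDelay} {I : RequestSequence T R}

lemma isValid_initial : (initial T R).IsValid H p I where
  onPath := fun r z h => by simp [initial] at h
  le_arrival := fun r _ => I.arrival_nonneg r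
  arrival_le := fun r h => absurd rfl h
  matched := fun r r' t h => by simp [initial] at h
  level_nonneg := fun z s => le_rfl
  level_le := fun z s l h => capacity_nonneg h

lemma IsValid.step {c c' : Config T R} (hc : c.IsValid H p I) (h : Step H p I c c') :
    c'.IsValid H p I := by
  classical
  cases h with
  | arrive r h ht =>
    refine ⟨fun r₁ z hr => ?_, fun r₁ hr => ?_, fun r₁ hr => ?_, fun r₁ r₂ t hr => ?_,
      hc.level_nonneg, hc.level_le⟩
    · by_cases he : r₁ = r
      · subst he
        simp only [Function.update_self] at hr
        cases hr
        exact onPath_entry _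
      · simp only [Function.update_of_ne he] at hr
        exact hc.onPath r₁ z hr
    · by_cases he : r₁ = r
      · subst he
        simp at hr
      · simp only [Function.update_of_ne he] at hr
        exact hc.le_arrival r₁ hr
    · by_cases he : r₁ = r
      · subst he
        exact ht.ge
      · simp only [Function.update_of_ne he] at hr
        exact hc.arrival_le r₁ hr
    · by_cases he : r₁ = r
      · subst he
        simp at hr
      · simp only [Function.update_of_ne he] at hr
        obtain ⟨h1, h2⟩ := hc.matched r₁ r₂ t hr
        have he2 : r₂ ≠ r := by
          rintro rfl
          rw [h] at h1
          cases h1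
        simp only [Function.update_of_ne he2]
        exact ⟨h1, h2⟩
  | pair r r' z h h' hpol =>
    have hne : r' ≠ r := by
      rintro rfl
      exact units_ne_neg_self _ hpol
    have hst : ∀ r₁, r₁ ≠ r → r₁ ≠ r' → (Function.update (Function.update c.status r
        (.matched r' c.time)) r' (.matched r c.time)) r₁ = c.status r₁ := by
      intro r₁ h1 h2
      rw [Function.update_of_ne h2, Function.update_of_ne h1]
    have hstr : (Function.update (Function.update c.status r
        (.matched r' c.time)) r' (.matched r c.time)) r = .matched r' c.time := by
      rw [Function.update_of_ne hne.symm, Function.update_self]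
    have hstr' : (Function.update (Function.update c.status r
        (.matched r' c.time)) r' (.matched r c.time)) r' = .matched r c.time := by
      rw [Function.update_self]
    have har : I.arrival r ≤ c.time := hc.arrival_le r (by simp [h])
    have har' : I.arrival r' ≤ c.time := hc.arrival_le r' (by simp [h'])
    refine ⟨fun r₁ z₁ hr => ?_, fun r₁ hr => ?_, fun r₁ hr => ?_, fun r₁ r₂ t hr => ?_,
      hc.level_nonneg, hc.level_le⟩
    all_goals
      by_cases he : r₁ = r
      · subst he
        simp only [hstr] at hr
        try cases hr
        try first
          | exact har
          | exact ⟨hstr', hpol, har⟩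
      by_cases he' : r₁ = r'
      · subst he'
        simp only [hstr'] at hr
        try cases hr
        try first
          | exact har'
          | exact ⟨hstr, by rw [hpol, neg_neg], har'⟩
      simp only [hst r₁ he he'] at hr
    · exact hc.onPath r₁ z₁ hr
    · exact hc.le_arrival r₁ hr
    · exact hc.arrival_le r₁ hr
    · obtain ⟨h1, h2⟩ := hc.matched r₁ r₂ t hr
      refine ⟨?_, h2⟩
      change Function.update (Function.update c.status r
        (.matched r' c.time)) r' (.matched r c.time) r₂ = _
      rw [hst r₂, h1]
      · rintro rfl
        rw [h] at h1
        cases h1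
      · rintro rfl
        rw [h'] at h1
        cases h1
  | move r z h hinc hopp hfull =>
    have hz := hc.onPath r z h
    refine ⟨fun r₁ z hr => ?_, fun r₁ hr => ?_, fun r₁ hr => ?_, fun r₁ r₂ t hr => ?_,
      fun z₁ s => ?_, fun z₁ s l hl => ?_⟩
    · by_cases he : r₁ = r
      · subst he
        simp only [Function.update_self] at hr
        cases hr
        refine hz.next ?_
        rw [← hfull]
        exact WithTop.coe_ne_top
      · simp only [Function.update_of_ne he] at hr
        exact hc.onPath r₁ z hr
    · by_cases he : r₁ = r
      · subst he
        simp at hr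
      · simp only [Function.update_of_ne he] at hr
        exact hc.le_arrival r₁ hr
    · by_cases he : r₁ = r
      · subst he
        exact hc.arrival_le r₁ (by simp [h])
      · simp only [Function.update_of_ne he] at hr
        exact hc.arrival_le r₁ hr
    · by_cases he : r₁ = r
      · subst he
        simp at hr
      · simp only [Function.update_of_ne he] at hr
        obtain ⟨h1, h2⟩ := hc.matched r₁ r₂ t hr
        have he2 : r₂ ≠ r := by
          rintro rfl
          rw [h] at h1
          cases h1
        simp only [Function.update_of_ne he2]
        exact ⟨h1, h2⟩
    · by_cases he : z₁ = z
      · subst he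
        simp
      · simp only [Function.update_of_ne he]
        exact hc.level_nonneg z₁ s
    · by_cases he : z₁ = z
      · subst he
        simp only [Function.update_self]
        exact capacity_nonneg hl
      · simp only [Function.update_of_ne he]
        exact hc.level_le z₁ s l hl
  | elapse τ hτ hfuture hmatch hcap =>
    refine ⟨hc.onPath, fun r hr => hfuture r hr, fun r hr => ?_, hc.matched, fun z s => ?_,
      fun z s l hl => ?_⟩
    · exact (hc.arrival_le r hr).trans (le_add_of_nonneg_right hτ.le)
    · exact add_nonneg (hc.level_nonneg z s) (mul_nonneg (rate_nonneg hc z s) hτ.le)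
    · by_cases hi : c.Increases H p I z s
      · exact hcap z s hi
      · have h0 : c.rate H p I z s = 0 := if_neg hi
        simp only [h0, zero_mul, add_zero]
        exact hc.level_le z s l hl

lemma Reachable.isValid {c : Config T R} (h : Reachable H p I c) : c.IsValid H p I := by
  induction h with
  | refl => exact isValid_initial
  | tail _ hs ih => exact ih.step hs

lemma NoMatchable.not_occupied_neg {c : Config T R} (hm : c.NoMatchable I) {z : Counter T}
    {s : ℤˣ} (h : c.Occupied I z s) : ¬ c.Occupied I z (-s) := by
  intro h'
  rcases Int.units_eq_one_or s with rfl | rfl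
  · exact hm z ⟨h, h'⟩
  · exact hm z ⟨by simpa using h', h⟩

lemma rate_pos {c : Config T R} (hc : c.IsValid H p I) {z : Counter T} {s : ℤˣ}
    (h : c.Increases H p I z s) : 0 < c.rate H p I z s := by
  have h1 : c.rate H p I z s = H.slope p z * |(c.surplus H p I z : ℝ)| := if_pos h
  obtain ⟨⟨r, hr, -⟩, h2⟩ := h
  rw [h1]
  refine mul_pos (slope_pos_of_onPath (hc.onPath r z hr)) (abs_pos.mpr ?_)
  intro h0
  have h0 : c.surplus H p I z = 0 := by exact_mod_cast h0
  rw [h0, mul_zero] at h2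
  exact lt_irrefl _ h2

lemma IsValid.exists_yields {c : Config T R} (hc : c.IsValid H p I)
    (hall : ∀ r, ∃ r' t, c.status r = .matched r' t) : ∃ A : Solution I, c.Yields A := by
  choose partner time h using hall
  have hinv : ∀ r, partner (partner r) = r ∧ time (partner r) = time r := by
    intro r
    have h1 := (hc.matched r _ _ (h r)).1
    rw [h (partner r)] at h1
    injection h1 with h2 h3
    exact ⟨h2, h3⟩
  exact ⟨⟨partner, time, fun r => (hinv r).1, fun r => (hc.matched r _ _ (h r)).2.1,
    fun r => (hinv r).2, fun r => (hc.matched r _ _ (h r)).2.2⟩, h⟩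

end Config

/-! ### The potential of a counter -/

/-- The potential of a counter of capacity `w` whose positive and negative copies have the levels
`a` and `b`, when the surplus of the algorithm exceeds the surplus of the solution by `d`. -/
noncomputable def potential (w : ℝ) (d : ℤ) (a b : ℝ) : ℝ :=
  3 * (if 0 < d then w * d - a + 2 * b else if d < 0 then -(w * d) + 2 * a - b else a + b) + a + b

lemma potential_neg (w : ℝ) (d : ℤ) (a b : ℝ) : potential w (-d) b a = potential w d a b := by
  unfold potential
  rcases lt_trichotomy d 0 with h | rfl | h
  · rw [if_pos (by omega), if_neg (by omega), if_pos h]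
    push_cast
    ring
  · simp only [neg_zero, lt_irrefl, if_false]
    ring
  · rw [if_neg (by omega), if_pos (by omega), if_pos h]
    push_cast
    ring

lemma potential_zero (w a b : ℝ) : potential w 0 a b = 4 * (a + b) := by
  simp only [potential, lt_irrefl, if_false]
  ring

lemma potential_of_pos (w a b : ℝ) {d : ℤ} (h : 0 < d) :
    potential w d a b = 3 * w * d - 2 * a + 7 * b := by
  rw [potential, if_pos h]
  ring

lemma potential_of_neg (w a b : ℝ) {d : ℤ} (h : d < 0) :
    potential w d a b = -(3 * w * d) + 7 * a - 2 * b := by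
  rw [potential, if_neg (by omega), if_pos h]
  ring

lemma potential_nonneg {w a b : ℝ} {d : ℤ} (ha : 0 ≤ a) (hb : 0 ≤ b)
    (h : d = 0 ∨ (a ≤ w ∧ b ≤ w)) : 0 ≤ potential w d a b := by
  rcases lt_trichotomy d 0 with hd | rfl | hd
  · obtain ⟨h1, h2⟩ := h.resolve_left hd.ne
    rw [potential_of_neg _ _ _ hd]
    have : (d : ℝ) ≤ -1 := by exact_mod_cast Int.le_sub_one_of_lt hd
    nlinarith
  · rw [potential_zero]
    linarith
  · obtain ⟨h1, h2⟩ := h.resolve_left hd.ne'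
    rw [potential_of_pos _ _ _ hd]
    have : (1 : ℝ) ≤ d := by exact_mod_cast hd
    nlinarith

lemma potential_jump {w a b : ℝ} (ha : 0 ≤ a) (hb : 0 ≤ b) (haw : a ≤ w) (hbw : b ≤ w)
    (d d' : ℤ) : potential w d' a b ≤ potential w d a b + 6 * w * |((d' - d : ℤ) : ℝ)| := by
  have hw : 0 ≤ w := ha.trans haw
  have hle := mul_le_mul_of_nonneg_left (le_abs_self (((d' - d : ℤ) : ℝ))) hw
  have hge := mul_le_mul_of_nonneg_left (neg_le_abs (((d' - d : ℤ) : ℝ))) hw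
  have hnn := mul_nonneg hw (abs_nonneg (((d' - d : ℤ) : ℝ)))
  set m := |((d' - d : ℤ) : ℝ)| with hm
  push_cast at hle hge
  rcases lt_trichotomy d 0 with hd | rfl | hd <;> rcases lt_trichotomy d' 0 with hd' | rfl | hd'
  · rw [potential_of_neg _ _ _ hd, potential_of_neg _ _ _ hd']
    nlinarith
  · rw [potential_of_neg _ _ _ hd, potential_zero]
    have h1 : (d : ℝ) ≤ -1 := by exact_mod_cast Int.le_sub_one_of_lt hd
    push_cast at hle hge
    nlinarith
  · rw [potential_of_neg _ _ _ hd, potential_of_pos _ _ _ hd']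
    have h1 : (d : ℝ) ≤ -1 := by exact_mod_cast Int.le_sub_one_of_lt hd
    have h2 : (1 : ℝ) ≤ d' := by exact_mod_cast hd'
    nlinarith
  · rw [potential_of_neg _ _ _ hd', potential_zero]
    have h1 : (d' : ℝ) ≤ -1 := by exact_mod_cast Int.le_sub_one_of_lt hd'
    push_cast at hle hge
    nlinarith
  · linarith
  · rw [potential_of_pos _ _ _ hd', potential_zero]
    have h1 : (1 : ℝ) ≤ d' := by exact_mod_cast hd'
    push_cast at hle hge
    nlinarith
  · rw [potential_of_pos _ _ _ hd, potential_of_neg _ _ _ hd']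
    have h1 : (d' : ℝ) ≤ -1 := by exact_mod_cast Int.le_sub_one_of_lt hd'
    have h2 : (1 : ℝ) ≤ d := by exact_mod_cast hd
    nlinarith
  · rw [potential_of_pos _ _ _ hd, potential_zero]
    have h1 : (1 : ℝ) ≤ d := by exact_mod_cast hd
    push_cast at hle hge
    nlinarith
  · rw [potential_of_pos _ _ _ hd, potential_of_pos _ _ _ hd']
    nlinarith

lemma potential_move_pos {w b : ℝ} (hw : 0 ≤ w) (hb : 0 ≤ b) (hbw : b ≤ w) (d : ℤ) :
    potential w (d - 1) 0 0 + w ≤ potential w d w b := by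
  rcases lt_trichotomy d 0 with hd | rfl | hd
  · rw [potential_of_neg _ _ _ hd, potential_of_neg _ _ _ (by omega)]
    push_cast
    nlinarith
  · rw [potential_zero, potential_of_neg _ _ _ (by omega)]
    push_cast
    nlinarith
  · rw [potential_of_pos _ _ _ hd]
    rcases (show 1 ≤ d from hd).eq_or_lt with rfl | h1
    · rw [sub_self, potential_zero]
      push_cast
      nlinarith
    · rw [potential_of_pos _ _ _ (by omega)]
      push_cast
      nlinarith

/-- When a full counter sends off a request and is reset, its potential drops by its capacity. -/
lemma potential_move {w : ℝ} (hw : 0 ≤ w) {y : ℤˣ → ℝ} (hy : ∀ s, 0 ≤ y s) (hyw : ∀ s, y s ≤ w)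
    {s : ℤˣ} (hs : y s = w) (d : ℤ) :
    potential w (d - s) 0 0 + w ≤ potential w d (y 1) (y (-1)) := by
  rcases Int.units_eq_one_or s with rfl | rfl
  · rw [hs]
    exact potential_move_pos hw (hy _) (hyw _) d
  · rw [hs, ← potential_neg, ← potential_neg w d]
    have := potential_move_pos hw (hy 1) (hyw 1) (-d)
    convert this using 3
    push_cast
    ring

lemma potential_grow_pos {w a b x : ℝ} (hx : 0 ≤ x) {s o : ℤ} (hs : 0 < s) :
    potential w (s - o) (a + x * |(s : ℝ)|) b + 2 * (x * |(s : ℝ)|) ≤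
      potential w (s - o) a b + 9 * x * |(o : ℝ)| := by
  have hsR : (0 : ℝ) < s := by exact_mod_cast hs
  rw [abs_of_pos hsR]
  have hxs := mul_nonneg hx hsR.le
  have hxo := mul_le_mul_of_nonneg_left (le_abs_self (o : ℝ)) hx
  have hxo' := mul_nonneg hx (abs_nonneg (o : ℝ))
  rcases lt_trichotomy (s - o) 0 with h | h | h
  · rw [potential_of_neg _ _ _ h, potential_of_neg _ _ _ h]
    have h1 : (s : ℝ) ≤ o := by exact_mod_cast (by omega : s ≤ o)
    nlinarith
  · rw [h, potential_zero, potential_zero]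
    have h1 : (s : ℝ) = o := by exact_mod_cast (by omega : s = o)
    rw [h1] at hxs ⊢
    linarith
  · rw [potential_of_pos _ _ _ h, potential_of_pos _ _ _ h]
    linarith

/-- The growth of an increasing counter is paid for by the potential, unless the surplus of the
solution is comparable to that of the algorithm. -/
lemma potential_grow {w x : ℝ} (hx : 0 ≤ x) {y g : ℤˣ → ℝ} {s o : ℤ}
    (hg : ∀ e : ℤˣ, g e = 0 ∨ (g e = x * |(s : ℝ)| ∧ 0 < (e : ℤ) * s)) :
    potential w (s - o) (y 1 + g 1) (y (-1) + g (-1)) + 2 * (g 1 + g (-1)) ≤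
      potential w (s - o) (y 1) (y (-1)) + 9 * x * |(o : ℝ)| := by
  have hxo := mul_nonneg hx (abs_nonneg (o : ℝ))
  rcases hg 1 with h1 | ⟨h1, hs⟩
  · rcases hg (-1) with h2 | ⟨h2, hs⟩
    · rw [h1, h2]
      simp only [add_zero, mul_zero]
      linarith
    · have hs : 0 < -s := by simpa using hs
      have := potential_grow_pos (w := w) (a := y (-1)) (b := y 1) hx (o := -o) hs
      rw [h1, h2, ← potential_neg, ← potential_neg w (s - o)]
      have e1 : -(s - o) = -s - -o := by ring
      rw [e1, add_zero, zero_add]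
      simpa using this
  · have hs : 0 < s := by simpa using hs
    have h2 : g (-1) = 0 := by
      rcases hg (-1) with h2 | ⟨-, h2⟩
      · exact h2
      · have : 0 < -s := by simpa using h2
        omega
    rw [h1, h2, add_zero, add_zero]
    exact potential_grow_pos hx hs

/-! ### The surplus of a solution and what the solution is charged -/

namespace Solution

open WeightedHST

variable {T : RootedTree} {R : Type*} [Fintype R] {I : RequestSequence T R}
  (H : WeightedHST 2 T) (p : PiecewiseLinearDelay) (S : Solution I)

/-- The time until which the solution keeps the request `r` at or below `z`: the request passes `z`
at the end of the piece of `z`, if it has not been matched before. -/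
noncomputable def deadline (r : R) (z : Counter T) : ℝ :=
  I.arrival r + p.clip (H.index p z) (S.time r - I.arrival r)

open scoped Classical in
/-- The surplus of `z` in the solution just after time `t`, when exactly the requests in `A` have
arrived. -/
noncomputable def offSurplus (A : R → Prop) (z : Counter T) (t : ℝ) : ℤ :=
  ∑ r, if A r ∧ H.OnPath p (I.loc r) z ∧ t ≤ S.deadline H p r z then (I.pol r : ℤ) else 0

/-- The request `r` leaves `z` in another way than by being matched below `z`, or its partner
does. -/
def Crosses (r : R) (z : Counter T) : Prop :=
  ¬ (H.OnPath p (I.loc (S.partner r)) z ∧ S.deadline H p r z = S.time r ∧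
    S.deadline H p (S.partner r) z = S.time r)

open scoped Classical in
/-- What the solution is charged up to time `t` for the request `r` at the counter `z`. -/
noncomputable def charge (r : R) (z : Counter T) (t : ℝ) : ℝ :=
  if H.OnPath p (I.loc r) z then
    9 * H.slope p z * max 0 (min t (S.deadline H p r z) - I.arrival r) +
      6 * (H.capacity p z).untopD 0 *
        (if S.Crosses H p r z ∧ S.deadline H p r z < t then 1 else 0)
  else 0

variable {H p S}

lemma arrival_le_deadline (r : R) (z : Counter T) : I.arrival r ≤ S.deadline H p r z :=
  le_add_of_nonneg_right (p.clip_nonneg _ (sub_nonneg.mpr (S.arrival_le r)))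

lemma untopD_capacity_nonneg {l : T} {z : Counter T} (h : H.OnPath p l z) :
    0 ≤ (H.capacity p z).untopD 0 := by
  have := capacity_nonneg h
  cases hc : H.capacity p z with
  | top => exact le_rfl
  | coe w =>
    rw [hc] at this
    exact WithTop.coe_nonneg.mp this

lemma charge_nonneg (r : R) (z : Counter T) (t : ℝ) : 0 ≤ S.charge H p r z t := by
  unfold charge
  by_cases h : H.OnPath p (I.loc r) z
  · have h1 := (slope_pos_of_onPath h).le
    have h2 := untopD_capacity_nonneg h
    rw [if_pos h]
    refine add_nonneg (mul_nonneg (by positivity) (le_max_left _ _))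
      (mul_nonneg (by positivity) ?_)
    split_ifs <;> norm_num
  · rw [if_neg h]

lemma not_crosses_of_capacity_eq_top {l : T} {z : Counter T} (h : H.OnPath p l z)
    (hc : H.capacity p z = ⊤) (r : R) : ¬ S.Crosses H p r z := by
  have hcl : ∀ t, p.clip (H.index p z) t = t := by
    intro t
    refine if_neg fun hk => ?_
    cases z with
    | edge v => exact capacity_edge_ne_top v hc
    | delay v k => exact capacity_ne_top_of_succ_lt hk hc
  rw [Crosses, not_not]
  refine ⟨h.of_capacity_eq_top hc, ?_, ?_⟩
  · rw [deadline, hcl]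
    ring
  · rw [deadline, hcl, S.time_partner]
    ring

open scoped Classical in
/-- A pair of requests that is matched below `z` in the solution does not affect the surplus of
`z`. -/
lemma abs_offSurplus_sub_le {A : R → Prop} {t t' : ℝ} (ht : t ≤ t')
    (hA : ∀ r, A r ∨ t' ≤ I.arrival r) (z : Counter T) :
    |((S.offSurplus H p A z t' - S.offSurplus H p A z t : ℤ) : ℝ)| ≤
      ∑ r, if H.OnPath p (I.loc r) z ∧ S.Crosses H p r z ∧
        t ≤ S.deadline H p r z ∧ S.deadline H p r z < t' then 1 else 0 := by
  let P : R → Prop := fun r => A r ∧ H.OnPath p (I.loc r) z ∧ t ≤ S.deadline H p r z ∧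
    S.deadline H p r z < t'
  have hzero : ∑ r, (if P r ∧ ¬ S.Crosses H p r z then (I.pol r : ℤ) else 0) = 0 := by
    have hinv : ∀ r, P r ∧ ¬ S.Crosses H p r z →
        P (S.partner r) ∧ ¬ S.Crosses H p (S.partner r) z := by
      rintro r ⟨⟨-, h2, h3, h4⟩, h5⟩
      rw [Crosses, not_not] at h5
      obtain ⟨h6, h7, h8⟩ := h5
      rw [h7] at h3 h4
      refine ⟨⟨?_, h6, h8 ▸ h3, h8 ▸ h4⟩, ?_⟩
      · refine (hA _).resolve_right fun h => ?_
        have := S.arrival_le (S.partner r)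
        rw [S.time_partner] at this
        linarith
      · rw [Crosses, not_not, S.partner_partner, S.time_partner]
        exact ⟨h2, h8, h7⟩
    have hinv' : ∀ r, P (S.partner r) ∧ ¬ S.Crosses H p (S.partner r) z ↔
        P r ∧ ¬ S.Crosses H p r z :=
      fun r => ⟨fun h => by simpa only [S.partner_partner] using hinv _ h, hinv r⟩
    have h : ∑ r, (if P (S.partner r) ∧ ¬ S.Crosses H p (S.partner r) z then
        (I.pol (S.partner r) : ℤ) else 0) =
        ∑ r, (if P r ∧ ¬ S.Crosses H p r z then (I.pol r : ℤ) else 0) :=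
      Equiv.sum_comp (Function.Involutive.toPerm S.partner S.partner_partner)
        (fun r => if P r ∧ ¬ S.Crosses H p r z then (I.pol r : ℤ) else 0)
    simp only [hinv', S.pol_partner] at h
    have h2 : ∀ r, (if P r ∧ ¬ S.Crosses H p r z then ((-I.pol r : ℤˣ) : ℤ) else 0) =
        -(if P r ∧ ¬ S.Crosses H p r z then (I.pol r : ℤ) else 0) := by
      intro r
      split_ifs <;> simp
    rw [Finset.sum_congr rfl fun r _ => h2 r, Finset.sum_neg_distrib] at h
    omega
  have hdiff : S.offSurplus H p A z t' - S.offSurplus H p A z t =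
      -∑ r, (if P r ∧ S.Crosses H p r z then (I.pol r : ℤ) else 0) := by
    have hsplit : S.offSurplus H p A z t = S.offSurplus H p A z t' +
        (∑ r, (if P r ∧ S.Crosses H p r z then (I.pol r : ℤ) else 0) +
          ∑ r, (if P r ∧ ¬ S.Crosses H p r z then (I.pol r : ℤ) else 0)) := by
      rw [offSurplus, offSurplus, ← Finset.sum_add_distrib, ← Finset.sum_add_distrib]
      refine Finset.sum_congr rfl fun r _ => ?_
      by_cases h1 : A r ∧ H.OnPath p (I.loc r) z
      · by_cases h2 : t' ≤ S.deadline H p r z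
        · have h3 : ¬ P r := fun h => absurd h.2.2.2 (not_lt_of_ge h2)
          rw [if_pos ⟨h1.1, h1.2, ht.trans h2⟩, if_pos ⟨h1.1, h1.2, h2⟩, if_neg (fun h => h3 h.1),
            if_neg (fun h => h3 h.1)]
          ring
        · rw [if_neg (c := _ ∧ _ ∧ t' ≤ _) (fun h => h2 h.2.2)]
          by_cases h3 : t ≤ S.deadline H p r z
          · have h4 : P r := ⟨h1.1, h1.2, h3, not_le.mp h2⟩
            rw [if_pos ⟨h1.1, h1.2, h3⟩]
            by_cases h5 : S.Crosses H p r z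
            · rw [if_pos ⟨h4, h5⟩, if_neg (fun h => h.2 h5)]
              ring
            · rw [if_neg (fun h => h5 h.2), if_pos ⟨h4, h5⟩]
              ring
          · have h4 : ¬ P r := fun h => h3 h.2.2.1
            rw [if_neg (fun h => h3 h.2.2), if_neg (fun h => h4 h.1), if_neg (fun h => h4 h.1)]
            ring
      · have h4 : ¬ P r := fun h => h1 ⟨h.1, h.2.1⟩
        rw [if_neg (fun h => h1 ⟨h.1, h.2.1⟩), if_neg (fun h => h1 ⟨h.1, h.2.1⟩),
          if_neg (fun h => h4 h.1), if_neg (fun h => h4 h.1)]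
        ring
    rw [hsplit, hzero]
    ring
  rw [hdiff]
  push_cast
  rw [abs_neg]
  refine (Finset.abs_sum_le_sum_abs _ _).trans (Finset.sum_le_sum fun r _ => ?_)
  split_ifs with h1 h2 h2
  · rcases Int.units_eq_one_or (I.pol r) with h | h <;> rw [h] <;> simp
  · exact absurd ⟨h1.1.2.1, h1.2, h1.1.2.2⟩ h2
  · simp
  · simp

open scoped Classical in
lemma abs_offSurplus_le (A : R → Prop) (z : Counter T) (t : ℝ) :
    |(S.offSurplus H p A z t : ℝ)| ≤
      ∑ r, if A r ∧ H.OnPath p (I.loc r) z ∧ t ≤ S.deadline H p r z then 1 else 0 := by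
  rw [offSurplus]
  push_cast
  refine (Finset.abs_sum_le_sum_abs _ _).trans (Finset.sum_le_sum fun r _ => ?_)
  split_ifs with h1
  · rcases Int.units_eq_one_or (I.pol r) with h | h <;> rw [h] <;> simp
  · simp

/-- Over a period without arrivals, the solution is charged for the surplus that it keeps at the
end of the period, and for the changes of its surplus. -/
lemma sum_charge_increment {A : R → Prop} {t t' : ℝ} (ht : t ≤ t')
    (hA : ∀ r, A r → I.arrival r ≤ t) (hA' : ∀ r, A r ∨ t' ≤ I.arrival r) {l : T} {z : Counter T}
    (hz : H.OnPath p l z) :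
    9 * (H.slope p z * (t' - t)) * |(S.offSurplus H p A z t' : ℝ)| +
      6 * (H.capacity p z).untopD 0 *
        |((S.offSurplus H p A z t' - S.offSurplus H p A z t : ℤ) : ℝ)| ≤
      ∑ r, S.charge H p r z t' - ∑ r, S.charge H p r z t := by
  classical
  have hα := (slope_pos_of_onPath hz).le
  have hw := untopD_capacity_nonneg hz
  have h1 := mul_le_mul_of_nonneg_left (S.abs_offSurplus_le (H := H) (p := p) A z t')
    (show 0 ≤ 9 * (H.slope p z * (t' - t)) by have := sub_nonneg.mpr ht; positivity)
  have h2 := mul_le_mul_of_nonneg_left (abs_offSurplus_sub_le (S := S) (H := H) (p := p) ht hA' z)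
    (show 0 ≤ 6 * (H.capacity p z).untopD 0 by positivity)
  refine (add_le_add h1 h2).trans ?_
  rw [Finset.mul_sum, Finset.mul_sum, ← Finset.sum_add_distrib, ← Finset.sum_sub_distrib]
  refine Finset.sum_le_sum fun r _ => ?_
  unfold charge
  by_cases hp : H.OnPath p (I.loc r) z
  swap
  · simp [hp]
  simp only [hp, if_true, true_and]
  have hwait : 9 * (H.slope p z * (t' - t)) *
      (if A r ∧ t' ≤ S.deadline H p r z then 1 else 0) ≤
      9 * H.slope p z * max 0 (min t' (S.deadline H p r z) - I.arrival r) -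
      9 * H.slope p z * max 0 (min t (S.deadline H p r z) - I.arrival r) := by
    rw [← mul_sub, mul_assoc, mul_assoc, mul_assoc]
    refine mul_le_mul_of_nonneg_left (mul_le_mul_of_nonneg_left ?_ hα) (by norm_num)
    split_ifs with h
    · have h3 := hA r h.1
      rw [min_eq_left h.2, min_eq_left (ht.trans h.2), max_eq_right (by linarith),
        max_eq_right (by linarith)]
      linarith
    · rw [mul_zero, sub_nonneg]
      exact max_le_max le_rfl (sub_le_sub_right (min_le_min ht le_rfl) _)
  have hcross : 6 * (H.capacity p z).untopD 0 *
      (if S.Crosses H p r z ∧ t ≤ S.deadline H p r z ∧ S.deadline H p r z < t' then 1 else 0) =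
      6 * (H.capacity p z).untopD 0 *
        (if S.Crosses H p r z ∧ S.deadline H p r z < t' then 1 else 0) -
      6 * (H.capacity p z).untopD 0 *
        (if S.Crosses H p r z ∧ S.deadline H p r z < t then 1 else 0) := by
    rw [← mul_sub]
    congr 1
    by_cases h3 : S.Crosses H p r z
    · simp only [h3, true_and]
      rcases lt_or_ge (S.deadline H p r z) t with h4 | h4
      · rw [if_neg (fun h => absurd h.1 (not_le_of_gt h4)), if_pos (h4.trans_le ht), if_pos h4]
        ring
      · rw [if_neg (not_lt_of_ge h4), sub_zero]
        simp only [h4, true_and]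
    · simp [h3]
  rw [hcross]
  linarith

end Solution

/-! ### The main invariant -/

namespace WeightedHST

variable {T : RootedTree} [Fintype T] {H : WeightedHST 2 T} {p : PiecewiseLinearDelay}

lemma sum_edgesBelow_nonneg (v l : T) : 0 ≤ ∑ u ∈ edgesBelow v l, H.weight u :=
  Finset.sum_nonneg fun _ hu =>
    (H.weight_pos _ (ne_bot_of_gt (mem_edgesBelow.mp hu).1)).le

lemma dist_le {v l l' : T} (hl : v ≤ l) (hl' : v ≤ l') :
    H.dist l l' ≤ ∑ u ∈ edgesBelow v l, H.weight u + ∑ u ∈ edgesBelow v l', H.weight u := by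
  classical
  have hnn : ∀ a b : T, a ≤ b → ∀ u ∈ edgesBelow a b, 0 ≤ H.weight u := fun a b _ u hu =>
    (H.weight_pos u (ne_bot_of_gt (mem_edgesBelow.mp hu).1)).le
  have hmem : ∀ a b e : T, v ≤ a → v ≤ b → e ≤ a → ¬ e ≤ b → e ∈ edgesBelow v a := by
    intro a b e ha hb h1 h2
    refine mem_edgesBelow.mpr ⟨?_, h1⟩
    rcases le_total_of_directed h1 ha with h | h
    · exact lt_of_le_of_ne h fun h3 => h2 (h3 ▸ hb)
    · exact absurd (h.trans hb) h2
  rw [← Finset.sum_union_inter]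
  have h1 : H.dist l l' ≤ ∑ u ∈ edgesBelow v l ∪ edgesBelow v l', H.weight u := by
    unfold dist
    refine Finset.sum_le_sum_of_subset_of_nonneg ?_ ?_
    · intro e he
      simp only [Finset.mem_filter, Finset.mem_univ, true_and] at he
      obtain ⟨-, ⟨h1, h2⟩ | ⟨h1, h2⟩⟩ := he
      · exact Finset.mem_union_left _ (hmem l l' e hl hl' h1 h2)
      · exact Finset.mem_union_right _ (hmem l' l e hl' hl h1 h2)
    · intro u hu _
      rcases Finset.mem_union.mp hu with hu | hu
      · exact hnn _ _ hl u hu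
      · exact hnn _ _ hl' u hu
  have h2 : 0 ≤ ∑ u ∈ edgesBelow v l ∩ edgesBelow v l', H.weight u :=
    Finset.sum_nonneg fun u hu => hnn _ _ hl u (Finset.mem_of_mem_inter_left hu)
  linarith

end WeightedHST

namespace Config

open WeightedHST

variable {T : RootedTree} {R : Type*} [Fintype R] [Fintype T] (H : WeightedHST 2 T)
  (p : PiecewiseLinearDelay) (I : RequestSequence T R)

/-- An upper bound, in terms of the current configuration, for the delay cost of a request so far
and the weight of the edges it has passed; for a matched request, its share of the cost. -/
noncomputable def requestCost (t : ℝ) (r : R) : Status T R → ℝ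
  | .future => 0
  | .waiting z => p.f (p.x (H.index p z)) + H.slope p z * (t - I.arrival r) +
      ∑ u ∈ edgesBelow z.vertex (I.loc r), H.weight u
  | .matched r' t' => p.f (t' - I.arrival r) + H.dist (I.loc r) (I.loc r') / 2

/-- The difference between the surpluses of the algorithm and of the solution. -/
noncomputable def gap {I : RequestSequence T R} (S : Solution I) (c : Config T R)
    (z : Counter T) : ℤ :=
  c.surplus H p I z - S.offSurplus H p (fun r => c.status r ≠ .future) z c.time

/-- The potential of a counter in a configuration. -/
noncomputable def counterPotential {I : RequestSequence T R} (S : Solution I) (c : Config T R)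
    (z : Counter T) : ℝ :=
  potential ((H.capacity p z).untopD 0) (gap H p S c z) (c.level z 1) (c.level z (-1))

/-- The main invariant of a run: what the algorithm has paid, together with the potential of all
counters, is at most what the solution has been charged. The inequality is stated for all
sufficiently large finite sets of counters. -/
structure Invariant {I : RequestSequence T R} (S : Solution I) (c : Config T R) : Prop where
  valid : c.IsValid H p I
  gap_eq_zero : ∀ l z, H.OnPath p l z → H.capacity p z = ⊤ → gap H p S c z = 0
  bound : ∀ᶠ K in atTop, (∀ r z, c.status r = .waiting z → z ∈ H.counters p K) ∧
    ∑ r, requestCost H p I c.time r (c.status r) + ∑ z ∈ H.counters p K, counterPotential H p S c z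
      ≤ ∑ z ∈ H.counters p K, ∑ r, S.charge H p r z c.time

variable {H p I} {S : Solution I}

lemma invariant_initial : Invariant H p S (initial T R) := by
  have hgap : ∀ z, gap H p S (initial T R) z = 0 := by
    intro z
    simp only [gap, surplus_eq_sum_load, Solution.offSurplus]
    simp [initial, load_future]
  refine ⟨isValid_initial, fun l z _ _ => hgap z, Eventually.of_forall fun K => ⟨?_, ?_⟩⟩
  · intro r z h
    simp [initial] at h
  · have h1 : ∑ r, requestCost H p I (initial T R).time r ((initial T R).status r) = 0 :=
      Finset.sum_eq_zero fun r _ => rfl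
    have h2 : ∑ z ∈ H.counters p K, counterPotential H p S (initial T R) z = 0 :=
      Finset.sum_eq_zero fun z _ => by
        rw [counterPotential, hgap, potential_zero]
        simp [initial]
    rw [h1, h2, add_zero]
    exact Finset.sum_nonneg fun z _ => Finset.sum_nonneg fun r _ => Solution.charge_nonneg r z _

lemma mem_counters_of_onPath {K : ℕ} {l : T} {z : Counter T} (h : H.OnPath p l z)
    (hK : H.index p z ≤ K) : z ∈ H.counters p K := mem_counters.mpr ⟨⟨l, h⟩, hK⟩

open scoped Classical in
lemma gap_arrive [DecidableEq R] {c : Config T R} {r : R} (h : c.status r = .future)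
    (ht : c.time = I.arrival r) {l : T} {z : Counter T} (hz : H.OnPath p l z) :
    gap H p S { c with
      status := Function.update c.status r (.waiting (H.entry p (I.loc r))) } z =
    gap H p S c z := by
  have h1 := surplus_arrive (c' := { c with
      status := Function.update c.status r (.waiting (H.entry p (I.loc r))) }) h rfl hz
  have h2 : S.offSurplus H p (fun r₁ => Function.update c.status r
      (.waiting (H.entry p (I.loc r))) r₁ ≠ .future) z c.time =
      S.offSurplus H p (fun r₁ => c.status r₁ ≠ .future) z c.time +
        if H.OnPath p (I.loc r) z then (I.pol r : ℤ) else 0 := by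
    have h3 : c.time ≤ S.deadline H p r z := ht ▸ Solution.arrival_le_deadline r z
    let F : R → Status T R → ℤ := fun r₁ st => if st ≠ Status.future ∧
      H.OnPath p (I.loc r₁) z ∧ c.time ≤ S.deadline H p r₁ z then (I.pol r₁ : ℤ) else 0
    have h4 : ∀ st : R → Status T R,
        S.offSurplus H p (fun r₁ => st r₁ ≠ .future) z c.time = ∑ r₁, F r₁ (st r₁) :=
      fun st => Finset.sum_congr rfl fun r₁ _ => by congr
    rw [h4, h4, sum_comp_update, h]
    simp [F, h3]
  unfold gap
  rw [h1]
  change _ - S.offSurplus H p (fun r₁ => Function.update c.status r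
      (.waiting (H.entry p (I.loc r))) r₁ ≠ .future) z c.time = _
  rw [h2]
  ring

lemma Invariant.arrive [DecidableEq R] {c : Config T R} (hc : Invariant H p S c) {r : R}
    (h : c.status r = .future)
    (ht : c.time = I.arrival r)
    (hv : ({ c with status := Function.update c.status r (.waiting (H.entry p (I.loc r))) } :
      Config T R).IsValid H p I) :
    Invariant H p S
      { c with status := Function.update c.status r (.waiting (H.entry p (I.loc r))) } := by
  refine ⟨hv, fun l z hz htop => by rw [gap_arrive h ht hz, hc.gap_eq_zero l z hz htop], ?_⟩
  filter_upwards [hc.bound] with K hK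
  refine ⟨fun r₁ z hr => ?_, ?_⟩
  · by_cases he : r₁ = r
    · subst he
      simp only [Function.update_self] at hr
      cases hr
      exact mem_counters_of_onPath (onPath_entry _) (by rw [index_entry]; exact K.zero_le)
    · simp only [Function.update_of_ne he] at hr
      exact hK.1 r₁ z hr
  · refine le_trans (le_of_eq ?_) hK.2
    congr 1
    · change ∑ r₁, requestCost H p I c.time r₁ (Function.update c.status r
        (.waiting (H.entry p (I.loc r))) r₁) = _
      rw [sum_comp_update, h]
      simp [requestCost, index_entry, vertex_entry, edgesBelow_self, ht, p.x_zero, p.f_zero]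
    · refine Finset.sum_congr rfl fun z hz => ?_
      obtain ⟨⟨l, hl⟩, -⟩ := mem_counters.mp hz
      rw [counterPotential, counterPotential, gap_arrive h ht hl]

lemma requestCost_matched_le {c : Config T R} (hc : c.IsValid H p I) {r r' : R} {z : Counter T}
    (h : c.status r = .waiting z) (h' : c.status r' = .waiting z) :
    requestCost H p I c.time r (.matched r' c.time) +
      requestCost H p I c.time r' (.matched r c.time) ≤
    requestCost H p I c.time r (c.status r) + requestCost H p I c.time r' (c.status r') := by
  have hz := hc.onPath r z h
  have hz' := hc.onPath r' z h'
  have h1 : I.arrival r ≤ c.time := hc.arrival_le r (by simp [h])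
  have h2 : I.arrival r' ≤ c.time := hc.arrival_le r' (by simp [h'])
  have h3 := p.f_le_line hz.index_lt (sub_nonneg.mpr h1)
  have h4 := p.f_le_line hz.index_lt (sub_nonneg.mpr h2)
  have h5 := H.dist_le hz.vertex_le hz'.vertex_le
  have h6 := H.dist_le hz'.vertex_le hz.vertex_le
  rw [h, h']
  simp only [requestCost, slope_eq]
  linarith

lemma Invariant.pair [DecidableEq R] {c : Config T R} (hc : Invariant H p S c) {r r' : R}
    {z : Counter T} (h : c.status r = .waiting z) (h' : c.status r' = .waiting z)
    (hpol : I.pol r' = -I.pol r)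
    (hv : ({ c with
      status := Function.update (Function.update c.status r
        (.matched r' c.time)) r' (.matched r c.time) } : Config T R).IsValid H p I) :
    Invariant H p S { c with
      status := Function.update (Function.update c.status r
        (.matched r' c.time)) r' (.matched r c.time) } := by
  have hne : r' ≠ r := by
    rintro rfl
    exact units_ne_neg_self _ hpol
  have hgap : ∀ z', gap H p S { c with
      status := Function.update (Function.update c.status r
        (.matched r' c.time)) r' (.matched r c.time) } z' = gap H p S c z' := by
    intro z'
    unfold gap
    congr 1
    · exact surplus_pair h h' hpol rfl z'
    · congr 1
      funext r₁
      by_cases he' : r₁ = r'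
      · subst he'
        simp [h']
      · by_cases he : r₁ = r
        · subst he
          simp [h, Function.update_of_ne he']
        · simp [Function.update_of_ne he', Function.update_of_ne he]
  refine ⟨hv, fun l z hz htop => by rw [hgap, hc.gap_eq_zero l z hz htop], ?_⟩
  filter_upwards [hc.bound] with K hK
  refine ⟨fun r₁ z₁ hr => ?_, ?_⟩
  · by_cases he' : r₁ = r'
    · subst he'
      simp at hr
    · by_cases he : r₁ = r
      · subst he
        simp [Function.update_of_ne he'] at hr
      · simp only [Function.update_of_ne he', Function.update_of_ne he] at hr
        exact hK.1 r₁ z₁ hr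
  · refine le_trans (add_le_add ?_ (le_of_eq ?_)) hK.2
    · change ∑ r₁, requestCost H p I c.time r₁ (Function.update (Function.update c.status r
        (.matched r' c.time)) r' (.matched r c.time) r₁) ≤ _
      rw [sum_comp_update, sum_comp_update, Function.update_of_ne hne]
      linarith [requestCost_matched_le hc.valid h h']
    · refine Finset.sum_congr rfl fun z _ => ?_
      rw [counterPotential, counterPotential, hgap]

/-- A move costs at most the capacity of the counter. -/
lemma requestCost_move_le {c : Config T R} (hc : c.IsValid H p I) {r : R} {z : Counter T}
    (h : c.status r = .waiting z) (hcap : H.capacity p z ≠ ⊤) :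
    requestCost H p I c.time r (.waiting (H.next p z)) ≤
      requestCost H p I c.time r (c.status r) + (H.capacity p z).untopD 0 := by
  classical
  have hz := hc.onPath r z h
  have ht : 0 ≤ c.time - I.arrival r := sub_nonneg.mpr (hc.arrival_le r (by simp [h]))
  rw [h]
  cases z with
  | edge v =>
    simp only [requestCost, slope_eq, index_next_edge, vertex_next_edge]
    rw [edgesBelow_pred hz.1 hz.2, Finset.sum_insert (notMem_edgesBelow_self _ _)]
    change _ ≤ _ + H.weight v
    simp only [Counter.vertex]
    linarith
  | delay v k =>
    have hk := succ_lt_pieces_of_capacity_ne_top hcap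
    simp only [requestCost, slope_eq, hz.index_next_delay, vertex_next_delay]
    have hy : (H.capacity p (.delay v k)).untopD 0 = p.f (p.x (k + 1)) - p.f (p.x k) := by
      change (p.height k).untopD 0 = _
      rw [p.height_of_lt hk]
      rfl
    rw [hy]
    have h1 := mul_le_mul_of_nonneg_right (p.slope_anti k.le_succ hk) ht
    simp only [Counter.vertex, index] at h1 ⊢
    linarith

lemma Invariant.move [DecidableEq R] [DecidableEq (Counter T)] {c : Config T R}
    (hc : Invariant H p S c) {r : R} {z : Counter T} (h : c.status r = .waiting z)
    (hfull : ((c.level z (I.pol r) : ℝ) : WithTop ℝ) = H.capacity p z)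
    (hv : ({ c with
      status := Function.update c.status r (.waiting (H.next p z))
      level := Function.update c.level z (fun _ => 0) } : Config T R).IsValid H p I) :
    Invariant H p S { c with
      status := Function.update c.status r (.waiting (H.next p z))
      level := Function.update c.level z (fun _ => 0) } := by
  have hz := hc.valid.onPath r z h
  have hcap : H.capacity p z ≠ ⊤ := by
    rw [← hfull]
    exact WithTop.coe_ne_top
  have hfull' : c.level z (I.pol r) = (H.capacity p z).untopD 0 := by
    rw [← hfull]
    rfl
  have hA : (fun r₁ => Function.update c.status r (.waiting (H.next p z)) r₁ ≠ .future) =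
      fun r₁ => c.status r₁ ≠ .future := by
    funext r₁
    by_cases he : r₁ = r
    · subst he
      simp [h]
    · simp [Function.update_of_ne he]
  have hgap : ∀ z', gap H p S { c with
      status := Function.update c.status r (.waiting (H.next p z))
      level := Function.update c.level z (fun _ => 0) } z' =
      gap H p S c z' - if z' = z then (I.pol r : ℤ) else 0 := by
    intro z'
    unfold gap
    change _ - S.offSurplus H p
      (fun r₁ => Function.update c.status r (.waiting (H.next p z)) r₁ ≠ .future) z' c.time = _
    rw [hA, surplus_move h hz rfl]
    ring
  refine ⟨hv, fun l z' hz' htop => ?_, ?_⟩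
  · have hne : z' ≠ z := fun he => hcap (he ▸ htop)
    rw [hgap, if_neg hne, sub_zero, hc.gap_eq_zero l z' hz' htop]
  filter_upwards [hc.bound, eventually_ge_atTop (H.index p (H.next p z))] with K hK hK2
  refine ⟨fun r₁ z₁ hr => ?_, ?_⟩
  · by_cases he : r₁ = r
    · subst he
      simp only [Function.update_self] at hr
      cases hr
      exact mem_counters_of_onPath (hz.next hcap) hK2
    · simp only [Function.update_of_ne he] at hr
      exact hK.1 r₁ z₁ hr
  · refine le_trans ?_ hK.2
    have hzK := hK.1 r z h
    have h1 : ∑ r₁, requestCost H p I c.time r₁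
        (Function.update c.status r (.waiting (H.next p z)) r₁) ≤
        ∑ r₁, requestCost H p I c.time r₁ (c.status r₁) + (H.capacity p z).untopD 0 := by
      rw [sum_comp_update]
      linarith [requestCost_move_le hc.valid h hcap]
    have h2 : counterPotential H p S { c with
        status := Function.update c.status r (.waiting (H.next p z))
        level := Function.update c.level z (fun _ => 0) } z + (H.capacity p z).untopD 0 ≤
        counterPotential H p S c z := by
      rw [counterPotential, counterPotential, hgap, if_pos rfl]
      simp only [Function.update_self]
      refine potential_move (Solution.untopD_capacity_nonneg hz) (hc.valid.level_nonneg z)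
        (fun s => ?_) hfull' _
      have := hc.valid.level_le z s _ hz
      rw [← hfull] at this
      rw [← hfull']
      exact WithTop.coe_le_coe.mp this
    have h3 : ∀ z' ∈ (H.counters p K).erase z, counterPotential H p S { c with
        status := Function.update c.status r (.waiting (H.next p z))
        level := Function.update c.level z (fun _ => 0) } z' = counterPotential H p S c z' := by
      intro z' hz'
      have hne := Finset.ne_of_mem_erase hz'
      rw [counterPotential, counterPotential, hgap, if_neg hne, sub_zero]
      simp only [Function.update_of_ne hne]
    rw [← Finset.add_sum_erase _ _ hzK, ← Finset.add_sum_erase _ _ hzK, Finset.sum_congr rfl h3]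
    linarith

lemma Invariant.elapse {c : Config T R} (hc : Invariant H p S c) {τ : ℝ} (hτ : 0 < τ)
    (hfuture : ∀ r, c.status r = .future → c.time + τ ≤ I.arrival r)
    (hmatch : c.NoMatchable I)
    (hv : ({ c with
      time := c.time + τ
      level := fun z s => c.level z s + c.rate H p I z s * τ } : Config T R).IsValid H p I) :
    Invariant H p S { c with
      time := c.time + τ
      level := fun z s => c.level z s + c.rate H p I z s * τ } := by
  have ht : c.time ≤ c.time + τ := by linarith
  have hA : ∀ r, c.status r ≠ .future → I.arrival r ≤ c.time := hc.valid.arrival_le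
  have hA' : ∀ r, c.status r ≠ .future ∨ c.time + τ ≤ I.arrival r := by
    intro r
    by_cases h : c.status r = .future
    · exact Or.inr (hfuture r h)
    · exact Or.inl h
  set c' : Config T R := { c with
    time := c.time + τ
    level := fun z s => c.level z s + c.rate H p I z s * τ } with hc'
  have hsur : ∀ z, c'.surplus H p I z = c.surplus H p I z := fun z => rfl
  have hgap : ∀ z, gap H p S c' z = gap H p S c z -
      (S.offSurplus H p (fun r => c.status r ≠ .future) z (c.time + τ) -
        S.offSurplus H p (fun r => c.status r ≠ .future) z c.time) := by
    intro z
    unfold gap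
    rw [hsur]
    change _ - S.offSurplus H p (fun r => c.status r ≠ .future) z (c.time + τ) = _
    ring
  have htop : ∀ l z, H.OnPath p l z → H.capacity p z = ⊤ → gap H p S c' z = 0 := by
    intro l z hz htop
    have h1 := Solution.abs_offSurplus_sub_le (S := S) (H := H) (p := p) ht hA' z
    have h2 : ∀ r, ¬ (H.OnPath p (I.loc r) z ∧ S.Crosses H p r z ∧
        c.time ≤ S.deadline H p r z ∧ S.deadline H p r z < c.time + τ) :=
      fun r h => Solution.not_crosses_of_capacity_eq_top hz htop r h.2.1
    simp only [h2, if_false, Finset.sum_const_zero] at h1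
    have h3 := abs_eq_zero.mp (le_antisymm h1 (abs_nonneg _))
    rw [hgap, hc.gap_eq_zero l z hz htop, zero_sub, neg_eq_zero]
    exact_mod_cast h3
  refine ⟨hv, htop, ?_⟩
  filter_upwards [hc.bound] with K hK
  refine ⟨hK.1, ?_⟩
  have hcost : ∑ r, requestCost H p I c'.time r (c'.status r) =
      ∑ r, requestCost H p I c.time r (c.status r) + τ * ∑ r, waitRate H p (c.status r) := by
    rw [Finset.mul_sum, ← Finset.sum_add_distrib]
    refine Finset.sum_congr rfl fun r _ => ?_
    change requestCost H p I (c.time + τ) r (c.status r) = _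
    cases c.status r with
    | future => simp [requestCost, waitRate]
    | waiting z =>
      simp only [requestCost, waitRate]
      ring
    | matched r' t => simp [requestCost, waitRate]
  have hwait := mul_le_mul_of_nonneg_left (sum_waitRate_le hc.valid hmatch hK.1) hτ.le
  have hz : ∀ z ∈ H.counters p K, counterPotential H p S c' z +
      2 * τ * c.totalRate H p I z ≤ counterPotential H p S c z +
      (∑ r, S.charge H p r z (c.time + τ) - ∑ r, S.charge H p r z c.time) := by
    intro z hz
    obtain ⟨⟨l, hl⟩, -⟩ := mem_counters.mp hz
    have hch := Solution.sum_charge_increment (S := S) ht hA hA' hl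
    have hα := slope_pos_of_onPath hl
    set w := (H.capacity p z).untopD 0 with hw
    set o := S.offSurplus H p (fun r => c.status r ≠ .future) z c.time with ho
    set o' := S.offSurplus H p (fun r => c.status r ≠ .future) z (c.time + τ) with ho'
    have hjump : potential w (gap H p S c' z) (c.level z 1) (c.level z (-1)) ≤
        potential w (gap H p S c z) (c.level z 1) (c.level z (-1)) +
          6 * w * |((o' - o : ℤ) : ℝ)| := by
      by_cases hcap : H.capacity p z = ⊤
      · rw [htop l z hl hcap, hc.gap_eq_zero l z hl hcap]
        have := Solution.untopD_capacity_nonneg hl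
        have h2 : 0 ≤ 6 * w * |((o' - o : ℤ) : ℝ)| := by positivity
        linarith
      · have hlev : ∀ s, c.level z s ≤ w := by
          intro s
          have h1 := hc.valid.level_le z s l hl
          obtain ⟨y, hy⟩ := WithTop.ne_top_iff_exists.mp hcap
          rw [← hy] at h1
          rw [hw, ← hy]
          exact WithTop.coe_le_coe.mp h1
        have h1 := potential_jump (hc.valid.level_nonneg z 1) (hc.valid.level_nonneg z (-1))
          (hlev 1) (hlev (-1)) (gap H p S c z) (gap H p S c' z)
        have h2 : |((gap H p S c' z - gap H p S c z : ℤ) : ℝ)| = |((o' - o : ℤ) : ℝ)| := by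
          rw [hgap, ← abs_neg]
          congr 2
          push_cast
          ring
        rwa [h2] at h1
    have hgrow := potential_grow (w := w) (x := H.slope p z * τ) (by positivity)
      (y := c.level z) (g := fun s => c.rate H p I z s * τ) (s := c.surplus H p I z) (o := o')
      (by
        intro e
        by_cases hi : c.Increases H p I z e
        · right
          have h1 : c.rate H p I z e = H.slope p z * |(c.surplus H p I z : ℝ)| := if_pos hi
          refine ⟨?_, hi.2⟩
          rw [h1]
          ring
        · left
          have h1 : c.rate H p I z e = 0 := if_neg hi
          rw [h1, zero_mul])
    have hg' : gap H p S c' z = c.surplus H p I z - o' := rfl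
    rw [counterPotential, counterPotential]
    change potential w _ (c.level z 1 + c.rate H p I z 1 * τ)
      (c.level z (-1) + c.rate H p I z (-1) * τ) + _ ≤ _
    rw [← hg'] at hgrow
    have e1 : c.time + τ - c.time = τ := by ring
    rw [e1] at hch
    simp only [totalRate]
    linarith
  have hsum := Finset.sum_le_sum hz
  rw [Finset.sum_add_distrib, Finset.sum_add_distrib, Finset.sum_sub_distrib,
    ← Finset.mul_sum] at hsum
  have hold := hK.2
  rw [hcost]
  change _ ≤ ∑ z ∈ H.counters p K, ∑ r, S.charge H p r z (c.time + τ)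
  linarith

lemma Invariant.step {c c' : Config T R} (hc : Invariant H p S c) (h : Step H p I c c') :
    Invariant H p S c' := by
  classical
  have hv := hc.valid.step h
  cases h with
  | arrive r h ht => exact hc.arrive h ht hv
  | pair r r' z h h' hpol => exact hc.pair h h' hpol hv
  | move r z h hinc hopp hfull => exact hc.move h hfull hv
  | elapse τ hτ hfuture hmatch hcap => exact hc.elapse hτ hfuture hmatch hv

lemma Reachable.invariant (S : Solution I) {c : Config T R} (h : Reachable H p I c) :
    Invariant H p S c := by
  induction h with
  | refl => exact invariant_initial
  | tail _ hs ih => exact ih.step hs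

end Config

/-! ### The total charge of a solution -/

namespace WeightedHST

variable {T : RootedTree} [Fintype T] {H : WeightedHST 2 T} {p : PiecewiseLinearDelay}

lemma dist_nonneg (l l' : T) : 0 ≤ H.dist l l' := by
  classical
  exact Finset.sum_nonneg fun e he => (H.weight_pos e (Finset.mem_filter.mp he).2.1).le

lemma card_edgesBelow_bot_le (l : T) : (edgesBelow ⊥ l).card ≤ treeHeight T := by
  classical
  have h : (edgesBelow ⊥ l).card = depth T l := by
    unfold edgesBelow depth
    congr 1
    ext u
    simp [bot_lt_iff_ne_bot]
  rw [h]
  exact Finset.le_sup (f := depth T) (Finset.mem_univ l)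

open scoped Classical in
/-- A sum over counters on a path is a sum over edges and a sum over pieces, as every piece is met
only once. -/
lemma sum_counters_le {K : ℕ} {l : T} {P : Counter T → Prop} {g : Counter T → ℝ} {gd : ℕ → ℝ}
    {E : Finset T} {N : Finset ℕ} (hP : ∀ z, P z → H.OnPath p l z)
    (hE : ∀ v, .edge v ∈ H.counters p K → P (.edge v) → v ∈ E)
    (hN : ∀ v k, .delay v k ∈ H.counters p K → P (.delay v k) → k ∈ N)
    (hg : ∀ v k, g (.delay v k) = gd k) (hgE : ∀ v ∈ E, 0 ≤ g (.edge v))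
    (hgN : ∀ k ∈ N, 0 ≤ gd k) :
    ∑ z ∈ H.counters p K, (if P z then g z else 0) ≤ ∑ v ∈ E, g (.edge v) + ∑ k ∈ N, gd k := by
  rw [← Finset.sum_filter]
  rw [← Finset.sum_filter_add_sum_filter_not _ (fun z => ∃ v, z = Counter.edge v)]
  refine add_le_add ?_ ?_
  · have hinj : Set.InjOn Counter.edge (E : Set T) := fun v _ v' _ h => by cases h; rfl
    rw [← Finset.sum_image (f := g) hinj]
    refine Finset.sum_le_sum_of_subset_of_nonneg ?_ ?_
    · intro z hz
      simp only [Finset.mem_filter] at hz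
      obtain ⟨⟨hz, hz'⟩, v, rfl⟩ := hz
      exact Finset.mem_image_of_mem _ (hE v hz hz')
    · intro z hz _
      obtain ⟨v, hv, rfl⟩ := Finset.mem_image.mp hz
      exact hgE v hv
  · set s := ((H.counters p K).filter P).filter fun z => ¬ ∃ v, z = Counter.edge v with hs
    have hform : ∀ z ∈ s, ∃ v k, z = Counter.delay v k ∧ z ∈ H.counters p K ∧ P z := by
      intro z hz
      simp only [hs, Finset.mem_filter] at hz
      cases z with
      | edge v => exact absurd ⟨v, rfl⟩ hz.2
      | delay v k => exact ⟨v, k, rfl, hz.1⟩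
    have hinj : Set.InjOn (H.index p) (s : Set (Counter T)) := by
      intro z hz z' hz' he
      obtain ⟨v, k, rfl, -, h1⟩ := hform z hz
      obtain ⟨v', k', rfl, -, h2⟩ := hform z' hz'
      have he : k = k' := he
      subst he
      have h1 := hP _ h1
      have h2 := hP _ h2
      have hle : ∀ {a b : T}, H.OnPath p l (.delay a k) → H.OnPath p l (.delay b k) →
          a ≤ b → a = b := by
        intro a b ha hb hab
        by_contra hne
        have hlt := lt_of_le_of_ne hab hne
        have h3 := ha.2.2.2 b hlt hb.1
        have h4 := hb.2.2.1.resolve_left (ne_bot_of_gt hlt)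
        exact absurd h3 (not_le_of_gt h4)
      rcases le_total_of_directed h1.1 h2.1 with h | h
      · rw [hle h2 h1 h]
      · rw [hle h1 h2 h]
    have h1 : ∑ z ∈ s, g z = ∑ z ∈ s, gd (H.index p z) := by
      refine Finset.sum_congr rfl fun z hz => ?_
      obtain ⟨v, k, rfl, -⟩ := hform z hz
      exact hg v k
    rw [h1, ← Finset.sum_image (f := gd) hinj]
    refine Finset.sum_le_sum_of_subset_of_nonneg ?_ fun k hk _ => hgN k hk
    intro k hk
    obtain ⟨z, hz, rfl⟩ := Finset.mem_image.mp hk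
    obtain ⟨v, k, rfl, h1, h2⟩ := hform z hz
    exact hN v k h1 h2

/-- The weights on a path decrease geometrically. -/
lemma sum_weight_le_two_mul {v l : T} (hv : v ≠ ⊥) (hvl : v ≤ l) :
    H.weight v + ∑ u ∈ edgesBelow v l, H.weight u ≤ 2 * H.weight v := by
  classical
  obtain ⟨n, hn⟩ := hvl.exists_pred_iterate
  induction n generalizing v with
  | zero =>
    simp only [Function.iterate_zero, id_eq] at hn
    subst hn
    rw [edgesBelow_self, Finset.sum_empty]
    linarith [H.weight_pos l hv]
  | succ n ih =>
    rw [Function.iterate_succ_apply'] at hn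
    set u := Order.pred^[n] l with hu
    have hu0 : u ≠ ⊥ := by
      intro h0
      rw [h0, Order.pred_bot] at hn
      exact hv hn.symm
    have hul : u ≤ l := Order.pred_iterate_le _ _
    have h1 := ih hu0 hul rfl
    have h2 := H.two_mul_weight_le hu0 (hn ▸ hv)
    rw [hn] at h2
    rw [← hn, edgesBelow_pred hu0 hul, Finset.sum_insert (notMem_edgesBelow_self _ _), hn]
    linarith

lemma sum_light_edges_le {l : T} {s : ℝ} (hs : 0 ≤ s) {E : Finset T}
    (hE : ∀ v ∈ E, v ≠ ⊥ ∧ v ≤ l ∧ H.weight v ≤ s) : ∑ v ∈ E, H.weight v ≤ 2 * s := by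
  classical
  rcases E.eq_empty_or_nonempty with rfl | hne
  · simpa using hs
  · obtain ⟨v, hv, hmin⟩ := E.exists_minimal hne
    obtain ⟨hv0, hvl, hvs⟩ := hE v hv
    have hsub : E ⊆ insert v (edgesBelow v l) := by
      intro u hu
      obtain ⟨-, hul, -⟩ := hE u hu
      have hvu : v ≤ u := by
        rcases le_total_of_directed hvl hul with h | h
        · exact hmin hu h
        · exact h
      rcases hvu.eq_or_lt with rfl | h
      · exact Finset.mem_insert_self _ _
      · exact Finset.mem_insert_of_mem (mem_edgesBelow.mpr ⟨h, hul⟩)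
    have hnn : ∀ u ∈ insert v (edgesBelow v l), u ∉ E → 0 ≤ H.weight u := by
      intro u hu _
      rcases Finset.mem_insert.mp hu with rfl | hu
      · exact (H.weight_pos _ hv0).le
      · exact (H.weight_pos _ (ne_bot_of_gt (mem_edgesBelow.mp hu).1)).le
    refine (Finset.sum_le_sum_of_subset_of_nonneg hsub hnn).trans ?_
    rw [Finset.sum_insert (notMem_edgesBelow_self _ _)]
    linarith [sum_weight_le_two_mul (H := H) hv0 hvl]

lemma untopD_height {k : ℕ} (hk : ((k + 1 : ℕ) : ℕ∞) < p.pieces) :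
    (p.height k).untopD 0 = p.f (p.x (k + 1)) - p.f (p.x k) := by
  rw [p.height_of_lt hk]
  rfl

lemma sum_height_eq {n : ℕ} (hn : ((n + 1 : ℕ) : ℕ∞) < p.pieces) :
    ∑ k ∈ Finset.range (n + 1), (p.height k).untopD 0 = p.f (p.x (n + 1)) := by
  rw [Finset.sum_congr rfl fun k hk => untopD_height (p.lt_pieces_of_le
    (Nat.succ_le_succ (Finset.mem_range_succ_iff.mp hk)) hn),
    Finset.sum_range_sub fun k => p.f (p.x k), p.x_zero, p.f_zero, sub_zero]

lemma untopD_height_nonneg {k n : ℕ} (hn : ((n + 1 : ℕ) : ℕ∞) < p.pieces)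
    (hk : k ∈ Finset.range (n + 1)) : 0 ≤ (p.height k).untopD 0 := by
  have hk' : ((k + 1 : ℕ) : ℕ∞) < p.pieces :=
    p.lt_pieces_of_le (Nat.succ_le_succ (Finset.mem_range_succ_iff.mp hk)) hn
  rw [untopD_height hk']
  exact (sub_pos.mpr (p.f_x_lt hk')).le

open scoped Classical in
/-- The capacities of all counters that a request passes by waiting are bounded by three times its
delay. -/
lemma sum_capacity_passed_le {K : ℕ} {l : T} {t : ℝ} (ht : 0 ≤ t) :
    ∑ z ∈ H.counters p K, (if H.OnPath p l z ∧ ((H.index p z + 1 : ℕ) : ℕ∞) < p.pieces ∧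
      p.x (H.index p z + 1) < t then (H.capacity p z).untopD 0 else 0) ≤ 3 * p.f t := by
  set P : Counter T → Prop := fun z => H.OnPath p l z ∧
    ((H.index p z + 1 : ℕ) : ℕ∞) < p.pieces ∧ p.x (H.index p z + 1) < t with hP
  by_cases hne : ((H.counters p K).filter P).Nonempty
  · obtain ⟨y, hy, hmax⟩ := Finset.exists_max_image _ (H.index p) hne
    obtain ⟨-, -, hy1, hy2⟩ := Finset.mem_filter.mp hy
    set n := H.index p y with hn
    have hle : ∀ z, z ∈ H.counters p K → P z → H.index p z ≤ n :=
      fun z hz hPz => hmax z (Finset.mem_filter.mpr ⟨hz, hPz⟩)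
    have hmono := p.f_mono (p.x_nonneg hy1) hy2.le
    have hnn := p.f_x_nonneg hy1
    set E : Finset T := Finset.univ.filter fun v => v ≠ ⊥ ∧ v ≤ l ∧
      p.firstPiece (H.weight v) ≤ n with hE
    have hedge : ∀ v, .edge v ∈ H.counters p K → P (.edge v) → v ∈ E := fun v hv hv' =>
      Finset.mem_filter.mpr ⟨Finset.mem_univ _, hv'.1.1, hv'.1.2, hle _ hv hv'⟩
    have hEw : ∑ v ∈ E, H.weight v ≤ 2 * p.f (p.x (n + 1)) := by
      refine sum_light_edges_le (l := l) hnn fun v hv => ?_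
      obtain ⟨-, h1, h2, h3⟩ := Finset.mem_filter.mp hv
      rw [p.firstPiece_le_iff, p.cumHeight_of_lt hy1] at h3
      exact ⟨h1, h2, by exact_mod_cast h3⟩
    have key := sum_counters_le (H := H) (p := p) (K := K) (l := l)
      (P := P) (g := fun z => (H.capacity p z).untopD 0)
      (gd := fun k => (p.height k).untopD 0) (E := E) (N := Finset.range (n + 1))
      (fun z hz => hz.1) hedge
      (fun v k hv hv' => Finset.mem_range_succ_iff.mpr (hle _ hv hv')) (fun _ _ => rfl)
      (fun v hv => (H.weight_pos v (Finset.mem_filter.mp hv).2.1).le)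
      (fun k hk => untopD_height_nonneg hy1 hk)
    rw [sum_height_eq hy1] at key
    have hE2 : ∑ v ∈ E, (H.capacity p (.edge v)).untopD 0 = ∑ v ∈ E, H.weight v := rfl
    refine (le_of_eq (Finset.sum_congr rfl fun z _ => by congr)).trans (key.trans ?_)
    simp only [hE2]
    linarith
  · rw [Finset.not_nonempty_iff_eq_empty] at hne
    rw [← Finset.sum_filter, hne, Finset.sum_empty]
    linarith [p.f_nonneg ht]

open scoped Classical in
/-- The capacities of the counters on one of two paths but not on the other are bounded by the
distance. -/
lemma sum_capacity_diff_le {K : ℕ} {l l' : T} :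
    ∑ z ∈ H.counters p K, (if H.OnPath p l z ∧ ¬ H.OnPath p l' z then
      (H.capacity p z).untopD 0 else 0) ≤ 2 * H.dist l l' := by
  set E : Finset T := Finset.univ.filter fun e : T => e ≠ ⊥ ∧ Xor (e ≤ l) (e ≤ l') with hE
  have hmemE : ∀ e, e ∈ E ↔ e ≠ ⊥ ∧ Xor (e ≤ l) (e ≤ l') := by simp [hE]
  have hEpos : ∀ e ∈ E, 0 ≤ H.weight e := fun e he => (H.weight_pos e ((hmemE e).mp he).1).le
  have hdist : H.dist l l' = ∑ e ∈ E, H.weight e := rfl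
  have hsingle : ∀ e ∈ E, H.weight e ≤ H.dist l l' :=
    fun e he => hdist ▸ Finset.single_le_sum hEpos he
  -- such a delay counter has cumulative height less than the weight of some edge of the path
  have hdelay : ∀ v k, H.OnPath p l (.delay v k) → ¬ H.OnPath p l' (.delay v k) →
      ((k + 1 : ℕ) : ℕ∞) < p.pieces ∧ p.f (p.x (k + 1)) ≤ H.dist l l' := by
    intro v k h1 h2
    have h3 : ∃ e ∈ E, p.cumHeight k < (H.weight e : WithTop ℝ) := by
      by_cases hv : v ≤ l'
      · have h4 : ¬ ∀ u, v < u → u ≤ l' → (H.weight u : WithTop ℝ) ≤ p.cumHeight k :=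
          fun h => h2 ⟨hv, h1.2.1, h1.2.2.1, h⟩
        push Not at h4
        obtain ⟨u, hu1, hu2, hu3⟩ := h4
        refine ⟨u, (hmemE u).mpr ⟨ne_bot_of_gt hu1, Or.inr ⟨hu2, fun h5 => ?_⟩⟩, hu3⟩
        exact absurd (h1.2.2.2 u hu1 h5) (not_le_of_gt hu3)
      · have hv0 : v ≠ ⊥ := by
          rintro rfl
          exact hv bot_le
        exact ⟨v, (hmemE v).mpr ⟨hv0, Or.inl ⟨h1.1, hv⟩⟩, h1.2.2.1.resolve_left hv0⟩
    obtain ⟨e, he, h4⟩ := h3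
    have hk := p.succ_lt_pieces_of_cumHeight_lt h4
    rw [p.cumHeight_of_lt hk] at h4
    exact ⟨hk, (show p.f (p.x (k + 1)) ≤ H.weight e by exact_mod_cast h4.le).trans (hsingle e he)⟩
  set P : Counter T → Prop := fun z => H.OnPath p l z ∧ ¬ H.OnPath p l' z with hP
  have hedge : ∀ v, P (.edge v) → v ∈ E := fun v hv =>
    (hmemE v).mpr ⟨hv.1.1, Or.inl ⟨hv.1.2, fun h => hv.2 ⟨hv.1.1, h⟩⟩⟩
  have hE2 : ∑ v ∈ E, (H.capacity p (.edge v)).untopD 0 = H.dist l l' := rfl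
  by_cases hne : ((H.counters p K).filter fun z => P z ∧ ∃ v k, z = .delay v k).Nonempty
  · obtain ⟨y, hy, hmax⟩ := Finset.exists_max_image _ (H.index p) hne
    obtain ⟨-, hy1, v₀, n, rfl⟩ := Finset.mem_filter.mp hy
    obtain ⟨hn, hnd⟩ := hdelay v₀ n hy1.1 hy1.2
    have key := sum_counters_le (H := H) (p := p) (K := K) (l := l)
      (P := P) (g := fun z => (H.capacity p z).untopD 0)
      (gd := fun k => (p.height k).untopD 0) (E := E) (N := Finset.range (n + 1))
      (fun z hz => hz.1) (fun v _ hv => hedge v hv)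
      (fun v k hv hv' => Finset.mem_range_succ_iff.mpr
        (hmax (.delay v k) (Finset.mem_filter.mpr ⟨hv, hv', v, k, rfl⟩)))
      (fun _ _ => rfl) hEpos (fun k hk => untopD_height_nonneg hn hk)
    rw [sum_height_eq hn] at key
    refine (le_of_eq (Finset.sum_congr rfl fun z _ => by congr)).trans (key.trans ?_)
    simp only [hE2]
    linarith
  · have key := sum_counters_le (H := H) (p := p) (K := K) (l := l)
      (P := P) (g := fun z => (H.capacity p z).untopD 0)
      (gd := fun k => (p.height k).untopD 0) (E := E) (N := ∅)
      (fun z hz => hz.1) (fun v _ hv => hedge v hv)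
      (fun v k hv hv' => absurd ⟨_, Finset.mem_filter.mpr ⟨hv, hv', v, k, rfl⟩⟩ hne)
      (fun _ _ => rfl) hEpos (by simp)
    refine (le_of_eq (Finset.sum_congr rfl fun z _ => by congr)).trans (key.trans ?_)
    simp only [hE2, Finset.sum_empty]
    linarith [H.dist_nonneg l l']

open scoped Classical in
/-- A request that waits in the solution contributes to the surplus of all counters above it; the
delay counters cost a constant factor and the edges a factor of the height. -/
lemma sum_slope_clip_le {K : ℕ} {l : T} {t : ℝ} (ht : 0 ≤ t) :
    ∑ z ∈ H.counters p K, (if H.OnPath p l z then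
      H.slope p z * p.clip (H.index p z) t else 0) ≤ (treeHeight T + 2) * p.f t := by
  have hne : ((Finset.range (K + 1)).filter fun k : ℕ => (k : ℕ∞) < p.pieces).Nonempty :=
    ⟨0, Finset.mem_filter.mpr ⟨by simp, p.zero_lt_pieces⟩⟩
  obtain ⟨n, hn, hmax⟩ := Finset.exists_max_image _ id hne
  have hn := (Finset.mem_filter.mp hn).2
  have hnn : ∀ k : ℕ, (k : ℕ∞) < p.pieces → 0 ≤ p.slope k * p.clip k t := fun k hk =>
    mul_nonneg (p.slope_pos k hk).le (p.clip_nonneg k ht)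
  have key := sum_counters_le (H := H) (p := p) (K := K) (l := l)
    (P := H.OnPath p l)
    (g := fun z => H.slope p z * p.clip (H.index p z) t)
    (gd := fun k => p.slope k * p.clip k t) (E := edgesBelow ⊥ l) (N := Finset.range (n + 1))
    (fun z hz => hz)
    (fun v _ hv => mem_edgesBelow.mpr ⟨bot_lt_iff_ne_bot.mpr hv.1, hv.2⟩)
    (fun v k hv hv' => Finset.mem_range_succ_iff.mpr (hmax k (Finset.mem_filter.mpr
      ⟨Finset.mem_range_succ_iff.mpr (mem_counters.mp hv).2, hv'.index_lt⟩)))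
    (fun _ _ => rfl) (fun v _ => hnn _ (p.firstPiece_lt_pieces _))
    (fun k hk => hnn k (p.lt_pieces_of_le (Finset.mem_range_succ_iff.mp hk) hn))
  have h1 := p.sum_slope_mul_clip_le hn ht
  have h2 : ∑ v ∈ edgesBelow ⊥ l, H.slope p (.edge v) * p.clip (H.index p (.edge v)) t ≤
      treeHeight T * p.f t := by
    refine (Finset.sum_le_card_nsmul _ _ (p.f t) fun v _ =>
      p.slope_mul_clip_le (p.firstPiece_lt_pieces _) ht).trans ?_
    rw [nsmul_eq_mul]
    exact mul_le_mul_of_nonneg_right (by exact_mod_cast card_edgesBelow_bot_le l) (p.f_nonneg ht)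
  refine (le_of_eq (Finset.sum_congr rfl fun z _ => by congr)).trans (key.trans ?_)
  linarith

end WeightedHST

namespace Solution

open WeightedHST

variable {T : RootedTree} {R : Type*} [Fintype R] {I : RequestSequence T R}
  {H : WeightedHST 2 T} {p : PiecewiseLinearDelay} {S : Solution I}

lemma delay_nonneg (r : R) : 0 ≤ S.time r - I.arrival r := sub_nonneg.mpr (S.arrival_le r)

lemma lt_of_deadline_ne {r : R} {z : Counter T} (h : S.deadline H p r z ≠ S.time r) :
    ((H.index p z + 1 : ℕ) : ℕ∞) < p.pieces ∧
      p.x (H.index p z + 1) < S.time r - I.arrival r := by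
  unfold deadline PiecewiseLinearDelay.clip at h
  split_ifs at h with hk
  · refine ⟨hk, ?_⟩
    by_contra! hx
    rw [min_eq_left hx] at h
    exact h (by ring)
  · exact absurd (by ring) h

variable [Fintype T]

lemma sum_charge_le (K : ℕ) (r : R) (t : ℝ) :
    ∑ z ∈ H.counters p K, S.charge H p r z t ≤
      9 * ((treeHeight T + 2) * p.f (S.time r - I.arrival r)) +
      6 * (2 * H.dist (I.loc r) (I.loc (S.partner r)) + 3 * p.f (S.time r - I.arrival r) +
        3 * p.f (S.time (S.partner r) - I.arrival (S.partner r))) := by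
  classical
  have h1 := sum_slope_clip_le (H := H) (p := p) (K := K) (l := I.loc r) (S.delay_nonneg r)
  have h2 := sum_capacity_diff_le (H := H) (p := p) (K := K) (l := I.loc r)
    (l' := I.loc (S.partner r))
  have h3 := sum_capacity_passed_le (H := H) (p := p) (K := K) (l := I.loc r) (S.delay_nonneg r)
  have h4 := sum_capacity_passed_le (H := H) (p := p) (K := K) (l := I.loc (S.partner r))
    (S.delay_nonneg (S.partner r))
  refine le_trans ?_ (add_le_add (mul_le_mul_of_nonneg_left h1 (by norm_num : (0 : ℝ) ≤ 9))
    (mul_le_mul_of_nonneg_left (add_le_add (add_le_add h2 h3) h4) (by norm_num : (0 : ℝ) ≤ 6)))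
  rw [← Finset.sum_add_distrib, ← Finset.sum_add_distrib, Finset.mul_sum, Finset.mul_sum,
    ← Finset.sum_add_distrib]
  refine Finset.sum_le_sum fun z hz => ?_
  obtain ⟨⟨l, hl⟩, -⟩ := mem_counters.mp hz
  have hw := untopD_capacity_nonneg hl
  have hα := (slope_pos_of_onPath hl).le
  have hnn : ∀ (q : Prop) [Decidable q], 0 ≤ (if q then (H.capacity p z).untopD 0 else 0) := by
    intro q _
    split_ifs
    · exact hw
    · exact le_rfl
  unfold charge
  by_cases hp : H.OnPath p (I.loc r) z
  · rw [if_pos hp, if_pos hp]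
    refine add_le_add ?_ ?_
    · rw [mul_assoc]
      refine mul_le_mul_of_nonneg_left (mul_le_mul_of_nonneg_left ?_ hα) (by norm_num)
      refine max_le (p.clip_nonneg _ (S.delay_nonneg r)) ?_
      have := min_le_right t (S.deadline H p r z)
      unfold deadline at this ⊢
      linarith
    · rw [mul_assoc]
      refine mul_le_mul_of_nonneg_left ?_ (by norm_num)
      have h5 := hnn (H.OnPath p (I.loc r) z ∧ ¬ H.OnPath p (I.loc (S.partner r)) z)
      have h6 := hnn (H.OnPath p (I.loc r) z ∧ ((H.index p z + 1 : ℕ) : ℕ∞) < p.pieces ∧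
        p.x (H.index p z + 1) < S.time r - I.arrival r)
      have h7 := hnn (H.OnPath p (I.loc (S.partner r)) z ∧
        ((H.index p z + 1 : ℕ) : ℕ∞) < p.pieces ∧
        p.x (H.index p z + 1) < S.time (S.partner r) - I.arrival (S.partner r))
      by_cases hc : S.Crosses H p r z ∧ S.deadline H p r z < t
      · rw [if_pos hc, mul_one]
        by_cases hp' : H.OnPath p (I.loc (S.partner r)) z
        · by_cases hd : S.deadline H p r z = S.time r
          · have hd' : S.deadline H p (S.partner r) z ≠ S.time (S.partner r) := by
              rw [S.time_partner]
              exact fun h => hc.1 ⟨hp', hd, h⟩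
            rw [if_pos (c := _ ∧ _ ∧ p.x _ < S.time (S.partner r) - _)
              ⟨hp', lt_of_deadline_ne hd'⟩]
            linarith
          · rw [if_pos (c := _ ∧ _ ∧ p.x _ < S.time r - _) ⟨hp, lt_of_deadline_ne hd⟩]
            linarith
        · rw [if_pos (c := _ ∧ ¬ _) ⟨hp, hp'⟩]
          linarith
      · rw [if_neg hc, mul_zero]
        linarith
  · rw [if_neg hp, if_neg hp]
    have h5 := hnn (H.OnPath p (I.loc r) z ∧ ¬ H.OnPath p (I.loc (S.partner r)) z)
    have h6 := hnn (H.OnPath p (I.loc r) z ∧ ((H.index p z + 1 : ℕ) : ℕ∞) < p.pieces ∧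
      p.x (H.index p z + 1) < S.time r - I.arrival r)
    have h7 := hnn (H.OnPath p (I.loc (S.partner r)) z ∧
      ((H.index p z + 1 : ℕ) : ℕ∞) < p.pieces ∧
      p.x (H.index p z + 1) < S.time (S.partner r) - I.arrival (S.partner r))
    linarith

end Solution

/-! ### The cost of a run -/

namespace Config

open WeightedHST

variable {T : RootedTree} {R : Type*} [Fintype R] [Fintype T] {H : WeightedHST 2 T}
  {p : PiecewiseLinearDelay} {I : RequestSequence T R} {S : Solution I}

lemma Invariant.counterPotential_nonneg {c : Config T R} (hc : Invariant H p S c) {l : T}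
    {z : Counter T} (hz : H.OnPath p l z) : 0 ≤ counterPotential H p S c z := by
  refine potential_nonneg (hc.valid.level_nonneg z 1) (hc.valid.level_nonneg z (-1)) ?_
  by_cases hcap : H.capacity p z = ⊤
  · exact Or.inl (hc.gap_eq_zero l z hz hcap)
  · obtain ⟨w, hw⟩ := WithTop.ne_top_iff_exists.mp hcap
    have h := fun s => hc.valid.level_le z s l hz
    rw [← hw] at h ⊢
    exact Or.inr ⟨WithTop.coe_le_coe.mp (h 1), WithTop.coe_le_coe.mp (h (-1))⟩

/-- What the algorithm has paid at any time is bounded in terms of the cost of any solution. -/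
lemma Invariant.sum_requestCost_le {c : Config T R} (hc : Invariant H p S c) :
    ∑ r, requestCost H p I c.time r (c.status r) ≤
      24 * S.connectionCost H + (9 * treeHeight T + 54) * S.delayCost p.f := by
  obtain ⟨K, -, hK⟩ := hc.bound.exists
  have h1 : 0 ≤ ∑ z ∈ H.counters p K, counterPotential H p S c z :=
    Finset.sum_nonneg fun z hz => by
      obtain ⟨⟨l, hl⟩, -⟩ := mem_counters.mp hz
      exact hc.counterPotential_nonneg hl
  have h2 : ∑ r, p.f (S.time (S.partner r) - I.arrival (S.partner r)) = S.delayCost p.f :=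
    Equiv.sum_comp (Function.Involutive.toPerm S.partner S.partner_partner)
      (fun r => p.f (S.time r - I.arrival r))
  rw [Finset.sum_comm] at hK
  have h3 := Finset.sum_le_sum fun r (_ : r ∈ Finset.univ) =>
    Solution.sum_charge_le (H := H) (p := p) (S := S) K r c.time
  simp only [Finset.sum_add_distrib, ← Finset.mul_sum] at h3
  rw [h2] at h3
  have h4 : ∑ r, p.f (S.time r - I.arrival r) = S.delayCost p.f := rfl
  have h5 : ∑ r, H.dist (I.loc r) (I.loc (S.partner r)) = 2 * S.connectionCost H := by
    unfold Solution.connectionCost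
    ring
  rw [h4, h5] at h3
  linarith

lemma Yields.cost_le {c : Config T R} {A : Solution I} (hA : c.Yields A)
    (hc : Invariant H p S c) {D : ℝ → ℝ} (hD : p.Approximates D) (hh : 1 ≤ treeHeight T) :
    A.cost H D ≤ 126 * S.connectionCost H + 126 * (treeHeight T : ℝ) * S.delayCost D := by
  have h1 := hc.sum_requestCost_le
  have h2 : ∑ r, requestCost H p I c.time r (c.status r) =
      A.delayCost p.f + A.connectionCost H := by
    rw [Finset.sum_congr rfl fun r _ => by rw [hA r]]
    simp only [requestCost]
    rw [Finset.sum_add_distrib, ← Finset.sum_div]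
    rfl
  have h3 : A.delayCost D ≤ 2 * A.delayCost p.f := by
    unfold Solution.delayCost
    rw [Finset.mul_sum]
    exact Finset.sum_le_sum fun r _ => (hD _ (Solution.delay_nonneg r)).2
  have h4 : S.delayCost p.f ≤ S.delayCost D :=
    Finset.sum_le_sum fun r _ => (hD _ (Solution.delay_nonneg r)).1
  have h5 : ∀ S' : Solution I, 0 ≤ S'.connectionCost H := fun S' =>
    div_nonneg (Finset.sum_nonneg fun r _ => H.dist_nonneg _ _) (by norm_num)
  have h6 : 0 ≤ S.delayCost p.f :=
    Finset.sum_nonneg fun r _ => p.f_nonneg (Solution.delay_nonneg r)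
  have h7 : (1 : ℝ) ≤ treeHeight T := by exact_mod_cast hh
  have h8 := h5 A
  have h9 := h5 S
  have h10 : (9 * treeHeight T + 54 : ℝ) * S.delayCost p.f ≤
      63 * treeHeight T * S.delayCost D := by
    calc (9 * treeHeight T + 54 : ℝ) * S.delayCost p.f
        ≤ 63 * treeHeight T * S.delayCost p.f :=
          mul_le_mul_of_nonneg_right (by linarith) h6
      _ ≤ _ := mul_le_mul_of_nonneg_left h4 (by positivity)
  unfold Solution.cost
  linarith

end Config

/-! ### Completing a run -/

/-- Some solution matches all requests at one common time. -/
lemma exists_solution {T : RootedTree} {R : Type*} [Fintype R] (I : RequestSequence T R) :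
    ∃ (S : Solution I) (t : ℝ), ∀ r, S.time r = t := by
  classical
  have hcard : Fintype.card {r // I.pol r = 1} = Fintype.card {r // ¬ I.pol r = 1} := by
    have h := I.balanced
    rw [← Finset.sum_filter_add_sum_filter_not _ (fun r => I.pol r = 1)] at h
    have h1 : ∑ r ∈ Finset.univ.filter (fun r => I.pol r = 1), (I.pol r : ℤ) =
        (Fintype.card {r // I.pol r = 1} : ℤ) := by
      rw [Finset.sum_congr rfl (g := fun _ => (1 : ℤ)) fun r hr => by
        rw [(Finset.mem_filter.mp hr).2]; rfl]
      simp [Fintype.card_subtype]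
    have h2 : ∑ r ∈ Finset.univ.filter (fun r => ¬ I.pol r = 1), (I.pol r : ℤ) =
        -(Fintype.card {r // ¬ I.pol r = 1} : ℤ) := by
      rw [Finset.sum_congr rfl (g := fun _ => (-1 : ℤ)) fun r hr => by
        rw [(Int.units_eq_one_or (I.pol r)).resolve_left (Finset.mem_filter.mp hr).2]; rfl]
      rw [Finset.sum_const, Fintype.card_subtype]
      simp
    rw [h1, h2] at h
    omega
  let e := Fintype.equivOfCardEq hcard
  let partner : R → R := fun r => if h : I.pol r = 1 then e ⟨r, h⟩ else e.symm ⟨r, h⟩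
  have hpos : ∀ r (h : I.pol r = 1), partner r = e ⟨r, h⟩ := fun r h => dif_pos h
  have hneg : ∀ r (h : ¬ I.pol r = 1), partner r = e.symm ⟨r, h⟩ := fun r h => dif_neg h
  refine ⟨⟨partner, fun _ => ∑ r, I.arrival r, fun r => ?_, fun r => ?_, fun _ => rfl,
    fun r => Finset.single_le_sum (fun r _ => I.arrival_nonneg r) (Finset.mem_univ r)⟩,
    _, fun _ => rfl⟩
  · by_cases h : I.pol r = 1
    · rw [hpos r h, hneg _ (e ⟨r, h⟩).2]
      simp
    · rw [hneg r h, hpos _ (e.symm ⟨r, h⟩).2]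
      simp
  · by_cases h : I.pol r = 1
    · rw [hpos r h, h]
      exact (Int.units_eq_one_or _).resolve_left (e ⟨r, h⟩).2
    · rw [hneg r h, (e.symm ⟨r, h⟩).2, (Int.units_eq_one_or (I.pol r)).resolve_left h]
      simp

namespace Config

open WeightedHST

variable {T : RootedTree} {R : Type*} [Fintype R] [Fintype T] {H : WeightedHST 2 T}
  {p : PiecewiseLinearDelay} {I : RequestSequence T R}

/-- When all requests have arrived, their polarities cancel at a counter of infinite capacity. -/
lemma surplus_eq_zero_of_capacity_eq_top {c : Config T R} (hc : Reachable H p I c)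
    (hall : ∀ r, c.status r ≠ .future) {l : T} {z : Counter T} (hz : H.OnPath p l z)
    (hcap : H.capacity p z = ⊤) : c.surplus H p I z = 0 := by
  classical
  obtain ⟨S, t, ht⟩ := exists_solution I
  have h1 := (hc.invariant S).gap_eq_zero l z hz hcap
  have hdl : ∀ r, S.deadline H p r z = t := by
    intro r
    have := Solution.not_crosses_of_capacity_eq_top (S := S) hz hcap r
    rw [Solution.Crosses, not_not] at this
    rw [this.2.1, ht]
  have h2 : S.offSurplus H p (fun r => c.status r ≠ .future) z c.time = 0 := by
    unfold Solution.offSurplus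
    by_cases hle : c.time ≤ t
    · rw [← I.balanced]
      refine Finset.sum_congr rfl fun r _ => if_pos ⟨hall r, hz.of_capacity_eq_top hcap, ?_⟩
      rw [hdl]
      exact hle
    · refine Finset.sum_eq_zero fun r _ => if_neg fun h => hle ?_
      rw [← hdl r]
      exact h.2.2
  rw [gap, h2, sub_zero] at h1
  exact h1

/-- If no two requests can be matched, then a lowest counter among those with a request
increases. -/
lemma exists_increases {c : Config T R} (hc : c.IsValid H p I) (hm : c.NoMatchable I)
    (hw : ∃ r z, c.status r = .waiting z) :
    ∃ r z, c.status r = .waiting z ∧ c.Increases H p I z (I.pol r) := by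
  classical
  obtain ⟨r₀, z₀, h₀⟩ := hw
  let below : Counter T → Finset R := fun z => Finset.univ.filter fun r =>
    ∃ z', c.status r = .waiting z' ∧ H.IsDescendant p z' z
  obtain ⟨z, ⟨r, hr⟩, hmin⟩ := WellFounded.has_min (measure fun z => (below z).card).wf
    {z | ∃ r, c.status r = .waiting z} ⟨z₀, r₀, h₀⟩
  have hz := hc.onPath r z hr
  have hlow : ∀ r' z', c.status r' = .waiting z' → H.IsDescendant p z' z → z' = z := by
    intro r' z' hr' hd
    have hz' := hc.onPath r' z' hr'
    have hsub : below z' ⊆ below z := by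
      intro r₁ h₁
      obtain ⟨-, z₁, h2, n, hn⟩ := Finset.mem_filter.mp h₁
      obtain ⟨m, hm'⟩ := hd
      refine Finset.mem_filter.mpr ⟨Finset.mem_univ _, z₁, h2, m + n, ?_⟩
      rw [Function.iterate_add_apply, hn, hm']
    have hcard : (below z).card ≤ (below z').card := not_lt.mp (hmin z' ⟨r', hr'⟩)
    have hrm : r ∈ below z' := by
      rw [Finset.eq_of_subset_of_card_le hsub hcard]
      exact Finset.mem_filter.mpr ⟨Finset.mem_univ _, z, hr, 0, rfl⟩
    obtain ⟨-, z₁, h2, h3⟩ := Finset.mem_filter.mp hrm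
    rw [hr] at h2
    cases h2
    obtain ⟨h4, h5⟩ := (hz.isDescendant_iff hz'.not_isJunk).mp h3
    obtain ⟨-, h6⟩ := (h4.isDescendant_iff hz.not_isJunk).mp hd
    exact h4.eq_of_position_eq hz (le_antisymm h6 h5)
  refine ⟨r, z, hr, ⟨r, hr, rfl⟩, ?_⟩
  have hsur : c.surplus H p I z = c.polAt I z := by
    rw [surplus_eq_sum_load, polAt]
    refine Finset.sum_congr rfl fun r' _ => ?_
    rcases hst : c.status r' with _ | z' | ⟨r₁, t⟩
    · simp [load_future]
    · by_cases hd : H.IsDescendant p z' z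
      · rw [load_waiting_of_isDescendant hd, if_pos (by rw [hlow r' z' hst hd])]
      · rw [load_waiting_of_not hd, if_neg]
        intro he
        cases he
        exact hd ⟨0, rfl⟩
    · simp [load_matched]
  have hcount : 0 < c.countAt z := by
    refine Finset.sum_pos' (fun r' _ => ?_) ⟨r, Finset.mem_univ r, ?_⟩
    · split_ifs <;> norm_num
    · rw [if_pos hr]
      norm_num
  rw [← polAt_of_not_occupied (hm.not_occupied_neg ⟨r, hr, rfl⟩), ← hsur] at hcount
  exact_mod_cast hcount

/-- An arrival or a move of `r` is due. -/
def Due (H : WeightedHST 2 T) (p : PiecewiseLinearDelay) (I : RequestSequence T R)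
    (c : Config T R) (r : R) : Prop :=
  (c.status r = .future ∧ c.time = I.arrival r) ∨
    ∃ z, c.status r = .waiting z ∧ c.Increases H p I z (I.pol r) ∧
      ((c.level z (I.pol r) : ℝ) : WithTop ℝ) = H.capacity p z

/-- The time that passes until an arrival or a move of `r` is due. -/
noncomputable def waitingTime (H : WeightedHST 2 T) (p : PiecewiseLinearDelay)
    (I : RequestSequence T R) (c : Config T R) (r : R) : ℝ :=
  match c.status r with
  | .future => I.arrival r - c.time
  | .waiting z => ((H.capacity p z).untopD 0 - c.level z (I.pol r)) / c.rate H p I z (I.pol r)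
  | .matched _ _ => 0

/-- Unless all requests are matched, time can pass until an arrival or a move is due. -/
lemma exists_due {c : Config T R} (hc : Reachable H p I c) (hm : c.NoMatchable I)
    (hnot : ∃ r, ∀ r' t, c.status r ≠ .matched r' t) :
    ∃ c', Steps H p I c c' ∧ c'.status = c.status ∧ ∃ r, Due H p I c' r := by
  classical
  have hv := hc.isValid
  let F : Finset R := Finset.univ.filter fun r => c.status r = .future ∨
    ∃ z, c.status r = .waiting z ∧ c.Increases H p I z (I.pol r) ∧ H.capacity p z ≠ ⊤
  have hne : F.Nonempty := by
    by_cases hall : ∀ r, c.status r ≠ .future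
    · obtain ⟨r₀, h₀⟩ := hnot
      have hw : ∃ r z, c.status r = .waiting z := by
        rcases hst : c.status r₀ with _ | z | ⟨r', t⟩
        · exact absurd hst (hall r₀)
        · exact ⟨r₀, z, hst⟩
        · exact absurd hst (h₀ r' t)
      obtain ⟨r, z, hr, hinc⟩ := exists_increases hv hm hw
      refine ⟨r, Finset.mem_filter.mpr ⟨Finset.mem_univ _, Or.inr ⟨z, hr, hinc, fun hcap => ?_⟩⟩⟩
      have h0 := surplus_eq_zero_of_capacity_eq_top hc hall (hv.onPath r z hr) hcap
      have h1 := hinc.2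
      rw [h0, mul_zero] at h1
      exact lt_irrefl _ h1
    · push Not at hall
      obtain ⟨r, hr⟩ := hall
      exact ⟨r, Finset.mem_filter.mpr ⟨Finset.mem_univ _, Or.inl hr⟩⟩
  obtain ⟨r, hrF, hmin⟩ := Finset.exists_min_image F (waitingTime H p I c) hne
  set τ := waitingTime H p I c r with hτ
  have hfull : ∀ r' z, c.status r' = .waiting z → c.Increases H p I z (I.pol r') →
      H.capacity p z ≠ ⊤ → H.capacity p z = ((c.level z (I.pol r') +
        c.rate H p I z (I.pol r') * waitingTime H p I c r' : ℝ) : WithTop ℝ) := by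
    intro r' z h1 h2 h3
    obtain ⟨w, hw⟩ := WithTop.ne_top_iff_exists.mp h3
    have h4 := (rate_pos hv h2).ne'
    have h5 : waitingTime H p I c r' =
        ((H.capacity p z).untopD 0 - c.level z (I.pol r')) / c.rate H p I z (I.pol r') := by
      unfold waitingTime
      rw [h1]
    rw [h5, mul_div_cancel₀ _ h4, ← hw, WithTop.untopD_coe]
    congr 1
    ring
  have hτ0 : 0 ≤ τ := by
    rcases (Finset.mem_filter.mp hrF).2 with h | ⟨z, h1, h2, h3⟩
    · have h5 : waitingTime H p I c r = I.arrival r - c.time := by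
        unfold waitingTime
        rw [h]
      rw [hτ, h5]
      exact sub_nonneg.mpr (hv.le_arrival r h)
    · have h4 := hfull r z h1 h2 h3
      have h5 := hv.level_le z (I.pol r) _ (hv.onPath r z h1)
      rw [h4] at h5
      have h6 := WithTop.coe_le_coe.mp h5
      have h7 := rate_pos hv h2
      by_contra! hneg
      nlinarith
  -- the configuration after time `τ`
  set c' : Config T R := { c with
    time := c.time + τ
    level := fun z s => c.level z s + c.rate H p I z s * τ } with hc'
  refine ⟨c', ?_, rfl, r, ?_⟩
  · rcases hτ0.eq_or_lt with h0 | h0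
    · have : c' = c := by
        rw [hc', ← h0]
        simp
      rw [this]
      exact Relation.ReflTransGen.refl
    · refine Relation.ReflTransGen.single (Step.elapse c τ h0 (fun r' hr' => ?_) hm ?_)
      · have h1 := hmin r' (Finset.mem_filter.mpr ⟨Finset.mem_univ _, Or.inl hr'⟩)
        have h2 : waitingTime H p I c r' = I.arrival r' - c.time := by
          unfold waitingTime
          rw [hr']
        rw [h2] at h1
        linarith
      · intro z s hinc
        by_cases hcap : H.capacity p z = ⊤
        · rw [hcap]
          exact le_top
        · obtain ⟨r', hr', rfl⟩ := hinc.1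
          have h1 := hmin r' (Finset.mem_filter.mpr
            ⟨Finset.mem_univ _, Or.inr ⟨z, hr', hinc, hcap⟩⟩)
          rw [hfull r' z hr' hinc hcap]
          exact WithTop.coe_le_coe.mpr (by
            have := mul_le_mul_of_nonneg_left h1 (rate_pos hv hinc).le
            linarith)
  · rcases (Finset.mem_filter.mp hrF).2 with h | ⟨z, h1, h2, h3⟩
    · left
      refine ⟨h, ?_⟩
      have h5 : waitingTime H p I c r = I.arrival r - c.time := by
        unfold waitingTime
        rw [h]
      change c.time + τ = _
      rw [hτ, h5]
      ring
    · right
      exact ⟨z, h1, h2, (hfull r z h1 h2 h3).symm⟩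

/-- Since the cost of a run is bounded, the requests move only boundedly far. -/
lemma exists_position_bound (H : WeightedHST 2 T) (p : PiecewiseLinearDelay)
    (I : RequestSequence T R) :
    ∃ N : ℕ, ∀ c, Reachable H p I c → ∀ r z, c.status r = .waiting z →
      H.position p (I.loc r) z ≤ N := by
  obtain ⟨S, -⟩ := exists_solution I
  obtain ⟨K, hK⟩ := p.exists_index_bound
    (24 * S.connectionCost H + (9 * treeHeight T + 54) * S.delayCost p.f)
  refine ⟨K + Fintype.card T, fun c hc r z hr => ?_⟩
  have hv := hc.isValid
  have hz := hv.onPath r z hr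
  have hnn : ∀ r' ∈ Finset.univ, 0 ≤ requestCost H p I c.time r' (c.status r') := by
    intro r' _
    rcases hst : c.status r' with _ | z' | ⟨r₁, t⟩
    · exact le_rfl
    · have hz' := hv.onPath r' z' hst
      have h1 : I.arrival r' ≤ c.time := hv.arrival_le r' (by simp [hst])
      exact add_nonneg (add_nonneg (p.f_x_nonneg hz'.index_lt)
        (mul_nonneg (slope_pos_of_onPath hz').le (sub_nonneg.mpr h1))) (sum_edgesBelow_nonneg _ _)
    · exact add_nonneg (p.f_nonneg (sub_nonneg.mpr (hv.matched r' r₁ t hst).2.2))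
        (div_nonneg (H.dist_nonneg _ _) (by norm_num))
  have h1 := Finset.single_le_sum hnn (Finset.mem_univ r)
  have h2 := (hc.invariant S).sum_requestCost_le
  have h3 : p.f (p.x (H.index p z)) ≤ requestCost H p I c.time r (c.status r) := by
    rw [hr]
    have h4 := mul_nonneg (slope_pos_of_onPath hz).le
      (sub_nonneg.mpr (hv.arrival_le r (by simp [hr])))
    have h5 := sum_edgesBelow_nonneg (H := H) z.vertex (I.loc r)
    simp only [requestCost]
    linarith
  exact add_le_add (hK _ hz.index_lt (by linarith)) (Finset.card_le_univ _)

/-- The number of arrivals, moves and matches that a request may still have to go through, if its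
position on its path never exceeds `N`. -/
noncomputable def remaining (H : WeightedHST 2 T) (p : PiecewiseLinearDelay)
    (I : RequestSequence T R) (N : ℕ) (r : R) : Status T R → ℕ
  | .future => N + 2
  | .waiting z => N + 1 - H.position p (I.loc r) z
  | .matched _ _ => 0

lemma sum_remaining_update_lt [DecidableEq R] {N : ℕ} {c : Config T R} {r : R} {st : Status T R}
    (h : remaining H p I N r st < remaining H p I N r (c.status r)) :
    ∑ r', remaining H p I N r' (Function.update c.status r st r') <
      ∑ r', remaining H p I N r' (c.status r') := by
  refine Finset.sum_lt_sum (fun r' _ => ?_) ⟨r, Finset.mem_univ r, ?_⟩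
  · by_cases he : r' = r
    · subst he
      rw [Function.update_self]
      exact h.le
    · rw [Function.update_of_ne he]
  · rw [Function.update_self]
    exact h

/-- A run that has not matched all requests can be continued so that fewer arrivals, moves and
matches remain. -/
lemma exists_progress {N : ℕ} (hN : ∀ c, Reachable H p I c → ∀ r z, c.status r = .waiting z →
      H.position p (I.loc r) z ≤ N) {c : Config T R} (hc : Reachable H p I c)
    (hnot : ∃ r, ∀ r' t, c.status r ≠ .matched r' t) :
    ∃ c', Steps H p I c c' ∧ ∑ r, remaining H p I N r (c'.status r) <
      ∑ r, remaining H p I N r (c.status r) := by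
  classical
  by_cases hm : c.NoMatchable I
  · obtain ⟨c₁, hs, hst, r, hdue⟩ := exists_due hc hm hnot
    have hc₁ : Reachable H p I c₁ := Relation.ReflTransGen.trans hc hs
    rw [← hst]
    rcases hdue with ⟨h1, h2⟩ | ⟨z, h1, h2, h3⟩
    · refine ⟨_, hs.tail (Step.arrive c₁ r h1 h2), sum_remaining_update_lt ?_⟩
      rw [h1]
      simp only [remaining, position_entry]
      omega
    · have hopp : ¬ c₁.Occupied I z (-I.pol r) := by
        refine NoMatchable.not_occupied_neg ?_ ⟨r, h1, rfl⟩
        unfold NoMatchable Occupied at hm ⊢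
        rwa [hst]
      have hstep := Step.move c₁ r z h1 h2 hopp h3
      refine ⟨_, hs.tail hstep, sum_remaining_update_lt ?_⟩
      have h4 := hN _ (hc₁.tail hstep) r (H.next p z) (by simp)
      have h5 := (hc₁.isValid.onPath r z h1).position_next
      rw [h1]
      simp only [remaining]
      omega
  · unfold NoMatchable at hm
    push Not at hm
    obtain ⟨z, ⟨r, hr, hpr⟩, ⟨r', hr', hpr'⟩⟩ := hm
    have hpol : I.pol r' = -I.pol r := by rw [hpr, hpr']
    have hne : r' ≠ r := by
      rintro rfl
      exact units_ne_neg_self _ hpol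
    refine ⟨_, Relation.ReflTransGen.single (Step.pair c r r' z hr hr' hpol), ?_⟩
    have h1 := hN c hc r z hr
    have h2 := hN c hc r' z hr'
    have h3 : ∑ r₁, remaining H p I N r₁ (Function.update c.status r (.matched r' c.time) r₁) <
        ∑ r₁, remaining H p I N r₁ (c.status r₁) := by
      refine sum_remaining_update_lt ?_
      rw [hr]
      simp only [remaining]
      omega
    refine lt_trans (sum_remaining_update_lt (c := { c with
      status := Function.update c.status r (.matched r' c.time) }) ?_) h3
    simp only [Function.update_of_ne hne, hr', remaining]
    omega

/-- Every run can be continued until all requests are matched. -/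
lemma exists_all_matched {c : Config T R} (hc : Reachable H p I c) :
    ∃ c', Steps H p I c c' ∧ ∀ r, ∃ r' t, c'.status r = .matched r' t := by
  obtain ⟨N, hN⟩ := exists_position_bound H p I
  induction hn : ∑ r, remaining H p I N r (c.status r) using Nat.strong_induction_on
    generalizing c with
  | _ n ih =>
    by_cases hall : ∀ r, ∃ r' t, c.status r = .matched r' t
    · exact ⟨c, Relation.ReflTransGen.refl, hall⟩
    · push Not at hall
      obtain ⟨c₁, hs, hlt⟩ := exists_progress hN hc hall
      obtain ⟨c', hs', h⟩ := ih _ (hn ▸ hlt) (Relation.ReflTransGen.trans hc hs) rfl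
      exact ⟨c', Relation.ReflTransGen.trans hs hs', h⟩

end Config

end ConcaveMatching

theorem mainTheorem3 :
    ∃ C : ℝ, 0 < C ∧
      ∀ (D : ℝ → ℝ), ConcaveMatching.IsDelayFunction D →
        (∃ p : ConcaveMatching.PiecewiseLinearDelay, p.Approximates D) ∧
        ∀ p : ConcaveMatching.PiecewiseLinearDelay, p.Approximates D →
          ∀ (T : RootedTree) [Fintype T] (H : ConcaveMatching.WeightedHST 2 T),
            1 ≤ ConcaveMatching.treeHeight T →
            ∀ (R : Type*) [Fintype R] (I : ConcaveMatching.RequestSequence T R),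
              (∀ c, ConcaveMatching.Config.Reachable H p I c →
                ∃ c', ConcaveMatching.Config.Steps H p I c c' ∧
                  ∃ A : ConcaveMatching.Solution I, c'.Yields A) ∧
              ∀ c, ConcaveMatching.Config.Reachable H p I c →
                ∀ A : ConcaveMatching.Solution I, c.Yields A →
                  ∀ S : ConcaveMatching.Solution I,
                    A.cost H D ≤ C * S.connectionCost H +
                      C * (ConcaveMatching.treeHeight T : ℝ) * S.delayCost D := by
  refine ⟨126, by norm_num, fun D hD => ⟨hD.exists_approximates, ?_⟩⟩
  intro p hp T _ H hh R _ I
  refine ⟨fun c hc => ?_, fun c hc A hA S => hA.cost_le (hc.invariant S) hp hh⟩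
  obtain ⟨c', hs, hall⟩ := ConcaveMatching.Config.exists_all_matched hc
  have hc' : ConcaveMatching.Config.Reachable H p I c' := Relation.ReflTransGen.trans hc hs
  exact ⟨c', hs, hc'.isValid.exists_yields hall⟩
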